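/- **Setting.** Let $N_C \ni \top,\bot$ and $N_R$ be countably infinite sets of concept names and role names. A TBox is a finite set $\mathcal T$ of axioms, each translated into a rule as follows ($A,A_i,B\in N_C$, $R,S,V\in N_R$): $A_1\sqcap\dots\sqcap A_m\sqsubseteq B$ ($m\ge 1$) gives $A_1(x)\wedge\dots\wedge A_m(x)\to B(x)$; $A\sqsubseteq\forall R.B$ gives $A(x)\wedge R(x,y)\to B(y)$; $A\sqsubseteq{\le}1R.B$ gives $A(x)\wedge R(x,y)\wedge B(y)\wedge R(x,z)\wedge B(z)\to y\approx z$; $A\sqsubseteq\exists R.B$ gives $A(x)\to\exists y[R(x,y)\wedge B(y)]$; $S\sqsubseteq R$ gives $S(x,y)\to R(x,y)$; $S^-\sqsubseteq R$ gives $S(y,x)\to R(x,y)$; $S\circ V\sqsubseteq R$ gives $S(x,y)\wedge V(y,z)\to R(x,z)$. Let $\mathcal R_{\mathcal T}$ consist of these rules and, for every predicate $p$ occurring in them, the rule $p(\vec x)\to\bigwedge_i\top(x_i)$. Rules with head $y\approx z$ are EGDs, the others TGDs. Each $\rho=A(x)\to\exists y[R(x,y)\wedge B(y)]$ has its own unary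 (Skolem) function symbol $f_\rho$. Terms are built from constants (a special constant $\star$ and the individuals) by these symbols. $\mathrm{dep}(c)=0$ for a constant $c$, and $\mathrm{dep}(f_\rho(t))=\mathrm{dep}(t)+1$. A fact is a ground atom. A term $t$ is $n$-cyclic if there are terms $f(s_1),\dots,f(s_{n+1})$, with the same function symbol $f$, such that $f(s_{n+1})$ is a subterm of $t$ and each $f(s_i)$, $i\le n$, is a proper subterm of $f(s_{i+1})$. **Restricted chase.** Fix a total strict order $\succ$ on terms such that $t\succ u$ implies $\mathrm{dep}(t)\le\mathrm{dep}(u)$, and such that, given two terms $t,u$ written as words, it is decidable in exponential time whether $t\succ u$. For a set $\mathcal R$ of rules and a set $F$ of facts, let $\mathcal R^\approx(F)$ arise from $F$ by replacing every term by the $\succ$-greatest term congruent to it, under the least congruence on terms that identifies $y\sigma$ with $z\sigma$ for all EGDs $\beta\to y\approx z$ in $\mathcal R$ and substitutions $\sigma$ with $\beta\sigma\subseteq F$. Let $\mathcal R^\forall_R(F)$ (resp. $\mathcal R^\exists_R(F)$) be the union of $F$ and of all skolemized heads $\eta\sigma$ of TGDs in $\mathcal R$ without (resp. with) an existential variable,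 where the body of the rule under $\sigma$ is contained in $F$ and no extension of $\sigma$ maps the unskolemized head into $F$. The restricted chase of a program $\langle\mathcal R,I\rangle$ is $\bigcup_i F_i$, where $F_0=I$ and $F_{i+1}$ is $\mathcal R^\approx(F_i)$ if this differs from $F_i$; otherwise $\mathcal R^\forall_R(F_i)$ if this differs from $F_i$; otherwise $\mathcal R^\exists_R(F_i)$. **Restricted terms.** For $\rho = A(x)\to\exists y[R(x,y)\wedge B(y)]$ let $I(f_\rho(s))=\{A(s),R(s,f_\rho(s)),B(f_\rho(s))\}\cup I(s)$; for a constant $c$ let $I(c)=\emptyset$. Let $\mathrm{RT}(\mathcal T,s)$ be the program that consists of all rules of $\mathcal R_{\mathcal T}$ without existential variables and of the instance $I(s)$. The term $f_\rho(s)$ is restricted w.r.t. $\mathcal T$ if $R([s],u)$ and $B(u)$ are in the restricted chase of $\mathrm{RT}(\mathcal T,s)$ for some term $u$, where $[s]$ is the term that $s$ has finally become by the replacements in this chase. **Overchase and $\mathrm{RCA}_n$.** $\mathcal V_{\mathcal T}$ is the least set of facts that contains $p(\star,\dots,\star)$ for all predicates $p$ occurring in TGDs of $\mathcal R_{\mathcal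 T}$ and is closed under: (∀) applying the TGDs of $\mathcal R_{\mathcal T}$ without existential variables; (∃) adding $R(t,f_\rho(t))$ and $B(f_\rho(t))$ if $\rho=A(x)\to\exists y[R(x,y)\wedge B(y)]\in\mathcal R_{\mathcal T}$, $A(t)\in\mathcal V_{\mathcal T}$ and $f_\rho(t)$ is not restricted; (≈) adding $\mathit{Eq}(y\sigma,z\sigma)$ and $\mathit{Eq}(z\sigma,y\sigma)$ if $\beta\to y\approx z\in\mathcal R_{\mathcal T}$ is an EGD and $\beta\sigma\subseteq\mathcal V_{\mathcal T}$; (Eq) adding $p(u_1,\dots,u_k)[u/t]$ (every occurrence of $u$ replaced by $t$) if $p\ne\mathit{Eq}$, $\mathit{Eq}(t,u),p(u_1,\dots,u_k)\in\mathcal V_{\mathcal T}$, $\mathrm{dep}(t)\le\mathrm{dep}(u)$ and $u=u_j$ for some $j$. The TBox $\mathcal T$ is $\mathrm{RCA}_n$ if no $n$-cyclic term occurs in $\mathcal V_{\mathcal T}$. **Theorem.** For every fixed $n\in\mathbb N$, deciding whether a given TBox $\mathcal T$ is $\mathrm{RCA}_n$ is in ExpTime: there are a Turing machine and a polynomial $p$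 such that the machine, given $\mathcal T$ written as a word of length $\ell$ over a finite alphabet (names in binary), decides within $2^{p(\ell)}$ steps whether $\mathcal T$ is $\mathrm{RCA}_n$. -/

import Mathlib

/-! ### Exponential time -/

/-- The problem `L` on `α`, with instances written as words by `enc`, is in ExpTime: a finite
multi-stack (multi-tape) Turing machine outputs the truth value of `L a` on input `enc a` within
`2 ^ p(|enc a|)` steps, for some polynomial `p`. -/
def InExpTime {α Γ : Type} (enc : α → List Γ) (L : α → Prop) : Prop :=
  ∃ (f : α → Bool) (M : Turing.TM2ComputableInTime enc Computability.encodeBool f)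
    (p : Polynomial ℕ),
    (∀ a, f a = true ↔ L a) ∧ ∀ m, M.time m ≤ 2 ^ p.eval m

namespace HornSRIQ

/-! ### TBoxes -/

/-- Concept names; `⊤` and `⊥` are two of them. -/
inductive ConceptName
  | top
  | bot
  | name (k : ℕ)
  deriving DecidableEq

/-- Role names. -/
abbrev RoleName := ℕ

/-- The existential axiom `A ⊑ ∃ R . B`. -/
structure ExAxiom where
  A : ConceptName
  R : RoleName
  B : ConceptName
  deriving DecidableEq

/-- TBox axioms in normal form. -/
inductive TBoxAxiom
  /-- `A ⊓ A₂ ⊓ … ⊓ Aₙ ⊑ B`, where `As` is the list `A₂, …, Aₙ` -/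
  | conj (A : ConceptName) (As : List ConceptName) (B : ConceptName)
  /-- `A ⊑ ∀ R . B` -/
  | all (A : ConceptName) (R : RoleName) (B : ConceptName)
  /-- `A ⊑ ≤ 1 R . B` -/
  | atMostOne (A : ConceptName) (R : RoleName) (B : ConceptName)
  /-- `A ⊑ ∃ R . B` -/
  | ex (ρ : ExAxiom)
  /-- `S ⊑ R` -/
  | subRole (S R : RoleName)
  /-- `S⁻ ⊑ R` -/
  | invRole (S R : RoleName)
  /-- `S ∘ V ⊑ R` -/
  | comp (S V R : RoleName)
  deriving DecidableEq

/-! ### Terms and atoms -/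

/-- Constants: the special constant `⋆` and the individuals. -/
inductive Const
  | star
  | ind (k : ℕ)
  deriving DecidableEq

/-- Ground terms. A TGD `ρ = A(x) → ∃ y [R(x, y) ∧ B(y)]` is skolemized with one unary function
symbol that is unique for `ρ`; it is identified with the axiom `A ⊑ ∃ R . B`, and `app ρ t` is the
result of applying it to `t`. -/
inductive Term
  | const (c : Const)
  | app (ρ : ExAxiom) (t : Term)
  deriving DecidableEq

namespace Term

/-- The constant `⋆` as a term. -/
def star : Term := const Const.star

/-- The depth of a term. -/
def depth : Term → ℕ
  | const _ => 0
  | app _ t => t.depth + 1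

/-- `Subterm s t`: `s` is a subterm of `t`. -/
inductive Subterm (s : Term) : Term → Prop
  | refl : Subterm s s
  | app (ρ : ExAxiom) (t : Term) : Subterm s t → Subterm s (app ρ t)

/-- `ProperSubterm s t`: `s` is a proper subterm of `t`. -/
def ProperSubterm (s t : Term) : Prop := Subterm s t ∧ s ≠ t

/-- `t` is `n`-cyclic: there are terms `f(s₀), …, f(sₙ)`, with the same `f`, each one a proper
subterm of the next, the last one a subterm of `t`. -/
def Cyclic (n : ℕ) (t : Term) : Prop :=
  ∃ (ρ : ExAxiom) (s : ℕ → Term),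
    Subterm (app ρ (s n)) t ∧ ∀ i < n, ProperSubterm (app ρ (s i)) (app ρ (s (i + 1)))

/-- `replace u t s` is `s` with every occurrence of `u` replaced by `t`. -/
def replace (u t : Term) : Term → Term
  | const c => if const c = u then t else const c
  | app ρ s => if app ρ s = u then t else app ρ (replace u t s)

end Term

/-- Atoms over arguments from `τ`; `eq` is the special predicate `Eq`. -/
inductive Atom (τ : Type)
  | concept (A : ConceptName) (t : τ)
  | role (R : RoleName) (t u : τ)
  | eq (t u : τ)
  deriving DecidableEq

namespace Atom

/-- Apply `σ` to every argument. -/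
def map {τ υ : Type} (σ : τ → υ) : Atom τ → Atom υ
  | concept A t => concept A (σ t)
  | role R t u => role R (σ t) (σ u)
  | eq t u => eq (σ t) (σ u)

/-- The arguments of an atom. -/
def args {τ : Type} : Atom τ → List τ
  | concept _ t => [t]
  | role _ t u => [t, u]
  | eq t u => [t, u]

/-- The predicate of the atom is not `Eq`. -/
def EqFree {τ : Type} : Atom τ → Prop
  | eq _ _ => False
  | _ => True

end Atom

/-- Facts are ground atoms. -/
abbrev Fact := Atom Term

/-! ### Rules -/

/-- The variables `x = 0`, `y = 1`, `z = 2`; the rules of a TBox need no others. -/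
abbrev Var := Fin 3

/-- The rules that arise from TBoxes. -/
inductive Rule
  /-- a TGD without existentially quantified variables -/
  | tgd (body head : List (Atom Var))
  /-- the TGD `A(x) → ∃ y [R(x, y) ∧ B(y)]` -/
  | ex (ρ : ExAxiom)
  /-- the EGD `body → v ≈ w` -/
  | egd (body : List (Atom Var)) (v w : Var)

namespace Rule

/-- The rule is a TGD, with or without existentially quantified variables. -/
def IsTGD : Rule → Prop
  | tgd _ _ => True
  | ex _ => True
  | egd _ _ _ => False

/-- The rule is a TGD with an existentially quantified variable. -/
def IsExistential : Rule → Prop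
  | ex _ => True
  | _ => False

/-- The atoms (other than equalities) in body and head of a rule. -/
def atoms : Rule → List (Atom Var)
  | tgd body head => body ++ head
  | ex ρ => [.concept ρ.A 0, .role ρ.R 0 1, .concept ρ.B 1]
  | egd body _ _ => body

end Rule

/-- The translation of TBox axioms into rules. -/
def TBoxAxiom.toRule : TBoxAxiom → Rule
  | conj A As B => .tgd ((A :: As).map fun C => .concept C 0) [.concept B 0]
  | all A R B => .tgd [.concept A 0, .role R 0 1] [.concept B 1]
  | atMostOne A R B =>
      .egd [.concept A 0, .role R 0 1, .concept B 1, .role R 0 2, .concept B 2] 1 2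
  | ex ρ => .ex ρ
  | subRole S R => .tgd [.role S 0 1] [.role R 0 1]
  | invRole S R => .tgd [.role S 1 0] [.role R 0 1]
  | comp S V R => .tgd [.role S 0 1, .role V 1 2] [.role R 0 2]

/-- The rule `p(x₁, …, xₙ) → ⊤(x₁) ∧ … ∧ ⊤(xₙ)` for the predicate `p` of an atom. -/
def topRule : Atom Var → Rule
  | .concept A _ => .tgd [.concept A 0] [.concept .top 0]
  | .role R _ _ => .tgd [.role R 0 1] [.concept .top 0, .concept .top 1]
  | .eq _ _ => .tgd [.eq 0 1] [.concept .top 0, .concept .top 1]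

/-- The rules of a TBox: the translations of its axioms and, since `⊤` is treated as an ordinary
predicate, the rules `p(x₁, …, xₙ) → ⊤(x₁) ∧ … ∧ ⊤(xₙ)` for all predicates `p` that occur. -/
def rulesOf (T : Set TBoxAxiom) : Set Rule :=
  {r | ∃ α ∈ T, r = α.toRule} ∪ {r | ∃ α ∈ T, ∃ a ∈ α.toRule.atoms, r = topRule a}

/-! ### The restricted chase -/

/-- `gt t u` (`t` is greater than `u`) is a total strict order over terms in which a term is never
greater than a term of smaller depth. -/
structure IsTermOrder (gt : Term → Term → Prop) : Prop where
  irrefl : ∀ t, ¬ gt t t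
  trans : ∀ t u v, gt t u → gt u v → gt t v
  total : ∀ t u, t ≠ u → gt t u ∨ gt u t
  depth_le : ∀ t u, gt t u → t.depth ≤ u.depth

/-- The result of restrictively applying a TGD to `F` (nothing, for an EGD). -/
def Rule.applyR (F : Set Fact) : Rule → Set Fact
  | .tgd body head => {φ | ∃ σ : Var → Term, (∀ a ∈ body, a.map σ ∈ F) ∧
      (∃ a ∈ head, φ = a.map σ) ∧ ¬ ∀ a ∈ head, a.map σ ∈ F}
  | .ex ρ => {φ | ∃ t : Term, .concept ρ.A t ∈ F ∧
      (φ = .role ρ.R t (.app ρ t) ∨ φ = .concept ρ.B (.app ρ t)) ∧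
      ¬ ∃ u : Term, .role ρ.R t u ∈ F ∧ .concept ρ.B u ∈ F}
  | .egd _ _ _ => ∅

/-- The result of restrictively applying the TGDs in `𝓡` without existential variables to `F`. -/
def applyUniv (𝓡 : Set Rule) (F : Set Fact) : Set Fact :=
  {φ | ∃ r ∈ 𝓡, ¬ r.IsExistential ∧ φ ∈ r.applyR F} ∪ F

/-- The result of restrictively applying the TGDs in `𝓡` with existential variables to `F`. -/
def applyEx (𝓡 : Set Rule) (F : Set Fact) : Set Fact :=
  {φ | ∃ r ∈ 𝓡, r.IsExistential ∧ φ ∈ r.applyR F} ∪ F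

/-- The least congruence over terms that contains every pair `(σ v, σ w)` such that some EGD
`body → v ≈ w` in `𝓡` satisfies `body σ ⊆ F`. -/
inductive Cong (𝓡 : Set Rule) (F : Set Fact) : Term → Term → Prop
  | egd (body : List (Atom Var)) (v w : Var) (σ : Var → Term) : Rule.egd body v w ∈ 𝓡 →
      (∀ a ∈ body, a.map σ ∈ F) → Cong 𝓡 F (σ v) (σ w)
  | refl (t : Term) : Cong 𝓡 F t t
  | symm {t u : Term} : Cong 𝓡 F t u → Cong 𝓡 F u t
  | trans {t u v : Term} : Cong 𝓡 F t u → Cong 𝓡 F u v → Cong 𝓡 F t v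
  | app (ρ : ExAxiom) {t u : Term} : Cong 𝓡 F t u → Cong 𝓡 F (.app ρ t) (.app ρ u)

/-- `u` is the greatest term that is congruent to `t`. -/
def IsRep (gt : Term → Term → Prop) (𝓡 : Set Rule) (F : Set Fact) (t u : Term) : Prop :=
  Cong 𝓡 F t u ∧ ∀ u', Cong 𝓡 F t u' → u' ≠ u → gt u u'

/-- The result of applying the EGDs in `𝓡` to `F`: every term is replaced by the greatest term
that is congruent to it. -/
def applyEGD (gt : Term → Term → Prop) (𝓡 : Set Rule) (F : Set Fact) : Set Fact :=
  {φ | (∃ A t t', .concept A t ∈ F ∧ IsRep gt 𝓡 F t t' ∧ φ = .concept A t') ∨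
    (∃ R t t' u u', .role R t u ∈ F ∧ IsRep gt 𝓡 F t t' ∧ IsRep gt 𝓡 F u u' ∧
      φ = .role R t' u') ∨
    (∃ t t' u u', .eq t u ∈ F ∧ IsRep gt 𝓡 F t t' ∧ IsRep gt 𝓡 F u u' ∧ φ = .eq t' u')}

open Classical in
/-- One step of the restricted chase sequence of a program with rules `𝓡`. -/
noncomputable def chaseStep (gt : Term → Term → Prop) (𝓡 : Set Rule) (F : Set Fact) : Set Fact :=
  if applyEGD gt 𝓡 F ≠ F then applyEGD gt 𝓡 F
  else if applyUniv 𝓡 F ≠ F then applyUniv 𝓡 F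
  else applyEx 𝓡 F

/-- The restricted chase sequence of the program `⟨𝓡, I⟩`. -/
noncomputable def chaseSeq (gt : Term → Term → Prop) (𝓡 : Set Rule) (I : Set Fact) :
    ℕ → Set Fact
  | 0 => I
  | i + 1 => chaseStep gt 𝓡 (chaseSeq gt 𝓡 I i)

/-- The restricted chase of the program `⟨𝓡, I⟩`. -/
def chase (gt : Term → Term → Prop) (𝓡 : Set Rule) (I : Set Fact) : Set Fact :=
  ⋃ i, chaseSeq gt 𝓡 I i

/-- `ReplacedAt gt 𝓡 I s i v`: following the replacements of terms in the first `i` steps of the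
restricted chase sequence of `⟨𝓡, I⟩`, the term `s` has become `v`. -/
def ReplacedAt (gt : Term → Term → Prop) (𝓡 : Set Rule) (I : Set Fact) (s : Term) :
    ℕ → Term → Prop
  | 0, v => v = s
  | i + 1, v => ∃ w, ReplacedAt gt 𝓡 I s i w ∧
      ((applyEGD gt 𝓡 (chaseSeq gt 𝓡 I i) ≠ chaseSeq gt 𝓡 I i ∧
          IsRep gt 𝓡 (chaseSeq gt 𝓡 I i) w v) ∨
        (applyEGD gt 𝓡 (chaseSeq gt 𝓡 I i) = chaseSeq gt 𝓡 I i ∧ v = w))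

/-- `FinalTerm gt 𝓡 I s v` says `v = [s]`: it is the term that `s` has eventually become during
the restricted chase sequence of `⟨𝓡, I⟩`. -/
def FinalTerm (gt : Term → Term → Prop) (𝓡 : Set Rule) (I : Set Fact) (s v : Term) : Prop :=
  ∃ i, ∀ j ≥ i, ReplacedAt gt 𝓡 I s j v

/-! ### Restricted terms, the overchase and RCA -/

/-- The instance `I(t)`. -/
def termInstance : Term → Set Fact
  | .const _ => ∅
  | .app ρ s =>
      {.concept ρ.A s, .role ρ.R s (.app ρ s), .concept ρ.B (.app ρ s)} ∪ termInstance s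

/-- The rules of `T` without existential variables: the rules of the program `RT(T, t)`, whose
instance is `I(t)`. -/
def nonExistentialRules (T : Set TBoxAxiom) : Set Rule :=
  {r | r ∈ rulesOf T ∧ ¬ r.IsExistential}

/-- The term `app ρ s` is restricted with respect to `T`. -/
def Restricted (gt : Term → Term → Prop) (T : Set TBoxAxiom) (ρ : ExAxiom) (s : Term) : Prop :=
  ∃ v u, FinalTerm gt (nonExistentialRules T) (termInstance s) s v ∧
    .role ρ.R v u ∈ chase gt (nonExistentialRules T) (termInstance s) ∧
    .concept ρ.B u ∈ chase gt (nonExistentialRules T) (termInstance s)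

/-- The set `V_T`: the least set of facts that contains the critical instance of the rules of `T`
and is closed under the expansion rules. (A TGD without existential variables has the same
effect on a set `V` under restricted application joined with `V` as under plain application.) -/
inductive Overchase (gt : Term → Term → Prop) (T : Set TBoxAxiom) : Fact → Prop
  /-- the critical instance: all `p(⋆, …, ⋆)` for predicates `p` that occur in a TGD -/
  | critical (r : Rule) (a : Atom Var) : r ∈ rulesOf T → r.IsTGD → a ∈ r.atoms →
      Overchase gt T (a.map fun _ => Term.star)
  /-- the ∀-rule -/
  | univ (body head : List (Atom Var)) (σ : Var → Term) (a : Atom Var) :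
      Rule.tgd body head ∈ rulesOf T → (∀ b ∈ body, Overchase gt T (b.map σ)) → a ∈ head →
      Overchase gt T (a.map σ)
  /-- the ∃-rule, role atom -/
  | exRole (ρ : ExAxiom) (t : Term) : Rule.ex ρ ∈ rulesOf T → Overchase gt T (.concept ρ.A t) →
      ¬ Restricted gt T ρ t → Overchase gt T (.role ρ.R t (.app ρ t))
  /-- the ∃-rule, concept atom -/
  | exConcept (ρ : ExAxiom) (t : Term) : Rule.ex ρ ∈ rulesOf T →
      Overchase gt T (.concept ρ.A t) → ¬ Restricted gt T ρ t →
      Overchase gt T (.concept ρ.B (.app ρ t))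
  /-- the ≈-rule -/
  | egd (body : List (Atom Var)) (v w : Var) (σ : Var → Term) :
      Rule.egd body v w ∈ rulesOf T → (∀ b ∈ body, Overchase gt T (b.map σ)) →
      Overchase gt T (.eq (σ v) (σ w))
  /-- the ≈-rule, the symmetric fact -/
  | egdSymm (body : List (Atom Var)) (v w : Var) (σ : Var → Term) :
      Rule.egd body v w ∈ rulesOf T → (∀ b ∈ body, Overchase gt T (b.map σ)) →
      Overchase gt T (.eq (σ w) (σ v))
  /-- the Eq-rule -/
  | eqRule (t u : Term) (a : Fact) : a.EqFree → Overchase gt T (.eq t u) → Overchase gt T a →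
      t.depth ≤ u.depth → u ∈ a.args → Overchase gt T (a.map (Term.replace u t))

/-- The TBox `T` is `RCA_n`: no `n`-cyclic term occurs in the set `V_T`. -/
def RCA (gt : Term → Term → Prop) (n : ℕ) (T : Set TBoxAxiom) : Prop :=
  ∀ φ, Overchase gt T φ → ∀ t ∈ φ.args, ¬ t.Cyclic n

/-! ### Encodings as words; names are written in binary -/

/-- The alphabet. -/
inductive Sym
  | bit (b : Bool)
  | comma
  | semi
  deriving DecidableEq, Fintype

/-- A number in binary, least significant bit first, closed by a comma. -/
def encodeNat (k : ℕ) : List Sym := k.bits.map Sym.bit ++ [Sym.comma]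

/-- A list of numbers, closed by a semicolon. -/
def encodeNats (l : List ℕ) : List Sym := l.flatMap encodeNat ++ [Sym.semi]

/-- Numbering of the concept names. -/
def ConceptName.code : ConceptName → ℕ
  | top => 0
  | bot => 1
  | name k => k + 2

/-- An axiom as a list of numbers: its kind, then its names. -/
def TBoxAxiom.codes : TBoxAxiom → List ℕ
  | conj A As B => 0 :: B.code :: A.code :: As.map ConceptName.code
  | all A R B => [1, A.code, R, B.code]
  | atMostOne A R B => [2, A.code, R, B.code]
  | ex ρ => [3, ρ.A.code, ρ.R, ρ.B.code]
  | subRole S R => [4, S, R]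
  | invRole S R => [5, S, R]
  | comp S V R => [6, S, V, R]

/-- A finite TBox, given by a list of its axioms, as a word. -/
def encodeTBox (T : List TBoxAxiom) : List Sym := T.flatMap fun α => encodeNats α.codes

/-- A term as a list of numbers: its function symbols from the outside in, then its constant. -/
def Term.codes : Term → List ℕ
  | const .star => [0]
  | const (.ind k) => [k + 1]
  | app ρ t => ρ.A.code :: ρ.R :: ρ.B.code :: t.codes

/-- A pair of terms as a word. -/
def encodeTermPair (p : Term × Term) : List Sym := encodeNats p.1.codes ++ encodeNats p.2.codes

end HornSRIQ

/-!
The theorem combines a mathematical reduction to finitely many terms with an explicit Turing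
machine.

Reduction. A term over `m` function symbols that is not `n`-cyclic contains each symbol at most `n`
times, so its depth is at most `n * m` (`length_le_of_not_cyclic`). All terms in the overchase are
built from `⋆` and the symbols of the TBox, and its rules increase depths by at most one; the
Eq-rule replaces terms by terms that are no deeper. So if no `n`-cyclic term is derived by rule
applications inside the finite set of terms of depth at most `n * m + 1`, then no rule application
leaves this set, and the overchase can be computed by saturation (`accept_iff`). There are
exponentially many such terms and facts.

Restricted terms. The rules of the program `RT(T, s)` introduce no terms, and replacing a term by
the greatest congruent one does not increase its depth, so this chase also stays inside the finite
set. The congruence is infinite, but its restriction to a set of terms that is closed under subterms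
is generated inside this set (`Cong.of_closed`), because normal forms with respect to the restricted
relation extend to all terms. Each step of the chase that changes something either replaces two
terms by the same one or adds a fact without adding terms (`weight_step`). Hence the chase becomes
stationary after polynomially many steps in the number of facts, which are simulated (`restr_iff`).
All in all, `RCA_n` is decided in time polynomial in the table of all terms, all facts and the term
order on these terms.

Machines. The decision procedure is a program over binary trees that are kept, in preorder, on a
stack of a multi-stack machine. Machines are closed under composition, branching and loops, and
`Comp aux m f` says that `f` is computed within a polynomial (`m = .poly`) or exponential
(`m = .exp`) bound for time and output. The class `Poly` contains the usual list functions, whence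
the procedure is in it once the tables are given (`Poly.accept`). The tables are computed in
exponential time: the terms by iterated extension (`Comp.termsOver`), the term order by running the
given machine for `gt`, embedded with its own stacks, on each pair of terms (`comp_oracle`,
`Comp.collect`). As these terms have polynomial size, each run takes exponential time only.
-/

open Turing HornSRIQ

namespace StackMachine

/-! ### Structured stack machines -/

section Mach

variable {K : Type} [DecidableEq K] {Γ : K → Type} {σ : Type}

/-- A code with finitely many labels for a multi-stack machine; halting means reaching its exit. -/
structure Mach (Γ : K → Type) (σ : Type) where
  /-- the labels -/
  Λ : Type
  /-- there are finitely many labels -/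
  fin : Fintype Λ
  /-- the entry -/
  main : Λ
  /-- the statement of each label -/
  code : Λ → TM2.Stmt Γ Λ σ

/-- The statement with jump targets renamed by `e`, and with `x` in place of halting. -/
def relabel {Λ Λ' : Type} (e : Λ → Λ') (x : TM2.Stmt Γ Λ' σ) :
    TM2.Stmt Γ Λ σ → TM2.Stmt Γ Λ' σ
  | .push k f q => .push k f (relabel e x q)
  | .peek k f q => .peek k f (relabel e x q)
  | .pop k f q => .pop k f (relabel e x q)
  | .load f q => .load f (relabel e x q)
  | .branch f q₁ q₂ => .branch f (relabel e x q₁) (relabel e x q₂)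
  | .goto f => .goto fun v => e (f v)
  | .halt => x

/-- Executing `q` from the given state and stacks, and then the code `m` as far as `q` jumps to
it, halts within `n` steps with the last two arguments as state and stacks. -/
inductive Runs {Λ : Type} (m : Λ → TM2.Stmt Γ Λ σ) :
    TM2.Stmt Γ Λ σ → σ → (∀ k, List (Γ k)) → σ → (∀ k, List (Γ k)) → ℕ → Prop
  | halt {q v S v' S'} (n : ℕ) : TM2.stepAux q v S = ⟨none, v', S'⟩ → Runs m q v S v' S' (n + 1)
  | step {q v S l v₁ S₁ v' S' n} : TM2.stepAux q v S = ⟨some l, v₁, S₁⟩ →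
      Runs m (m l) v₁ S₁ v' S' n → Runs m q v S v' S' (n + 1)

theorem Runs.mono {Λ : Type} {m : Λ → TM2.Stmt Γ Λ σ} {q v S v' S' n n'}
    (h : Runs m q v S v' S' n) (hn : n ≤ n') : Runs m q v S v' S' n' := by
  induction h generalizing n' with
  | halt n h =>
    obtain ⟨k, rfl⟩ : ∃ k, n' = k + 1 := ⟨n' - 1, by omega⟩
    exact .halt k h
  | step h _ ih =>
    obtain ⟨k, rfl⟩ : ∃ k, n' = k + 1 := ⟨n' - 1, by omega⟩
    exact .step h (ih (by omega))

theorem stepAux_relabel {Λ Λ' : Type} (e : Λ → Λ') (x : TM2.Stmt Γ Λ' σ) (q : TM2.Stmt Γ Λ σ)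
    (v : σ) (S : ∀ k, List (Γ k)) :
    TM2.stepAux (relabel e x q) v S =
      (TM2.stepAux q v S).l.elim (TM2.stepAux x (TM2.stepAux q v S).var (TM2.stepAux q v S).stk)
        fun l => ⟨some (e l), (TM2.stepAux q v S).var, (TM2.stepAux q v S).stk⟩ := by
  induction q generalizing v S with
  | branch f q₁ q₂ ih₁ ih₂ => simp only [relabel, TM2.stepAux]; cases f v <;> simp [ih₁, ih₂]
  | _ => simp_all [relabel, TM2.stepAux]

theorem Runs.of_stepAux_eq {Λ : Type} {m : Λ → TM2.Stmt Γ Λ σ} {q q' v S v₀ S₀ v' S' n}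
    (h : Runs m q v S v' S' n) (hq : TM2.stepAux q' v₀ S₀ = TM2.stepAux q v S) :
    Runs m q' v₀ S₀ v' S' n := by
  cases h with
  | halt n h => exact .halt n (hq.trans h)
  | step h h' => exact .step (hq.trans h) h'

/-- A run of a code that has been embedded into another one by `relabel`, followed by a run from
its exit. -/
theorem Runs.relabel {Λ Λ' : Type} {m : Λ → TM2.Stmt Γ Λ σ} {m' : Λ' → TM2.Stmt Γ Λ' σ}
    {e : Λ → Λ'} {x : TM2.Stmt Γ Λ' σ} (hm : ∀ l, m' (e l) = relabel e x (m l))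
    {q v S v₁ S₁ v₂ S₂ n n'} (h : Runs m q v S v₁ S₁ n) (hx : Runs m' x v₁ S₁ v₂ S₂ n') :
    Runs m' (relabel e x q) v S v₂ S₂ (n + n') := by
  induction h with
  | halt n h =>
    refine (hx.of_stepAux_eq (q' := StackMachine.relabel e x _) ?_).mono (by omega)
    rw [stepAux_relabel, h]; rfl
  | step h _ ih =>
    rw [add_right_comm]
    refine .step (l := e _) (by rw [stepAux_relabel, h]; rfl) ?_
    rw [hm]
    exact ih hx

theorem Runs.relabel_halt {Λ Λ' : Type} {m : Λ → TM2.Stmt Γ Λ σ} {m' : Λ' → TM2.Stmt Γ Λ' σ}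
    {e : Λ → Λ'} (hm : ∀ l, m' (e l) = StackMachine.relabel e .halt (m l))
    {q v S v₁ S₁ n} (h : Runs m q v S v₁ S₁ n) :
    Runs m' (StackMachine.relabel e .halt q) v S v₁ S₁ n := by
  induction h with
  | halt n h => exact .halt n (by rw [stepAux_relabel, h]; rfl)
  | step h _ ih =>
    refine .step (l := e _) (by rw [stepAux_relabel, h]; rfl) ?_
    rw [hm]
    exact ih

namespace Mach

/-- The machine takes the first state and stacks to the second ones within `n` steps. -/
def Runs (M : Mach Γ σ) (v : σ) (S : ∀ k, List (Γ k)) (v' : σ) (S' : ∀ k, List (Γ k)) (n : ℕ) :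
    Prop :=
  StackMachine.Runs M.code (M.code M.main) v S v' S' n

theorem Runs.mono {M : Mach Γ σ} {v S v' S' n n'} (h : M.Runs v S v' S' n) (hn : n ≤ n') :
    M.Runs v S v' S' n' :=
  StackMachine.Runs.mono h hn

/-- A single straight-line statement. -/
def blk (q : TM2.Stmt Γ Empty σ) : Mach Γ σ where
  Λ := Unit
  fin := inferInstance
  main := ()
  code _ := relabel Empty.elim .halt q

/-- One machine after the other. -/
def seq (M N : Mach Γ σ) : Mach Γ σ where
  Λ := M.Λ ⊕ N.Λ
  fin := by have := M.fin; have := N.fin; exact inferInstance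
  main := .inl M.main
  code
    | .inl l => relabel .inl (relabel .inr .halt (N.code N.main)) (M.code l)
    | .inr l => relabel .inr .halt (N.code l)

/-- Run `q`; then `M` or `N`, as the test says. -/
def ite (q : TM2.Stmt Γ Empty σ) (test : σ → Bool) (M N : Mach Γ σ) : Mach Γ σ where
  Λ := Option (M.Λ ⊕ N.Λ)
  fin := by have := M.fin; have := N.fin; exact inferInstance
  main := none
  code
    | none => relabel Empty.elim (.branch test (.goto fun _ => some (.inl M.main))
        (.goto fun _ => some (.inr N.main))) q
    | some (.inl l) => relabel (fun l => some (.inl l)) .halt (M.code l)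
    | some (.inr l) => relabel (fun l => some (.inr l)) .halt (N.code l)

/-- Run `q` and then `M`, again and again, until the test between them fails. -/
def loop (q : TM2.Stmt Γ Empty σ) (test : σ → Bool) (M : Mach Γ σ) : Mach Γ σ where
  Λ := Option M.Λ
  fin := by have := M.fin; exact inferInstance
  main := none
  code
    | none => relabel Empty.elim (.branch test (.goto fun _ => some M.main) .halt) q
    | some l => relabel some (relabel Empty.elim
        (.branch test (.goto fun _ => some M.main) .halt) q) (M.code l)

variable {M N : Mach Γ σ} {q : TM2.Stmt Γ Empty σ} {test : σ → Bool}
  {v v₁ v₂ v₃ : σ} {S S₁ S₂ S₃ : ∀ k, List (Γ k)} {n n' : ℕ}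

theorem blk_runs (h : TM2.stepAux q v S = ⟨none, v₁, S₁⟩) : (blk q).Runs v S v₁ S₁ 1 :=
  .halt 0 (by simp only [blk]; rw [stepAux_relabel, h]; rfl)

theorem seq_runs (h : M.Runs v S v₁ S₁ n) (h' : N.Runs v₁ S₁ v₂ S₂ n') :
    (seq M N).Runs v S v₂ S₂ (n + n') :=
  StackMachine.Runs.relabel (e := Sum.inl) (m' := (seq M N).code) (fun _ => rfl) h
    (StackMachine.Runs.relabel_halt (m' := (seq M N).code) (fun _ => rfl) h')

theorem ite_runs_true (h : TM2.stepAux q v S = ⟨none, v₁, S₁⟩) (ht : test v₁ = true)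
    (hM : M.Runs v₁ S₁ v₂ S₂ n) : (ite q test M N).Runs v S v₂ S₂ (n + 1) := by
  refine .step (l := some (.inl M.main)) (v₁ := v₁) (S₁ := S₁) ?_ ?_
  · simp only [ite]; rw [stepAux_relabel, h]; simp [ht]
  · exact StackMachine.Runs.relabel_halt (e := fun l => some (Sum.inl l))
      (m' := (ite q test M N).code) (fun _ => rfl) hM

theorem ite_runs_false (h : TM2.stepAux q v S = ⟨none, v₁, S₁⟩) (ht : test v₁ = false)
    (hN : N.Runs v₁ S₁ v₂ S₂ n) : (ite q test M N).Runs v S v₂ S₂ (n + 1) := by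
  refine .step (l := some (.inr N.main)) (v₁ := v₁) (S₁ := S₁) ?_ ?_
  · simp only [ite]; rw [stepAux_relabel, h]; simp [ht]
  · exact StackMachine.Runs.relabel_halt (e := fun l => some (Sum.inr l))
      (m' := (ite q test M N).code) (fun _ => rfl) hN

theorem loop_runs_true (h : TM2.stepAux q v S = ⟨none, v₁, S₁⟩) (ht : test v₁ = true)
    (hM : M.Runs v₁ S₁ v₂ S₂ n) (hL : (loop q test M).Runs v₂ S₂ v₃ S₃ n') :
    (loop q test M).Runs v S v₃ S₃ (n + n' + 1) := by
  refine .step (l := some M.main) (v₁ := v₁) (S₁ := S₁) ?_ ?_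
  · simp only [loop]; rw [stepAux_relabel, h]; simp [ht]
  · exact StackMachine.Runs.relabel (e := some) (m' := (loop q test M).code) (fun _ => rfl) hM hL

theorem loop_runs_false (h : TM2.stepAux q v S = ⟨none, v₁, S₁⟩) (ht : test v₁ = false) :
    (loop q test M).Runs v S v₁ S₁ 1 :=
  .halt 0 (by simp only [loop]; rw [stepAux_relabel, h]; simp [ht])

end Mach

end Mach

/-! ### Trees and their serialization on a stack -/

/-- The data: binary trees with leaves that are blank or hold a symbol. -/
inductive Tree
  | leaf (s : Option Sym)
  | node (l r : Tree)
  deriving DecidableEq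

/-- The stack cells: `none` announces a node, `some s` is a leaf. -/
abbrev Cell := Option (Option Sym)

namespace Tree

/-- The tree in preorder. -/
def ser : Tree → List Cell
  | leaf s => [some s]
  | node l r => none :: (l.ser ++ r.ser)

/-- The length of the serialization. -/
def size (t : Tree) : ℕ := t.ser.length

@[simp] theorem size_leaf (s) : (leaf s).size = 1 := rfl

@[simp] theorem size_node (l r : Tree) : (node l r).size = l.size + r.size + 1 := by
  simp [size, ser]

theorem ser_append_inj {t u : Tree} {r r' : List Cell} (h : t.ser ++ r = u.ser ++ r') :
    t = u ∧ r = r' := by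
  induction t generalizing u r r' with
  | leaf s => cases u <;> simp_all [ser]
  | node a b iha ihb =>
    cases u with
    | leaf s => simp [ser] at h
    | node c d =>
      simp only [ser, List.cons_append, List.append_assoc, List.cons.injEq, true_and] at h
      obtain ⟨rfl, h₁⟩ := iha h
      obtain ⟨rfl, h₂⟩ := ihb h₁
      exact ⟨rfl, h₂⟩

theorem ser_inj {t u : Tree} : t.ser = u.ser ↔ t = u :=
  ⟨fun h => (ser_append_inj (r := []) (r' := []) (by simpa using h)).1, fun h => h ▸ rfl⟩

end Tree

/-! ### The stacks and basic routines -/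

/-- The stacks other than those of the oracle: input, output, the main stack `a`, two auxiliary
stacks and a counter. -/
inductive Wk
  | inp | out | a | b | e | d
  deriving DecidableEq

instance : Fintype Wk := ⟨{.inp, .out, .a, .b, .e, .d}, fun x => by cases x <;> decide⟩

variable (aux : TM2ComputableAux Sym Bool)

/-- All stacks: the own ones and those of the oracle. -/
abbrev Stack := Wk ⊕ aux.tm.K

/-- The alphabets of the stacks. -/
abbrev Gam : Stack aux → Type
  | .inl .inp => Sym
  | .inl .out => Bool
  | .inl .a => Cell
  | .inl .b => Cell
  | .inl .e => Cell
  | .inl .d => Unit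
  | .inr k => aux.tm.Γ k

/-- The internal states: two buffers, a flag and the state of the oracle. -/
abbrev Sta := (Option Cell × Option Cell × Bool) × aux.tm.σ

variable {aux}

/-- The initial state. -/
def v0 : Sta aux := ((none, none, false), aux.tm.initialState)

/-- The contents of all stacks. -/
def store (i : List Sym) (o : List Bool) (a b e : List Cell) (d : List Unit)
    (g : ∀ k, List (aux.tm.Γ k)) : ∀ k, List (Gam aux k)
  | .inl .inp => i
  | .inl .out => o
  | .inl .a => a
  | .inl .b => b
  | .inl .e => e
  | .inl .d => d
  | .inr k => g k

section store

variable (i i' : List Sym) (o o' : List Bool) (a a' b b' e e' : List Cell) (d d' : List Unit)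
  (g : ∀ k, List (aux.tm.Γ k))

@[simp] theorem store_inp : store i o a b e d g (.inl .inp) = i := rfl
@[simp] theorem store_out : store i o a b e d g (.inl .out) = o := rfl
@[simp] theorem store_a : store i o a b e d g (.inl .a) = a := rfl
@[simp] theorem store_b : store i o a b e d g (.inl .b) = b := rfl
@[simp] theorem store_e : store i o a b e d g (.inl .e) = e := rfl
@[simp] theorem store_d : store i o a b e d g (.inl .d) = d := rfl
@[simp] theorem store_inr (k : aux.tm.K) : store i o a b e d g (.inr k) = g k := rfl

@[simp] theorem update_store_inp :
    Function.update (store i o a b e d g) (.inl .inp) i' = store i' o a b e d g := by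
  funext k
  by_cases h : k = .inl .inp
  · subst h; exact Function.update_self ..
  · refine (Function.update_of_ne h ..).trans ?_
    rcases k with (_ | _ | _ | _ | _ | _) | k <;> first | rfl | exact absurd rfl h

@[simp] theorem update_store_out :
    Function.update (store i o a b e d g) (.inl .out) o' = store i o' a b e d g := by
  funext k
  by_cases h : k = .inl .out
  · subst h; exact Function.update_self ..
  · refine (Function.update_of_ne h ..).trans ?_
    rcases k with (_ | _ | _ | _ | _ | _) | k <;> first | rfl | exact absurd rfl h

@[simp] theorem update_store_a :
    Function.update (store i o a b e d g) (.inl .a) a' = store i o a' b e d g := by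
  funext k
  by_cases h : k = .inl .a
  · subst h; exact Function.update_self ..
  · refine (Function.update_of_ne h ..).trans ?_
    rcases k with (_ | _ | _ | _ | _ | _) | k <;> first | rfl | exact absurd rfl h

@[simp] theorem update_store_b :
    Function.update (store i o a b e d g) (.inl .b) b' = store i o a b' e d g := by
  funext k
  by_cases h : k = .inl .b
  · subst h; exact Function.update_self ..
  · refine (Function.update_of_ne h ..).trans ?_
    rcases k with (_ | _ | _ | _ | _ | _) | k <;> first | rfl | exact absurd rfl h

@[simp] theorem update_store_e :
    Function.update (store i o a b e d g) (.inl .e) e' = store i o a b e' d g := by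
  funext k
  by_cases h : k = .inl .e
  · subst h; exact Function.update_self ..
  · refine (Function.update_of_ne h ..).trans ?_
    rcases k with (_ | _ | _ | _ | _ | _) | k <;> first | rfl | exact absurd rfl h

@[simp] theorem update_store_d :
    Function.update (store i o a b e d g) (.inl .d) d' = store i o a b e d' g := by
  funext k
  by_cases h : k = .inl .d
  · subst h; exact Function.update_self ..
  · refine (Function.update_of_ne h ..).trans ?_
    rcases k with (_ | _ | _ | _ | _ | _) | k <;> first | rfl | exact absurd rfl h

@[simp] theorem update_store_inr (k : aux.tm.K) (l : List (aux.tm.Γ k)) :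
    Function.update (store i o a b e d g) (.inr k) l =
      store i o a b e d (Function.update g k l) := by
  funext k'
  by_cases h : k' = .inr k
  · subst h
    exact (Function.update_self ..).trans (Function.update_self (f := g) ..).symm
  · refine (Function.update_of_ne h ..).trans ?_
    rcases k' with (_ | _ | _ | _ | _ | _) | k'
    case inr => exact (Function.update_of_ne (fun h' => h (congrArg Sum.inr h')) ..).symm
    all_goals rfl

end store

/-- A machine with these stacks. -/
abbrev Machine (aux : TM2ComputableAux Sym Bool) := Mach (Gam aux) (Sta aux)

/-- The contents of the stacks when only the own working stacks are in use. -/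
abbrev work (a b e : List Cell) (d : List Unit) : ∀ k, List (Gam aux k) :=
  store [] [] a b e d fun _ => []

namespace Machine

open Mach

/-- The machine changes the contents of the main stack from `a` to `a'` within `n` steps. Before
and after, all other stacks are empty and the state is the initial one. -/
def On (M : Machine aux) (a a' : List Cell) (n : ℕ) : Prop :=
  M.Runs v0 (work a [] [] []) v0 (work a' [] [] []) n

theorem On.mono {M : Machine aux} {a a' n n'} (h : M.On a a' n) (hn : n ≤ n') : M.On a a' n' :=
  Mach.Runs.mono h hn

theorem On.seq {M N : Machine aux} {a a' a'' n n'} (h : M.On a a' n) (h' : N.On a' a'' n') :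
    On (Mach.seq M N) a a'' (n + n') :=
  seq_runs h h'

/-- The statement that resets the own part of the state. -/
def reset : TM2.Stmt (Gam aux) Empty (Sta aux) → TM2.Stmt (Gam aux) Empty (Sta aux) :=
  .load fun v => ((none, none, false), v.2)

/-- Move the contents of the stack `b` to the main stack. -/
def drainB : Machine aux :=
  loop (.pop (.inl .b) (fun v c => ((c, v.1.2), v.2)) .halt) (fun v => v.1.1.isSome)
    (blk (.push (.inl .a) (fun v => v.1.1.getD none) (reset .halt)))

/-- Move the contents of the stack `e` to the main stack. -/
def drainE : Machine aux :=
  loop (.pop (.inl .e) (fun v c => ((c, v.1.2), v.2)) .halt) (fun v => v.1.1.isSome)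
    (blk (.push (.inl .a) (fun v => v.1.1.getD none) (reset .halt)))

theorem drainB_runs (a b e d) : (drainB (aux := aux)).Runs v0 (work a b e d) v0
    (work (b.reverse ++ a) [] e d) (2 * b.length + 1) := by
  induction b generalizing a with
  | nil => exact loop_runs_false (by simp; rfl) rfl
  | cons c b ih =>
    rw [List.reverse_cons, List.append_assoc]
    refine Mach.Runs.mono (loop_runs_true (v₁ := ((some c, none, false), aux.tm.initialState))
      (S₁ := work a b e d) ?_ rfl (blk_runs ?_) (ih (c :: a))) ?_
    · simp [v0]
    · simp [reset, v0]
    · simp; omega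

theorem drainE_runs (a b e d) : (drainE (aux := aux)).Runs v0 (work a b e d) v0
    (work (e.reverse ++ a) b [] d) (2 * e.length + 1) := by
  induction e generalizing a with
  | nil => exact loop_runs_false (by simp; rfl) rfl
  | cons c e ih =>
    rw [List.reverse_cons, List.append_assoc]
    refine Mach.Runs.mono (loop_runs_true (v₁ := ((some c, none, false), aux.tm.initialState))
      (S₁ := work a b e d) ?_ rfl (blk_runs ?_) (ih (c :: a))) ?_
    · simp [v0]
    · simp [reset, v0]
    · simp; omega

/-- Ends the statement of `move`: two more trees are to be read after a node. -/
def moveCount : TM2.Stmt (Gam aux) Empty (Sta aux) :=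
  .branch (fun v => v.1.1 == some none)
    (.push (.inl .d) (fun _ => ()) (.push (.inl .d) (fun _ => ()) (reset .halt))) (reset .halt)

/-- Remove as many trees from the main stack as the counter `d` says, pushing their
serialization, reversed, onto `b` and `e` if `p` and `q` say so. -/
def move (p q : Bool) : Machine aux :=
  loop (.pop (.inl .d) (fun v c => ((c.map fun _ => none, v.1.2), v.2)) .halt)
    (fun v => v.1.1.isSome)
    (blk (.pop (.inl .a) (fun v c => ((c, v.1.2), v.2))
      (.branch (fun _ => p)
        (.push (.inl .b) (fun v => v.1.1.getD none)
          (.branch (fun _ => q) (.push (.inl .e) (fun v => v.1.1.getD none) moveCount) moveCount))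
        (.branch (fun _ => q) (.push (.inl .e) (fun v => v.1.1.getD none) moveCount) moveCount))))

theorem move_runs_step (p q : Bool) (t : Tree) (r b e : List Cell) (d : List Unit) (v' S' n)
    (h : (move (aux := aux) p q).Runs v0 (work r (bif p then t.ser.reverse ++ b else b)
      (bif q then t.ser.reverse ++ e else e) d) v' S' n) :
    (move (aux := aux) p q).Runs v0 (work (t.ser ++ r) b e (() :: d)) v' S'
      (2 * t.size + n) := by
  induction t generalizing r b e d n with
  | leaf s =>
    refine .mono (loop_runs_true (v₁ := ((some none, none, false), aux.tm.initialState))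
      (S₁ := work ((Tree.leaf s).ser ++ r) b e d) (by simp [v0]) rfl (blk_runs ?_) h)
        (by rw [Tree.size_leaf]; omega)
    cases p <;> cases q <;> simp [reset, v0, moveCount, Tree.ser]
  | node t u iht ihu =>
    have h₁ := iht (u.ser ++ r) (bif p then none :: b else b) (bif q then none :: e else e)
      (() :: d) _ (ihu r _ _ d n (by
        refine cast ?_ h
        cases p <;> cases q <;> simp [Tree.ser]))
    refine .mono (loop_runs_true (v₁ := ((some none, none, false), aux.tm.initialState))
      (S₁ := work ((Tree.node t u).ser ++ r) b e d) (by simp [v0]) rfl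
      (blk_runs ?_) h₁) (by simp; omega)
    cases p <;> cases q <;> simp [reset, v0, moveCount, Tree.ser]

/-- Remove one tree from the main stack. -/
def move1 (p q : Bool) : Machine aux :=
  seq (blk (.push (.inl .d) (fun _ => ()) .halt)) (move p q)

theorem move1_runs (p q : Bool) (t : Tree) (r b e : List Cell) :
    (move1 (aux := aux) p q).Runs v0 (work (t.ser ++ r) b e []) v0
      (work r (bif p then t.ser.reverse ++ b else b) (bif q then t.ser.reverse ++ e else e) [])
      (2 * t.size + 2) :=
  .mono (seq_runs (blk_runs (by simp)) (move_runs_step p q t r b e [] _ _ _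
    (loop_runs_false (by simp [v0]) rfl))) (by omega)

/-! ### Rearranging trees on the main stack -/

/-- Remove the top tree. -/
def drop : Machine aux := move1 false false

theorem drop_on (t : Tree) (r) : (drop (aux := aux)).On (t.ser ++ r) r (2 * t.size + 2) :=
  move1_runs false false t r [] []

/-- Duplicate the top tree. -/
def dup : Machine aux := seq (move1 true true) (seq drainB drainE)

theorem dup_on (t : Tree) (r) :
    (dup (aux := aux)).On (t.ser ++ r) (t.ser ++ (t.ser ++ r)) (6 * t.size + 4) := by
  have h := seq_runs (move1_runs (aux := aux) true true t r [] [])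
    (seq_runs (drainB_runs _ _ _ _) (drainE_runs _ _ _ _))
  simp only [cond_true, List.append_nil, List.reverse_reverse] at h
  exact h.mono (by simp [Tree.size]; omega)

/-- Exchange the two topmost trees. -/
def swap : Machine aux :=
  seq (move1 true false) (seq (move1 false true) (seq drainB drainE))

theorem swap_on (t u : Tree) (r) : (swap (aux := aux)).On (t.ser ++ (u.ser ++ r))
    (u.ser ++ (t.ser ++ r)) (4 * (t.size + u.size) + 6) := by
  have h := seq_runs (move1_runs (aux := aux) true false t (u.ser ++ r) [] [])
    (seq_runs (move1_runs false true u r _ _)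
      (seq_runs (drainB_runs _ _ _ _) (drainE_runs _ _ _ _)))
  simp only [cond_true, cond_false, List.append_nil, List.reverse_reverse] at h
  exact h.mono (by simp [Tree.size]; omega)

/-- Push the cells of a list, the last one first. -/
def push : List Cell → Machine aux
  | [] => blk .halt
  | c :: l => seq (push l) (blk (.push (.inl .a) (fun _ => c) .halt))

theorem push_on (l : List Cell) (r) : (push (aux := aux) l).On r (l ++ r) (l.length + 1) := by
  induction l with
  | nil => exact blk_runs rfl
  | cons c l ih => exact On.seq ih (blk_runs (by simp))

/-- Remove the top cell. -/
def popCell : Machine aux := blk (.pop (.inl .a) (fun v _ => v) .halt)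

theorem popCell_on (c : Cell) (r) : (popCell (aux := aux)).On (c :: r) r 1 :=
  blk_runs (by simp)

/-- Compare the stacks `b` and `e`, emptying them. -/
def compare : Machine aux :=
  loop (.pop (.inl .b) (fun v c => ((c, v.1.2), v.2))
      (.pop (.inl .e) (fun v c => ((v.1.1, c, v.1.2.2), v.2)) .halt))
    (fun v => v.1.1.isSome || v.1.2.1.isSome)
    (blk (.load (fun v => ((none, none, v.1.2.2 || v.1.1 != v.1.2.1), v.2)) .halt))

theorem compare_runs (r b e : List Cell) (f : Bool) :
    (compare (aux := aux)).Runs ((none, none, f), aux.tm.initialState) (work r b e [])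
      ((none, none, f || decide (b ≠ e)), aux.tm.initialState) (work r [] [] [])
      (2 * (b.length + e.length) + 1) := by
  induction b generalizing e f with
  | nil =>
    induction e generalizing f with
    | nil => exact loop_runs_false (by simp) rfl
    | cons c e ih =>
      refine .mono (loop_runs_true (v₁ := ((none, some c, f), aux.tm.initialState))
        (S₁ := work r [] e []) (v₂ := ((none, none, true), aux.tm.initialState))
        (S₂ := work r [] e []) (by simp) rfl (blk_runs (by simp))
        ?_) (n := 1 + (2 * (0 + e.length) + 1) + 1) (by simp; omega)
      have h := ih true
      simp only [Bool.true_or, List.length_nil] at h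
      simpa only [ne_eq, reduceCtorEq, not_false_eq_true, decide_true, Bool.or_true] using! h
  | cons c b ih =>
    cases e with
    | nil =>
      refine .mono (loop_runs_true (v₁ := ((some c, none, f), aux.tm.initialState))
        (S₁ := work r b [] []) (v₂ := ((none, none, true), aux.tm.initialState))
        (S₂ := work r b [] []) (by simp) rfl (blk_runs (by simp))
        ?_) (n := 1 + (2 * (b.length + 0) + 1) + 1) (by simp; omega)
      have h := ih [] true
      simp only [Bool.true_or, List.length_nil] at h
      simpa only [ne_eq, reduceCtorEq, not_false_eq_true, decide_true, Bool.or_true] using! h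
    | cons c' e =>
      refine .mono (loop_runs_true (v₁ := ((some c, some c', f), aux.tm.initialState))
        (S₁ := work r b e []) (v₂ := ((none, none, f || c != c'), aux.tm.initialState))
        (S₂ := work r b e []) (by simp) rfl (blk_runs (by simp; rfl))
        ?_) (n := 1 + (2 * (b.length + e.length) + 1) + 1) (by simp; omega)
      have h := ih e (f || c != c')
      have h' : (f || c != c' || decide (b ≠ e)) = (f || decide (c :: b ≠ c' :: e)) := by
        by_cases h : c = c' <;> simp [h]
      rw [h'] at h
      exact h

/-- Remove the two topmost trees and push the truth value of their equality. -/
def eq : Machine aux :=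
  seq (move1 true false) (seq (move1 false true) (seq compare
    (blk (.push (.inl .a) (fun v => some (some (Sym.bit !v.1.2.2))) (reset .halt)))))

theorem eq_on (t u : Tree) (r) : (eq (aux := aux)).On (t.ser ++ (u.ser ++ r))
    ((Tree.leaf (some (.bit (decide (t = u))))).ser ++ r) (4 * (t.size + u.size) + 6) := by
  refine .mono (seq_runs (move1_runs true false t _ [] []) (seq_runs
    (move1_runs false true u r _ _) (seq_runs (compare_runs _ _ _ false) (blk_runs ?_)))) ?_
  · simp [v0, reset, Tree.ser, Tree.ser_inj]
  · simp [Tree.size]; omega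

/-! ### Control -/

/-- Run `M` or `N` as the test of the top cell says. -/
def iteTop (test : Cell → Bool) (M N : Machine aux) : Machine aux :=
  Mach.ite (.peek (.inl .a) (fun v c => ((none, none, test (c.getD none)), v.2)) .halt)
    (fun v => v.1.2.2) (seq (blk (reset .halt)) M) N

theorem iteTop_on_true {test : Cell → Bool} {M N : Machine aux} {c r r' n} (h : test c = true)
    (hM : M.On (c :: r) r' n) : (iteTop test M N).On (c :: r) r' (n + 2) :=
  Mach.Runs.mono (ite_runs_true (v₁ := ((none, none, true), aux.tm.initialState))
    (S₁ := work (c :: r) [] [] [])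
    (by simp [h, v0]) rfl (seq_runs (blk_runs (by simp [reset, v0])) hM)) (by omega)

theorem iteTop_on_false {test : Cell → Bool} {M N : Machine aux} {c r r' n} (h : test c = false)
    (hN : N.On (c :: r) r' n) : (iteTop test M N).On (c :: r) r' (n + 2) :=
  Mach.Runs.mono (ite_runs_false (v₁ := ((none, none, false), aux.tm.initialState))
    (S₁ := work (c :: r) [] [] [])
    (by simp [h, v0]) rfl hN) (by omega)

/-- Run `M` as long as the second cell of the main stack announces a node: the main stack holds a
pair whose first component is a nonempty list. -/
def loopSnd (M : Machine aux) : Machine aux :=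
  loop (.pop (.inl .a) (fun v _ => v) (.peek (.inl .a)
    (fun v c => ((none, none, c == some none), v.2)) (.push (.inl .a) (fun _ => none) .halt)))
    (fun v => v.1.2.2) (seq (blk (reset .halt)) M)

theorem loopSnd_on_true {M : Machine aux} {r r' r'' n n'} (h : M.On (none :: none :: r) r' n)
    (h' : (loopSnd M).On r' r'' n') : (loopSnd M).On (none :: none :: r) r'' (n + n' + 2) :=
  Mach.Runs.mono (loop_runs_true (v₁ := ((none, none, true), aux.tm.initialState))
    (S₁ := work (none :: none :: r) [] [] []) (by simp [v0]) rfl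
    (seq_runs (blk_runs (by simp [reset]; rfl)) h) h') (by omega)

theorem loopSnd_on_false (M : Machine aux) (s r) :
    (loopSnd M).On (none :: some s :: r) (none :: some s :: r) 1 :=
  loop_runs_false (by simp [v0]) rfl

/-! ### The oracle, the input and the output -/

/-- The serialization of a list of symbols. -/
def wordTree : List Sym → Tree
  | [] => .leaf none
  | s :: w => .node (.leaf (some s)) (wordTree w)

theorem size_wordTree (w : List Sym) : (wordTree w).size = 2 * w.length + 1 := by
  induction w with
  | nil => rfl
  | cons s w ih => simp [wordTree, ih]; omega

/-- The statements of the oracle, acting on its own stacks and state. -/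
def lift {Λ : Type} : TM2.Stmt aux.tm.Γ Λ aux.tm.σ → TM2.Stmt (Gam aux) Λ (Sta aux)
  | .push k f q => .push (.inr k) (fun v => f v.2) (lift q)
  | .peek k f q => .peek (.inr k) (fun v c => (v.1, f v.2 c)) (lift q)
  | .pop k f q => .pop (.inr k) (fun v c => (v.1, f v.2 c)) (lift q)
  | .load f q => .load (fun v => (v.1, f v.2)) (lift q)
  | .branch f q₁ q₂ => .branch (fun v => f v.2) (lift q₁) (lift q₂)
  | .goto f => .goto fun v => f v.2
  | .halt => .halt

theorem stepAux_lift {Λ : Type} (q : TM2.Stmt aux.tm.Γ Λ aux.tm.σ) (u v) (i o a b e d g) :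
    TM2.stepAux (lift q) (u, v) (store i o a b e d g) =
      ⟨(TM2.stepAux q v g).l, (u, (TM2.stepAux q v g).var),
        store i o a b e d (TM2.stepAux q v g).stk⟩ := by
  induction q generalizing v g with
  | branch f q₁ q₂ ih₁ ih₂ => simp only [lift, TM2.stepAux]; cases f v <;> simp [ih₁, ih₂]
  | _ => simp_all [lift]

/-- The oracle as a machine on its own stacks. -/
def embedded : Machine aux := ⟨aux.tm.Λ, aux.tm.ΛFin, aux.tm.main, fun l => lift (aux.tm.m l)⟩

theorem runs_lift {l v g v' g' n} {i o a b e d u}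
    (h : (flip bind aux.tm.step)^[n] (some ⟨some l, v, g⟩) = some ⟨none, v', g'⟩) :
    StackMachine.Runs (embedded (aux := aux)).code ((embedded (aux := aux)).code l)
      (u, v) (store i o a b e d g) (u, v') (store i o a b e d g') (n + 1) := by
  induction n generalizing l v g with
  | zero => cases h
  | succ n ih =>
    rw [Function.iterate_succ_apply] at h
    change (flip bind aux.tm.step)^[n] (some (TM2.stepAux (aux.tm.m l) v g)) = _ at h
    rcases h₁ : TM2.stepAux (aux.tm.m l) v g with ⟨_ | l₁, v₁, g₁⟩
    · rw [h₁] at h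
      have h₂ : v₁ = v' ∧ g₁ = g' := by
        cases n with
        | zero => cases h; exact ⟨rfl, rfl⟩
        | succ n =>
          rw [Function.iterate_succ_apply] at h
          change (flip bind aux.tm.step)^[n] none = _ at h
          exfalso
          have : ∀ n, (flip bind aux.tm.step)^[n] none = none := by
            intro n
            induction n with
            | zero => rfl
            | succ n ih => rw [Function.iterate_succ_apply]; exact ih
          rw [this] at h
          cases h
      obtain ⟨rfl, rfl⟩ := h₂
      exact .halt _ (by simp [embedded, stepAux_lift, h₁])
    · rw [h₁] at h
      exact .step (by simp [embedded, stepAux_lift, h₁]) (ih h)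

/-- The symbol in a cell. -/
def cellSym (c : Cell) : Sym := (c.getD none).getD .comma

/-- Read a word from the main stack, run the oracle on it and push its answer. -/
def oracle : Machine aux :=
  seq (loop (.pop (.inl .a) (fun v c => ((c, v.1.2), v.2)) .halt) (fun v => v.1.1 == some none)
      (blk (.pop (.inl .a) (fun v c => ((c, v.1.2), v.2))
        (.push (.inl .b) (fun v => v.1.1.getD none) (reset .halt)))))
  (seq (blk (reset .halt))
  (seq (loop (.pop (.inl .b) (fun v c => ((c, v.1.2), v.2)) .halt) (fun v => v.1.1.isSome)
      (blk (.push (.inr aux.tm.k₀)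
        (fun v => aux.inputAlphabet.symm (cellSym (v.1.1.getD none))) (reset .halt))))
  (seq embedded
    (blk (.pop (.inr aux.tm.k₁)
      (fun v c => ((c.map fun c => some (some (Sym.bit (aux.outputAlphabet c))), v.1.2), v.2))
      (.push (.inl .a) (fun v => v.1.1.getD none) (reset .halt)))))))

theorem initList_stk (tm : FinTM2) (l : List (tm.Γ tm.k₀)) :
    (initList tm l).stk = Function.update (fun _ => []) tm.k₀ l := by
  funext k
  by_cases h : k = tm.k₀
  · subst h; simp [initList]
  · simp [initList, h]

theorem haltList_stk (tm : FinTM2) (l : List (tm.Γ tm.k₁)) :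
    (haltList tm l).stk = Function.update (fun _ => []) tm.k₁ l := by
  funext k
  by_cases h : k = tm.k₁
  · subst h; simp [haltList]
  · simp [haltList, h]

theorem oracle_on {w : List Sym} {x : Bool} {m : ℕ}
    (h : TM2OutputsInTime aux.tm (w.map aux.inputAlphabet.invFun)
      (some ((Computability.encodeBool x).map aux.outputAlphabet.invFun)) m) (r) :
    (oracle (aux := aux)).On ((wordTree w).ser ++ r) ((Tree.leaf (some (.bit x))).ser ++ r)
      (4 * w.length + m + 6) := by
  have h₁ : ∀ (w : List Sym) (b : List Cell),
      (loop (.pop (.inl .a) (fun v c => ((c, v.1.2), v.2)) .halt) (fun v => v.1.1 == some none)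
      (blk (.pop (.inl .a) (fun v c => ((c, v.1.2), v.2))
        (.push (.inl .b) (fun v => v.1.1.getD none) (reset .halt)))) : Machine aux).Runs v0
        (work ((wordTree w).ser ++ r) b [] [])
        ((some (some none), none, false), aux.tm.initialState)
        (work r ((w.map fun s => some (some s)).reverse ++ b) [] []) (2 * w.length + 1) := by
    intro w
    induction w with
    | nil => intro b; exact loop_runs_false (by simp [wordTree, Tree.ser, v0]) rfl
    | cons s w ih =>
      intro b
      simp only [List.map_cons, List.reverse_cons, List.append_assoc, List.singleton_append]
      refine .mono (loop_runs_true (v₁ := ((some none, none, false), aux.tm.initialState))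
        (S₁ := work (some (some s) :: ((wordTree w).ser ++ r)) b [] [])
        (by simp [wordTree, Tree.ser, v0]) rfl
        (blk_runs ?_) (ih (some (some s) :: b))) ?_
      · simp [reset, v0]
      · simp; omega
  have h₂ : ∀ (w : List Sym) (l : List (aux.tm.Γ aux.tm.k₀)),
      (loop (.pop (.inl .b) (fun v c => ((c, v.1.2), v.2)) .halt) (fun v => v.1.1.isSome)
      (blk (.push (.inr aux.tm.k₀)
        (fun v => aux.inputAlphabet.symm (cellSym (v.1.1.getD none))) (reset .halt))) :
          Machine aux).Runs v0
        (store [] [] r ((w.map fun s => some (some s))) [] []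
          (Function.update (fun _ => []) aux.tm.k₀ l)) v0
        (store [] [] r [] [] [] (Function.update (fun _ => []) aux.tm.k₀
          ((w.map aux.inputAlphabet.invFun).reverse ++ l))) (2 * w.length + 1) := by
    intro w
    induction w with
    | nil => intro l; exact loop_runs_false (by simp; rfl) rfl
    | cons s w ih =>
      intro l
      simp only [List.map_cons, List.reverse_cons, List.append_assoc, List.singleton_append]
      refine .mono (loop_runs_true
        (v₁ := ((some (some (some s)), none, false), aux.tm.initialState))
        (S₁ := store [] [] r (w.map fun s => some (some s)) [] []
          (Function.update (fun _ => []) aux.tm.k₀ l)) ?_ rfl (blk_runs ?_)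
          (ih (aux.inputAlphabet.invFun s :: l))) ?_
      · simp [v0]
      · simp [reset, v0, cellSym]
      · simp; omega
  have h₃ := h.evals_in_steps
  have h₄ := runs_lift (i := []) (o := []) (a := r) (b := []) (e := []) (d := [])
    (u := ((none, none, false) : Option Cell × Option Cell × Bool)) (l := aux.tm.main)
    (v := aux.tm.initialState) (g := (initList aux.tm (w.map aux.inputAlphabet.invFun)).stk)
    (v' := aux.tm.initialState)
    (g' := (haltList aux.tm ((Computability.encodeBool x).map aux.outputAlphabet.invFun)).stk) h₃
  rw [initList_stk, haltList_stk] at h₄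
  have h₅ := h₁ w []
  have h₆ := h₂ w.reverse []
  rw [show Function.update (fun _ : aux.tm.K => []) aux.tm.k₀ [] = fun _ => [] from
    Function.update_eq_self aux.tm.k₀ _, List.map_reverse, List.map_reverse,
    List.reverse_reverse, List.append_nil] at h₆
  rw [List.append_nil] at h₅
  refine Mach.Runs.mono (seq_runs h₅ (seq_runs (blk_runs (v₁ := v0)
    (S₁ := work r (w.map fun s => some (some s)).reverse [] []) ?_) (seq_runs h₆
      (seq_runs (M := embedded) h₄ (blk_runs ?_))))) ?_
  · simp [reset, v0]
  · simp [reset, v0, Computability.encodeBool, Tree.ser, Function.update_idem]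
  · have := h.steps_le_m
    simp; omega

/-- Read the input word onto the main stack. -/
def readInput : Machine aux :=
  seq (loop (.pop (.inl .inp) (fun v c => ((c.map fun s => some (some s), v.1.2), v.2)) .halt)
      (fun v => v.1.1.isSome) (blk (.push (.inl .b) (fun v => v.1.1.getD none) (reset .halt))))
  (seq (push [some none])
    (loop (.pop (.inl .b) (fun v c => ((c, v.1.2), v.2)) .halt) (fun v => v.1.1.isSome)
      (blk (.push (.inl .a) (fun v => v.1.1.getD none)
        (.push (.inl .a) (fun _ => none) (reset .halt))))))

theorem readInput_runs (w : List Sym) : (readInput (aux := aux)).Runs v0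
    (store w [] [] [] [] [] fun _ => []) v0 (work (wordTree w).ser [] [] [])
      (4 * w.length + 4) := by
  have h₁ : ∀ (w : List Sym) (b : List Cell),
      (loop (.pop (.inl .inp) (fun v c => ((c.map fun s => some (some s), v.1.2), v.2)) .halt)
      (fun v => v.1.1.isSome) (blk (.push (.inl .b) (fun v => v.1.1.getD none) (reset .halt))) :
        Machine aux).Runs v0
        (store w [] [] b [] [] fun _ => []) v0
        (work [] ((w.map fun s => some (some s)).reverse ++ b) [] []) (2 * w.length + 1) := by
    intro w
    induction w with
    | nil => intro b; exact loop_runs_false (by simp; rfl) rfl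
    | cons s w ih =>
      intro b
      simp only [List.map_cons, List.reverse_cons, List.append_assoc, List.singleton_append]
      refine .mono (loop_runs_true
        (v₁ := ((some (some (some s)), none, false), aux.tm.initialState))
        (S₁ := store w [] [] b [] [] fun _ => [])
        (by simp [v0]) rfl
        (blk_runs ?_) (ih (some (some s) :: b))) ?_
      · simp [reset, v0]
      · simp; omega
  have h₂ : ∀ w w' : List Sym,
      (loop (.pop (.inl .b) (fun v c => ((c, v.1.2), v.2)) .halt) (fun v => v.1.1.isSome)
      (blk (.push (.inl .a) (fun v => v.1.1.getD none)
        (.push (.inl .a) (fun _ => none) (reset .halt)))) : Machine aux).Runs v0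
        (work (wordTree w').ser (w.map fun s => some (some s)) [] []) v0
        (work (wordTree (w.reverse ++ w')).ser [] [] []) (2 * w.length + 1) := by
    intro w
    induction w with
    | nil => intro w'; exact loop_runs_false (by simp; rfl) rfl
    | cons s w ih =>
      intro w'
      simp only [List.map_cons, List.reverse_cons, List.append_assoc, List.singleton_append]
      refine .mono (loop_runs_true
        (v₁ := ((some (some (some s)), none, false), aux.tm.initialState))
        (S₁ := work (wordTree w').ser (w.map fun s => some (some s)) [] [])
        (by simp [v0]) rfl
        (blk_runs ?_) (ih (s :: w'))) ?_
      · simp [reset, v0, wordTree, Tree.ser]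
      · simp; omega
  have h₃ := h₂ w.reverse []
  rw [List.map_reverse, List.reverse_reverse, List.append_nil] at h₃
  have h₄ := h₁ w []
  rw [List.append_nil] at h₄
  refine (seq_runs h₄ (seq_runs (seq_runs (blk_runs rfl) (blk_runs ?_)) h₃)).mono
    (by simp; omega)
  simp [wordTree, Tree.ser]

/-- Output the truth value on the main stack. -/
def writeOutput : Machine aux :=
  blk (.pop (.inl .a) (fun v c => ((c, v.1.2), v.2))
    (.push (.inl .out) (fun v => decide (v.1.1 = some (some (some (Sym.bit true))))) (reset .halt)))

theorem writeOutput_runs (x : Bool) : (writeOutput (aux := aux)).Runs v0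
    (work (Tree.leaf (some (.bit x))).ser [] [] []) v0
    (store [] [x] [] [] [] [] fun _ => []) 1 := by
  refine blk_runs ?_
  cases x <;> simp [reset, v0, Tree.ser]

end Machine

/-! ### Tree transformations by machines -/

namespace Machine

open Mach

/-- The machine replaces the tree `x` on top of the main stack by `y` within `n` steps. -/
def Computes (M : Machine aux) (x y : Tree) (n : ℕ) : Prop :=
  ∀ r, M.On (x.ser ++ r) (y.ser ++ r) n

theorem Computes.mono {M : Machine aux} {x y n n'} (h : M.Computes x y n) (hn : n ≤ n') :
    M.Computes x y n' :=
  fun r => (h r).mono hn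

theorem Computes.seq {M N : Machine aux} {x y z n n'} (h : M.Computes x y n)
    (h' : N.Computes y z n') : Computes (Mach.seq M N) x z (n + n') :=
  fun r => (h r).seq (h' r)

/-- Do nothing. -/
def skip : Machine aux := blk .halt

theorem skip_computes (x) : (skip (aux := aux)).Computes x x 1 := fun _ => blk_runs rfl

/-- The first component of a pair. -/
def fst : Machine aux := seq popCell (seq swap drop)

theorem fst_computes (x y) : (fst (aux := aux)).Computes (.node x y) x
    (6 * (x.size + y.size) + 9) := fun r => by
  have := (popCell_on none (x.ser ++ (y.ser ++ r))).seq
    ((swap_on (aux := aux) x y r).seq (drop_on y (x.ser ++ r)))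
  simp only [Tree.ser, List.cons_append, List.append_assoc]
  exact this.mono (by omega)

/-- The second component of a pair. -/
def snd : Machine aux := seq popCell drop

theorem snd_computes (x y) : (snd (aux := aux)).Computes (.node x y) y
    (6 * (x.size + y.size) + 9) := fun r => by
  have := (popCell_on none (x.ser ++ (y.ser ++ r))).seq (drop_on (aux := aux) x (y.ser ++ r))
  simp only [Tree.ser, List.cons_append, List.append_assoc]
  exact this.mono (by omega)

/-- The pair of the results of `M` and `N`. -/
def pair (M N : Machine aux) : Machine aux :=
  seq dup (seq N (seq swap (seq M (push [none]))))

theorem pair_computes {M N : Machine aux} {x y z n n'} (h : M.Computes x y n)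
    (h' : N.Computes x z n') :
    (pair M N).Computes x (.node y z) (n + n' + 10 * (x.size + z.size) + 12) := fun r => by
  have := (dup_on x r).seq ((h' (x.ser ++ r)).seq ((swap_on z x r).seq
    ((h (z.ser ++ r)).seq (push_on [none] _))))
  simp only [Tree.ser, List.cons_append, List.append_assoc]
  exact this.mono (by simp; omega)

/-- Forget the tree on top and push another one. -/
def const (y : Tree) : Machine aux := seq drop (push y.ser)

theorem const_computes (x y) :
    (const (aux := aux) y).Computes x y (2 * x.size + y.size + 3) := fun r =>
  ((drop_on x r).seq (push_on y.ser r)).mono (by simp only [Tree.size]; omega)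

/-- The truth value of the equality of two trees. -/
def eqPair : Machine aux := seq popCell eq

theorem eqPair_computes (x y) : (eqPair (aux := aux)).Computes (.node x y)
    (.leaf (some (.bit (decide (x = y))))) (4 * (x.size + y.size) + 7) := fun r => by
  have := (popCell_on none (x.ser ++ (y.ser ++ r))).seq (eq_on (aux := aux) x y r)
  simp only [Tree.ser, List.cons_append, List.append_assoc] at this ⊢
  exact this.mono (by omega)

/-- Given a pair of a truth value and `x`, run `M` or `N` on `x`. -/
def condPair (M N : Machine aux) : Machine aux :=
  seq popCell (iteTop (fun c => c == some (some (.bit true))) (seq popCell M) (seq popCell N))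

theorem condPair_computes_true {M N : Machine aux} {x y n} (h : M.Computes x y n) :
    (condPair M N).Computes (.node (.leaf (some (.bit true))) x) y (n + 4) := fun r =>
  ((popCell_on none _).seq (iteTop_on_true (by simp)
    ((popCell_on (some (some (.bit true))) (x.ser ++ r)).seq (h r)))).mono (by omega)

theorem condPair_computes_false {M N : Machine aux} {x y n} (h : N.Computes x y n) :
    (condPair M N).Computes (.node (.leaf (some (.bit false))) x) y (n + 4) := fun r =>
  ((popCell_on none _).seq (iteTop_on_false (by simp)
    ((popCell_on (some (some (.bit false))) (x.ser ++ r)).seq (h r)))).mono (by omega)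

/-- Run `M` on a node and `N` on a leaf. -/
def cases (M N : Machine aux) : Machine aux := iteTop (fun c => c == none) M N

theorem cases_computes_node {M N : Machine aux} {x y z n} (h : M.Computes (.node x y) z n) :
    (cases M N).Computes (.node x y) z (n + 2) := fun r =>
  iteTop_on_true (by simp) (h r)

theorem cases_computes_leaf {M N : Machine aux} {s z n} (h : N.Computes (.leaf s) z n) :
    (cases M N).Computes (.leaf s) z (n + 2) := fun r =>
  iteTop_on_false (by simp) (h r)

/-- One iteration of `foldl`: from `((b :: l), (a, c))` to `(l, (a, s (a, (c, b))))`. -/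
def foldStep (M : Machine aux) : Machine aux :=
  pair (seq fst snd) (pair (seq snd fst)
    (seq (pair (seq snd fst) (pair (seq snd snd) (seq fst fst))) M))

theorem foldStep_computes {M : Machine aux} {a b c l c' n}
    (h : M.Computes (.node a (.node c b)) c' n) :
    (foldStep M).Computes (.node (.node b l) (.node a c)) (.node l (.node a c'))
      (n + 1000 * (a.size + b.size + c.size + l.size + c'.size + 3)) := by
  have f₁ := fst_computes (aux := aux) (.node b l) (.node a c)
  have s₁ := snd_computes (aux := aux) (.node b l) (.node a c)
  have f₂ := fst_computes (aux := aux) b l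
  have s₂ := snd_computes (aux := aux) b l
  have f₃ := fst_computes (aux := aux) a c
  have s₃ := snd_computes (aux := aux) a c
  refine (pair_computes (f₁.seq s₂) (pair_computes (s₁.seq f₃)
    ((pair_computes (s₁.seq f₃) (pair_computes (s₁.seq s₃) (f₁.seq f₂))).seq h))).mono ?_
  simp
  omega

end Machine

open Machine

/-! ### Encodings -/

/-- A type whose elements are written as trees. -/
class Enc (α : Type) where
  /-- the tree of an element -/
  enc : α → Tree
  /-- different elements have different trees -/
  inj : Function.Injective enc

open Enc (enc)

instance : Enc Unit := ⟨fun _ => .leaf none, fun _ _ _ => rfl⟩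

instance : Enc Sym := ⟨fun s => .leaf (some s), fun _ _ h => by simpa using h⟩

instance : Enc Bool := ⟨fun b => .leaf (some (.bit b)), fun _ _ h => by simpa using h⟩

instance {α β : Type} [Enc α] [Enc β] : Enc (α × β) :=
  ⟨fun z => .node (enc z.1) (enc z.2), fun z w h => by
    simp only [Tree.node.injEq] at h
    exact Prod.ext (Enc.inj h.1) (Enc.inj h.2)⟩

/-- The tree of a list. -/
def encList {α : Type} [Enc α] : List α → Tree
  | [] => .leaf none
  | a :: l => .node (enc a) (encList l)

instance {α : Type} [Enc α] : Enc (List α) :=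
  ⟨encList, fun l => by
    induction l with
    | nil => intro l' h; cases l' <;> simp_all [encList]
    | cons a l ih =>
      intro l' h
      cases l' with
      | nil => simp [encList] at h
      | cons b l' =>
        simp only [encList, Tree.node.injEq] at h
        rw [Enc.inj h.1, ih h.2]⟩

/-- Numbers are written in binary. -/
instance : Enc ℕ :=
  ⟨fun n => enc n.bits, fun m n h => by
    have h := congrArg (fun l => Nat.ofDigits 2 (l.map fun b : Bool => cond b 1 0)) (Enc.inj h)
    simpa only [← Nat.digits_two_eq_bits, Nat.ofDigits_digits] using h⟩

/-- The size of the tree of an element. -/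
def size {α : Type} [Enc α] (a : α) : ℕ := (enc a).size

section size

variable {α β : Type} [Enc α] [Enc β]

@[simp] theorem size_pair (a : α) (b : β) : size (a, b) = size a + size b + 1 := by
  simp [size, enc]

theorem size_fst_le (z : α × β) : size z.1 ≤ size z := by
  obtain ⟨a, b⟩ := z
  rw [size_pair]; dsimp only; omega

theorem size_snd_le (z : α × β) : size z.2 ≤ size z := by
  obtain ⟨a, b⟩ := z
  rw [size_pair]; dsimp only; omega

@[simp] theorem size_nil : size ([] : List α) = 1 := rfl

@[simp] theorem size_cons (a : α) (l : List α) : size (a :: l) = size a + size l + 1 := by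
  simp [size, enc, encList]

@[simp] theorem size_bool (b : Bool) : size b = 1 := rfl

theorem size_append (l l' : List α) : size (l ++ l') + 1 = size l + size l' := by
  induction l with
  | nil => simp; omega
  | cons a l ih => simp; omega

theorem size_pos (a : α) : 0 < size a := by
  rw [size, Tree.size]
  cases enc a <;> simp [Tree.ser]

theorem length_le_size (l : List α) : l.length < size l := by
  induction l with
  | nil => simp
  | cons a l ih => simp; omega

theorem size_le_of_mem {a : α} {l : List α} (h : a ∈ l) : size a ≤ size l := by
  induction l with
  | nil => cases h
  | cons b l ih =>
    rcases List.mem_cons.1 h with rfl | h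
    · simp; omega
    · have := ih h; simp; omega

theorem size_le_of_prefix {l l' : List α} (h : l <+: l') : size l ≤ size l' := by
  obtain ⟨r, rfl⟩ := h
  have := size_append l r
  have := size_pos r
  omega

theorem size_le_of_sublist {l l' : List α} (h : l.Sublist l') : size l ≤ size l' := by
  induction h with
  | slnil => exact le_rfl
  | cons a _ ih => simp; omega
  | cons_cons a _ ih => simp; omega

theorem size_le_of_forall {l : List α} {k : ℕ} (h : ∀ a ∈ l, size a ≤ k) :
    size l ≤ l.length * (k + 1) + 1 := by
  induction l with
  | nil => simp
  | cons a l ih =>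
    have h₁ := h a (by simp)
    have h₂ := ih fun b hb => h b (by simp [hb])
    simp only [size_cons, List.length_cons]
    linarith [add_mul l.length 1 (k + 1)]

end size

/-! ### Bounds -/

/-- The two kinds of bounds. -/
inductive Mode
  | poly | exp

/-- The function is bounded polynomially, or exponentially in a polynomial, in the size. -/
def Bd {α : Type} [Enc α] : Mode → (α → ℕ) → Prop
  | .poly, t => ∃ c, ∀ a, t a ≤ (size a + 2) ^ c
  | .exp, t => ∃ c, ∀ a, t a ≤ 2 ^ (size a + 2) ^ c

namespace Bd

variable {α β : Type} [Enc α] [Enc β] {m : Mode} {t t' : α → ℕ}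

theorem mono (h : Bd m t) (ht : ∀ a, t' a ≤ t a) : Bd m t' := by
  cases m <;> exact h.imp fun c h a => (ht a).trans (h a)

theorem pow_add_pow_le {x : ℕ} (hx : 2 ≤ x) (c d : ℕ) : x ^ c + x ^ d ≤ x ^ (c + d + 1) := by
  have h₁ : x ^ c ≤ x ^ (c + d) := Nat.pow_le_pow_right (by omega) (by omega)
  have h₂ : x ^ d ≤ x ^ (c + d) := Nat.pow_le_pow_right (by omega) (by omega)
  rw [pow_succ]
  have h₃ := Nat.mul_le_mul_left (x ^ (c + d)) hx
  omega

theorem const (k : ℕ) : Bd m fun _ : α => k := by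
  have h : ∀ a : α, k ≤ (size a + 2) ^ k := fun a =>
    Nat.lt_two_pow_self.le.trans (Nat.pow_le_pow_left (by omega) k)
  cases m
  · exact ⟨k, h⟩
  · exact ⟨k, fun a => (h a).trans Nat.lt_two_pow_self.le⟩

theorem exp_of_poly (h : Bd .poly t) : Bd m t := by
  cases m
  · exact h
  · exact h.imp fun c h a => (h a).trans Nat.lt_two_pow_self.le

theorem size : Bd m (StackMachine.size : α → ℕ) :=
  exp_of_poly ⟨1, fun a => by rw [pow_one]; omega⟩

theorem mul (h : Bd m t) (h' : Bd m t') : Bd m fun a => t a * t' a := by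
  cases m <;> obtain ⟨c, h⟩ := h <;> obtain ⟨d, h'⟩ := h'
  · exact ⟨c + d, fun a => (Nat.mul_le_mul (h a) (h' a)).trans (pow_add ..).ge⟩
  · refine ⟨c + d + 1, fun a => (Nat.mul_le_mul (h a) (h' a)).trans ?_⟩
    rw [← pow_add]
    exact Nat.pow_le_pow_right (by omega) (pow_add_pow_le (by omega) c d)

theorem add (h : Bd m t) (h' : Bd m t') : Bd m fun a => t a + t' a := by
  cases m <;> obtain ⟨c, h⟩ := h <;> obtain ⟨d, h'⟩ := h'
  · exact ⟨c + d + 1, fun a => (Nat.add_le_add (h a) (h' a)).trans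
      (pow_add_pow_le (by omega) c d)⟩
  · refine ⟨c + d + 1 + 0 + 1, fun a => (Nat.add_le_add (h a) (h' a)).trans
      ((pow_add_pow_le le_rfl _ _).trans (Nat.pow_le_pow_right (by omega) ?_))⟩
    have h₁ := pow_add_pow_le (x := StackMachine.size a + 2) (by omega) c d
    have h₂ := pow_add_pow_le (x := StackMachine.size a + 2) (by omega) (c + d + 1) 0
    rw [pow_zero] at h₂
    omega

theorem pow (h : Bd m t) (k : ℕ) : Bd m fun a => t a ^ k := by
  induction k with
  | zero => simpa using const 1
  | succ k ih => simpa only [pow_succ] using ih.mul h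

/-- A polynomial bound in a quantity that is itself bounded. -/
theorem comp_poly {t : β → ℕ} (ht : Bd .poly t) {f : α → β} {u : α → ℕ} (hu : Bd m u)
    (hf : ∀ a, StackMachine.size (f a) ≤ u a) : Bd m fun a => t (f a) := by
  obtain ⟨c, ht⟩ := ht
  exact ((hu.add (const 2)).pow c).mono fun a =>
    (ht _).trans (Nat.pow_le_pow_left (by have := hf a; omega) c)

end Bd

/-! ### Functions computed within bounds -/

section Within

variable {α β γ δ : Type} [Enc α] [Enc β] [Enc γ] [Enc δ] {m : Mode}

variable (aux) in
/-- Some machine computes `f`, with running time and output size bounded by `t`. -/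
def Within (t : α → ℕ) (f : α → β) : Prop :=
  ∃ M : Machine aux, ∀ a, size (f a) ≤ t a ∧ M.Computes (enc a) (enc (f a)) (t a)

variable (aux) in
/-- Some machine computes `f` within a bound of kind `m`. -/
def Comp (m : Mode) (f : α → β) : Prop := ∃ t, Bd m t ∧ Within aux t f

theorem Within.comp {t : α → ℕ} {u : β → ℕ} {g : β → γ} {f : α → β} (hg : Within aux u g)
    (hf : Within aux t f) : Within aux (fun a => t a + u (f a)) fun a => g (f a) := by
  obtain ⟨M, hM⟩ := hf
  obtain ⟨N, hN⟩ := hg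
  exact ⟨Mach.seq M N, fun a => ⟨(hN _).1.trans (Nat.le_add_left _ _), (hM a).2.seq (hN _).2⟩⟩

theorem Within.pair {t u : α → ℕ} {f : α → β} {g : α → γ} (hf : Within aux t f)
    (hg : Within aux u g) :
    Within aux (fun a => t a + u a + 10 * (size a + u a) + 12) fun a => (f a, g a) := by
  obtain ⟨M, hM⟩ := hf
  obtain ⟨N, hN⟩ := hg
  refine ⟨Machine.pair M N, fun a => ?_⟩
  obtain ⟨h₁, h₂⟩ := hM a
  obtain ⟨h₃, h₄⟩ := hN a
  refine ⟨?_, (pair_computes h₂ h₄).mono ?_⟩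
  · simp; omega
  · simp only [size] at *; omega

theorem Comp.exp_of_poly {f : α → β} (h : Comp aux .poly f) : Comp aux m f := by
  obtain ⟨t, ht, h⟩ := h
  exact ⟨t, ht.exp_of_poly, h⟩

theorem Comp.exists_size_le {f : α → β} (h : Comp aux m f) :
    ∃ t, Bd m t ∧ ∀ a, size (f a) ≤ t a := by
  obtain ⟨t, ht, M, h⟩ := h
  exact ⟨t, ht, fun a => (h a).1⟩

theorem Comp.comp {g : β → γ} {f : α → β} (hg : Comp aux .poly g) (hf : Comp aux m f) :
    Comp aux m fun a => g (f a) := by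
  obtain ⟨t, ht, hf⟩ := hf
  obtain ⟨u, hu, hg⟩ := hg
  exact ⟨_, ht.add (hu.comp_poly ht fun a => (hf.choose_spec a).1), hg.comp hf⟩

theorem Comp.pair {f : α → β} {g : α → γ} (hf : Comp aux m f) (hg : Comp aux m g) :
    Comp aux m fun a => (f a, g a) := by
  obtain ⟨t, ht, hf⟩ := hf
  obtain ⟨u, hu, hg⟩ := hg
  exact ⟨_, ((ht.add hu).add ((Bd.const 10).mul (Bd.size.add hu))).add (Bd.const 12), hf.pair hg⟩

theorem Comp.of_computes {f : α → β} (M : Machine aux) {t u : α → ℕ} (ht : Bd m t) (hu : Bd m u)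
    (h : ∀ a, M.Computes (enc a) (enc (f a)) (t a)) (h' : ∀ a, size (f a) ≤ u a) :
    Comp aux m f :=
  ⟨_, ht.add hu, M, fun a => ⟨(h' a).trans (Nat.le_add_left _ _),
    (h a).mono (Nat.le_add_right _ _)⟩⟩

/-- Folding over a list: `T` bounds the size of all intermediate results and the time of all
steps. -/
theorem Comp.foldl {l : α → List β} {i : α → γ} {s : α → γ → β → γ} {t : α × γ × β → ℕ}
    (hl : Comp aux m l) (hi : Comp aux m i)
    (hs : Within aux t fun z : α × γ × β => s z.1 z.2.1 z.2.2) {T : α → ℕ} (hT : Bd m T)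
    (h : ∀ a l', l' <+: l a → size (l'.foldl (s a) (i a)) ≤ T a)
    (h' : ∀ a l' b, l' ++ [b] <+: l a → t (a, l'.foldl (s a) (i a), b) ≤ T a) :
    Comp aux m fun a => (l a).foldl (s a) (i a) := by
  obtain ⟨M, hM⟩ := hs
  -- the loop alone
  have key : ∀ (a : α) (K : ℕ) (l : List β) (c : γ),
      (∀ l', l' <+: l → size (l'.foldl (s a) c) ≤ K) →
      (∀ l' b, l' ++ [b] <+: l → t (a, l'.foldl (s a) c, b) ≤ K) →
      (loopSnd (foldStep M)).Computes (.node (enc l) (.node (enc a) (enc c)))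
        (.node (enc ([] : List β)) (.node (enc a) (enc (l.foldl (s a) c))))
        (l.length * (K + 1000 * (size a + 2 * K + size l + 3) + 2) + 1) := by
    intro a K l
    induction l with
    | nil =>
      intro c _ _ r
      exact (loopSnd_on_false _ _ _).mono (by simp)
    | cons b l ih =>
      intro c h₁ h₂ r
      have h₃ := (hM (a, c, b)).2.mono (h₂ [] b (by simp))
      have h₄ := h₁ [] (by simp)
      have h₅ := h₁ [b] (by simp)
      have h₆ := ih (s a c b) (fun l' hl' => by
          simpa using h₁ (b :: l') (by simpa using hl'))
        (fun l' b' hl' => by simpa using h₂ (b :: l') b' (by simpa using hl'))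
      refine (loopSnd_on_true (foldStep_computes (l := enc l) h₃ r) (h₆ r)).mono ?_
      simp only [List.foldl_nil, List.foldl_cons] at h₄ h₅
      have e₁ : l.length * (K + 1000 * (size a + 2 * K + size l + 3) + 2) ≤
          l.length * (K + 1000 * (size a + 2 * K + size (b :: l) + 3) + 2) :=
        Nat.mul_le_mul_left _ (by simp; omega)
      rw [List.length_cons, add_mul, one_mul]
      have e₂ := size_cons b l
      simp only [size] at *
      omega
  obtain ⟨u, hu, Ml, hMl⟩ := hl
  obtain ⟨w, hw, Mi, hMi⟩ := hi
  refine .of_computes (m := m) (u := T) (Mach.seq (Machine.pair Ml (Machine.pair skip Mi))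
    (Mach.seq (loopSnd (foldStep M)) (Mach.seq snd snd)))
    (t := fun a => (u a + (1 + w a + 10 * (size a + w a) + 12) +
      10 * (size a + (size a + w a + 1)) + 12) +
      (u a * (T a + 1000 * (size a + 2 * T a + u a + 3) + 2) + 1 +
        ((6 * (1 + (size a + T a + 1)) + 9) + (6 * (size a + T a) + 9)))) ?_ hT ?_ ?_
  · have c := fun k => Bd.const (α := α) (m := m) k
    have z := Bd.size (α := α) (m := m)
    exact (((hu.add ((((c 1).add hw).add ((c 10).mul (z.add hw))).add (c 12))).add
      ((c 10).mul (z.add ((z.add hw).add (c 1))))).add (c 12)).add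
      (((hu.mul ((hT.add ((c 1000).mul (((z.add ((c 2).mul hT)).add hu).add (c 3)))).add
        (c 2))).add (c 1)).add ((((c 6).mul ((c 1).add ((z.add hT).add (c 1)))).add (c 9)).add
          (((c 6).mul (z.add hT)).add (c 9))))
  · intro a
    obtain ⟨l₁, l₂⟩ := hMl a
    obtain ⟨i₁, i₂⟩ := hMi a
    have e₁ := key a (T a) (l a) (i a) (h a) (h' a)
    have e₂ := h a (l a) List.prefix_rfl
    have e₃ := length_le_size (l a)
    have e₄ : (l a).length * (T a + 1000 * (size a + 2 * T a + size (l a) + 3) + 2) ≤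
      u a * (T a + 1000 * (size a + 2 * T a + u a + 3) + 2) :=
      Nat.mul_le_mul (by omega) (by omega)
    refine ((pair_computes l₂ (pair_computes (skip_computes _) i₂)).seq
      (e₁.seq ((snd_computes _ _).seq (snd_computes _ _)))).mono ?_
    have e₅ : (enc ([] : List β)).size = 1 := rfl
    simp only [Tree.size_node, size, e₅] at *
    omega
  · intro a
    exact h a _ List.prefix_rfl

end Within

/-! ### Functions computable in polynomial time -/

variable {α β γ δ : Type} [Enc α] [Enc β] [Enc γ] [Enc δ] {m : Mode}

variable (aux) in
/-- The function is computable in polynomial time by a machine that may use the stacks and the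
code of the oracle. -/
@[fun_prop]
def Poly (f : α → β) : Prop := Comp aux .poly f

namespace Poly

theorem of_computes {f : α → β} (M : Machine aux) {t u : α → ℕ} (ht : Bd .poly t) (hu : Bd .poly u)
    (h : ∀ a, M.Computes (enc a) (enc (f a)) (t a)) (h' : ∀ a, size (f a) ≤ u a) :
    Poly aux f :=
  Comp.of_computes M ht hu h h'

/-- Only the trees of arguments and values matter. -/
theorem of_enc_eq {α' β' : Type} [Enc α'] [Enc β'] {g : α' → β'} (hg : Poly aux g) {f : α → β}
    (φ : α → α') (hφ : ∀ a, enc (φ a) = enc a) (h : ∀ a, enc (f a) = enc (g (φ a))) :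
    Poly aux f := by
  obtain ⟨t, ⟨c, hc⟩, M, hM⟩ := hg
  refine ⟨fun a => t (φ a), ⟨c, fun a => ?_⟩, M, fun a => ?_⟩
  · have := hc (φ a)
    rwa [size, hφ, ← size] at this
  · have := hM (φ a)
    rwa [size, ← h, ← size, hφ] at this

@[fun_prop]
theorem id : Poly aux fun a : α => a :=
  of_computes skip (Bd.const 1) Bd.size (fun _ => skip_computes _) fun _ => le_rfl

@[fun_prop]
theorem const (b : β) : Poly aux fun _ : α => b :=
  of_computes (Machine.const (enc b)) (((Bd.const 2).mul Bd.size).add (Bd.const (size b + 3)))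
    (Bd.const (size b)) (fun a => (const_computes _ _).mono (by simp only [size]; omega))
    fun _ => le_rfl

@[fun_prop]
theorem comp {g : β → γ} {f : α → β} (hg : Poly aux g) (hf : Poly aux f) :
    Poly aux fun a => g (f a) :=
  Comp.comp hg hf

@[fun_prop]
theorem prodMk {f : α → β} {g : α → γ} (hf : Poly aux f) (hg : Poly aux g) :
    Poly aux fun a => (f a, g a) :=
  Comp.pair hf hg

@[fun_prop]
theorem fst : Poly aux (Prod.fst : α × β → α) :=
  of_computes Machine.fst (((Bd.const 6).mul Bd.size).add (Bd.const 9)) Bd.size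
    (fun a => (fst_computes _ _).mono (by simp [size, enc]))
    size_fst_le

@[fun_prop]
theorem snd : Poly aux (Prod.snd : α × β → β) :=
  of_computes Machine.snd (((Bd.const 6).mul Bd.size).add (Bd.const 9)) Bd.size
    (fun a => (snd_computes _ _).mono (by simp [size, enc]))
    size_snd_le

theorem comp₂ {g : β → γ → δ} (hg : Poly aux fun z : β × γ => g z.1 z.2) {f : α → β} {f' : α → γ}
    (hf : Poly aux f) (hf' : Poly aux f') : Poly aux fun a => g (f a) (f' a) :=
  hg.comp (hf.prodMk hf')

theorem bd_size {f : α → β} (h : Poly aux f) : Bd .poly fun a => size (f a) := by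
  obtain ⟨t, ⟨c, hc⟩, M, hM⟩ := h
  exact ⟨c, fun a => (hM a).1.trans (hc a)⟩

end Poly

/-- Equality as a truth value. -/
def eqb (a b : α) : Bool := decide (enc a = enc b)

@[simp] theorem eqb_iff {a b : α} : eqb a b = true ↔ a = b := by
  simp [eqb, Enc.inj.eq_iff]

theorem eqb_eq_decide [DecidableEq α] (a b : α) : eqb a b = decide (a = b) := by
  rw [Bool.eq_iff_iff, eqb_iff, decide_eq_true_iff]

namespace Poly

@[fun_prop]
theorem eqb {f g : α → β} (hf : Poly aux f) (hg : Poly aux g) :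
    Poly aux fun a => eqb (f a) (g a) := by
  refine comp (g := fun z : β × β => StackMachine.eqb z.1 z.2) ?_ (hf.prodMk hg)
  refine of_computes eqPair (((Bd.const 4).mul Bd.size).add (Bd.const 7)) (Bd.const 1)
    (fun a => (eqPair_computes _ _).mono ?_) fun _ => le_rfl
  simp [size, enc]

@[fun_prop]
theorem cond {c : α → Bool} {f g : α → β} (hc : Poly aux c) (hf : Poly aux f) (hg : Poly aux g) :
    Poly aux fun a => bif c a then f a else g a := by
  suffices h : Poly aux fun z : Bool × α => bif z.1 then f z.2 else g z.2 from
    comp h (hc.prodMk id)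
  obtain ⟨t, ht, M, hM⟩ := hf
  obtain ⟨u, hu, N, hN⟩ := hg
  have e₁ : Bd .poly fun z : Bool × α => t z.2 :=
    ht.comp_poly Bd.size size_snd_le
  have e₂ : Bd .poly fun z : Bool × α => u z.2 :=
    hu.comp_poly Bd.size size_snd_le
  refine of_computes (condPair M N) ((e₁.add e₂).add (Bd.const 4)) (e₁.add e₂) ?_ ?_
  · rintro ⟨b, a⟩
    cases b
    · exact (condPair_computes_false (hN a).2).mono (by simp)
    · exact (condPair_computes_true (hM a).2).mono (by simp)
  · rintro ⟨b, a⟩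
    cases b
    · exact (hN a).1.trans (by simp)
    · exact (hM a).1.trans (by simp)

@[fun_prop]
theorem not {c : α → Bool} (hc : Poly aux c) : Poly aux fun a => !c a := by
  have : Poly aux fun a => bif c a then false else true := by fun_prop
  convert this using 2 with a
  cases c a <;> rfl

@[fun_prop]
theorem and {c d : α → Bool} (hc : Poly aux c) (hd : Poly aux d) :
    Poly aux fun a => c a && d a := by
  have : Poly aux fun a => bif c a then d a else false := by fun_prop
  convert this using 2 with a
  cases c a <;> rfl

@[fun_prop]
theorem or {c d : α → Bool} (hc : Poly aux c) (hd : Poly aux d) :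
    Poly aux fun a => c a || d a := by
  have : Poly aux fun a => bif c a then true else d a := by fun_prop
  convert this using 2 with a
  cases c a <;> rfl

/-! ### Lists -/

@[fun_prop]
theorem cons {f : α → β} {g : α → List β} (hf : Poly aux f) (hg : Poly aux g) :
    Poly aux fun a => f a :: g a :=
  (hf.prodMk hg).of_enc_eq (fun a => a) (fun _ => rfl) fun _ => rfl

@[fun_prop]
theorem isEmpty {f : α → List β} (hf : Poly aux f) : Poly aux fun a => (f a).isEmpty := by
  refine comp (g := fun l : List β => l.isEmpty) ?_ hf
  refine of_computes (Machine.cases (Machine.const (enc false)) (Machine.const (enc true)))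
    (((Bd.const 2).mul Bd.size).add (Bd.const 6)) (Bd.const 1) (fun l => ?_) fun _ => le_rfl
  cases l with
  | nil => exact (cases_computes_leaf (const_computes _ _)).mono (by simp [enc])
  | cons b l => exact (cases_computes_node (const_computes _ _)).mono (by
        simp [enc, size, encList])

@[fun_prop]
theorem tail {f : α → List β} (hf : Poly aux f) : Poly aux fun a => (f a).tail := by
  refine comp (g := fun l : List β => l.tail) ?_ hf
  refine of_computes (Machine.cases Machine.snd skip)
    (((Bd.const 6).mul Bd.size).add (Bd.const 11)) Bd.size (fun l => ?_) fun l => ?_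
  · cases l with
    | nil => exact (cases_computes_leaf (skip_computes _)).mono (by simp)
    | cons b l => exact (cases_computes_node (snd_computes _ _)).mono (by
        simp [size, enc, encList])
  · cases l <;> simp; omega

@[fun_prop]
theorem headD (b : β) {f : α → List β} (hf : Poly aux f) : Poly aux fun a => (f a).headD b := by
  refine comp (g := fun l : List β => l.headD b) ?_ hf
  refine of_computes (Machine.cases Machine.fst (Machine.const (enc b)))
    (((Bd.const 6).mul Bd.size).add (Bd.const (size b + 11))) (Bd.size.add (Bd.const (size b)))
    (fun l => ?_) fun l => ?_
  · cases l with
    | nil => exact (cases_computes_leaf (const_computes _ _)).mono (by simp [size, enc]; omega)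
    | cons c l => exact (cases_computes_node (fst_computes _ _)).mono (by
        simp [size, enc, encList]; omega)
  · cases l <;> simp; omega

end Poly

/-- Folding with a step that is computable in polynomial time: only the sizes of the intermediate
results have to be bounded. -/
theorem Comp.foldl_poly {l : α → List β} {i : α → γ} {s : α → γ → β → γ}
    (hl : Comp aux m l) (hi : Comp aux m i) (hs : Poly aux fun z : α × γ × β => s z.1 z.2.1 z.2.2)
    {T : α → ℕ} (hT : Bd m T) (h : ∀ a l', l' <+: l a → size (l'.foldl (s a) (i a)) ≤ T a) :
    Comp aux m fun a => (l a).foldl (s a) (i a) := by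
  obtain ⟨t, ⟨c, hc⟩, hs⟩ := hs
  obtain ⟨u, hu, hl'⟩ := hl.exists_size_le
  refine Comp.foldl hl hi hs
    (hT.add ((((Bd.size.add hT).add hu).add (Bd.const 4)).pow c)) ?_ ?_
  · exact fun a l' hl' => (h a l' hl').trans (Nat.le_add_right _ _)
  · intro a l' b hb
    have h₁ := h a l' ((List.prefix_append _ _).trans hb)
    have h₂ := size_le_of_mem (hb.subset (List.mem_append_right l' (List.mem_singleton_self b)))
    refine (hc _).trans ((Nat.pow_le_pow_left ?_ c).trans (Nat.le_add_left _ _))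
    have := hl' a
    simp only [size_pair]
    omega

namespace Poly

theorem foldl {l : α → List β} {i : α → γ} {s : α → γ → β → γ}
    (hl : Poly aux l) (hi : Poly aux i) (hs : Poly aux fun z : α × γ × β => s z.1 z.2.1 z.2.2)
    {T : α → ℕ} (hT : Bd .poly T) (h : ∀ a l', l' <+: l a → size (l'.foldl (s a) (i a)) ≤ T a) :
    Poly aux fun a => (l a).foldl (s a) (i a) :=
  Comp.foldl_poly hl hi hs hT h

@[fun_prop]
theorem reverse {f : α → List β} (hf : Poly aux f) : Poly aux fun a => (f a).reverse := by
  refine comp (g := fun l : List β => l.reverse) ?_ hf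
  have h : Poly aux fun l : List β => l.foldl (fun c b => b :: c) [] := by
    refine foldl id (const _) (s := fun _ c b => b :: c) (by fun_prop) Bd.size fun l l' hl' => ?_
    have : ∀ (l c : List β), size (l.foldl (fun c b => b :: c) c) + 1 = size l + size c := by
      intro l
      induction l with
      | nil => intro c; simp; omega
      | cons b l ih => intro c; have := ih (b :: c); simp at this ⊢; omega
    have h₁ := this l' []
    have h₂ := size_le_of_prefix hl'
    rw [size_nil] at h₁
    omega
  simpa [List.foldl_flip_cons_eq_append] using h

@[fun_prop]
theorem append {f g : α → List β} (hf : Poly aux f) (hg : Poly aux g) :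
    Poly aux fun a => f a ++ g a := by
  refine comp (g := fun z : List β × List β => z.1 ++ z.2) ?_ (hf.prodMk hg)
  have h : Poly aux fun z : List β × List β => z.1.reverse.foldl (fun c b => b :: c) z.2 := by
    refine foldl (by fun_prop) (by fun_prop) (s := fun _ c b => b :: c) (by fun_prop)
      (T := fun z => size z.1.reverse + size z.2) ?_ fun z l' hl' => ?_
    · refine Bd.add ?_ ?_
      · exact (show Poly aux fun z : List β × List β => z.1.reverse by fun_prop).bd_size
      · exact (show Poly aux fun z : List β × List β => z.2 by fun_prop).bd_size
    · have : ∀ (l c : List β), size (l.foldl (fun c b => b :: c) c) + 1 = size l + size c := by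
        intro l
        induction l with
        | nil => intro c; simp; omega
        | cons b l ih => intro c; have := ih (b :: c); simp at this ⊢; omega
      have h₁ := this l' z.2
      have h₂ := size_le_of_prefix hl'
      omega
  simpa [List.foldl_flip_cons_eq_append] using h

@[fun_prop]
theorem flatMap {l : α → List β} {f : α → β → List γ} (hl : Poly aux l)
    (hf : Poly aux fun z : α × β => f z.1 z.2) : Poly aux fun a => (l a).flatMap (f a) := by
  obtain ⟨c, hc⟩ := hf.bd_size
  obtain ⟨d, hd⟩ := hl.bd_size
  have hd' : Bd .poly fun a => size (l a) := ⟨d, hd⟩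
  have h : Poly aux fun a => (l a).foldl (fun c b => c ++ f a b) [] := by
    refine foldl hl (by fun_prop) (s := fun a c b => c ++ f a b) (by fun_prop)
      (T := fun a => size (l a) * (size a + size (l a) + 4) ^ c + 1)
      ((hd'.mul (((Bd.size.add hd').add (Bd.const 4)).pow c)).add (Bd.const 1))
      fun a l' hl' => ?_
    have key : ∀ (l' : List β) (e : List γ), (∀ b ∈ l', b ∈ l a) →
        size (l'.foldl (fun c b => c ++ f a b) e) ≤
          l'.length * (size a + size (l a) + 4) ^ c + size e := by
      intro l'
      induction l' with
      | nil => intro e _; simp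
      | cons b l' ih =>
        intro e h
        have h₁ := ih (e ++ f a b) fun b hb => h b (by simp [hb])
        have h₂ := size_append e (f a b)
        have h₃ : size (f a b) ≤ (size a + size (l a) + 4) ^ c := by
          refine (hc (a, b)).trans (Nat.pow_le_pow_left ?_ c)
          have := size_le_of_mem (h b (by simp))
          simp only [size_pair]
          omega
        rw [List.foldl_cons, List.length_cons, add_mul, one_mul]
        omega
    refine (key l' [] fun b hb => hl'.subset hb).trans ?_
    rw [size_nil]
    exact Nat.add_le_add_right (Nat.mul_le_mul_right _ (hl'.length_le.trans
      (length_le_size _).le)) 1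
  have e : ∀ a, (l a).foldl (fun c b => c ++ f a b) [] = (l a).flatMap (f a) := fun a => by
    rw [List.flatMap_eq_foldl]
  simpa only [e] using h

@[fun_prop]
theorem map {l : α → List β} {f : α → β → γ} (hl : Poly aux l)
    (hf : Poly aux fun z : α × β => f z.1 z.2) : Poly aux fun a => (l a).map (f a) := by
  have h : Poly aux fun a => (l a).flatMap fun b => [f a b] :=
    flatMap hl (f := fun a b => [f a b]) (by fun_prop)
  simpa only [List.map_eq_flatMap] using h

@[fun_prop]
theorem filter {l : α → List β} {p : α → β → Bool} (hl : Poly aux l)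
    (hp : Poly aux fun z : α × β => p z.1 z.2) : Poly aux fun a => (l a).filter (p a) := by
  have h : Poly aux fun a => (l a).flatMap fun b => bif p a b then [b] else [] :=
    flatMap hl (f := fun a b => bif p a b then [b] else []) (by fun_prop)
  have e : ∀ a (l : List β), (l.flatMap fun b => bif p a b then [b] else []) = l.filter (p a) := by
    intro a l
    induction l with
    | nil => rfl
    | cons b l ih => cases h : p a b <;> simp_all
  simpa only [e] using h

@[fun_prop]
theorem any {l : α → List β} {p : α → β → Bool} (hl : Poly aux l)
    (hp : Poly aux fun z : α × β => p z.1 z.2) : Poly aux fun a => (l a).any (p a) := by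
  have h : Poly aux fun a => !((l a).filter (p a)).isEmpty := by fun_prop
  have e : ∀ a (l : List β), (!(l.filter (p a)).isEmpty) = l.any (p a) := by
    intro a l
    induction l with
    | nil => rfl
    | cons b l ih => cases h : p a b <;> simp_all
  simpa only [e] using h

@[fun_prop]
theorem all {l : α → List β} {p : α → β → Bool} (hl : Poly aux l)
    (hp : Poly aux fun z : α × β => p z.1 z.2) : Poly aux fun a => (l a).all (p a) := by
  have h : Poly aux fun a => !(l a).any fun b => !p a b := by fun_prop
  simpa [List.any_eq_not_all_not] using h

end Poly

/-- Membership as a truth value. -/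
def memb (a : α) (l : List α) : Bool := l.any fun b => eqb a b

@[simp] theorem memb_iff {a : α} {l : List α} : memb a l = true ↔ a ∈ l := by
  simp [memb]

@[fun_prop]
theorem Poly.memb {f : α → β} {l : α → List β} (hf : Poly aux f) (hl : Poly aux l) :
    Poly aux fun a => memb (f a) (l a) := by
  unfold StackMachine.memb
  fun_prop

/-! ### Encodings of TBoxes and facts as trees -/

theorem code_injective : Function.Injective ConceptName.code := fun A B h => by
  cases A <;> cases B <;> simp_all [ConceptName.code]

/-- Concept names are written as their numbers. -/
instance : Enc ConceptName := ⟨fun A => enc A.code, fun _ _ h => code_injective (Enc.inj h)⟩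

instance : Enc ExAxiom :=
  ⟨fun ρ => enc (ρ.A, ρ.R, ρ.B), fun ρ ρ' h => by
    have h : (ρ.A, ρ.R, ρ.B) = (ρ'.A, ρ'.R, ρ'.B) := Enc.inj h
    cases ρ; cases ρ'; simp_all⟩

instance : Enc Var := ⟨fun v => enc v.val, fun _ _ h => Fin.ext (Enc.inj h)⟩

/-- The predicate of an atom: its kind and its name. -/
def key {τ : Type} : Atom τ → ℕ × ℕ
  | .concept A _ => (0, A.code)
  | .role R _ _ => (1, R)
  | .eq _ _ => (2, 0)

/-- The first argument. -/
def arg₁ {τ : Type} : Atom τ → τ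
  | .concept _ t => t
  | .role _ t _ => t
  | .eq t _ => t

/-- The last argument. -/
def arg₂ {τ : Type} : Atom τ → τ
  | .concept _ t => t
  | .role _ _ u => u
  | .eq _ u => u

theorem atom_ext {τ : Type} {a b : Atom τ} (h : key a = key b) (h₁ : arg₁ a = arg₁ b)
    (h₂ : arg₂ a = arg₂ b) : a = b := by
  cases a <;> cases b <;> simp_all [key, arg₁, arg₂, code_injective.eq_iff]

instance {τ : Type} [Enc τ] : Enc (Atom τ) :=
  ⟨fun a => enc (key a, arg₁ a, arg₂ a), fun a b h => by
    have h : (key a, arg₁ a, arg₂ a) = (key b, arg₁ b, arg₂ b) := Enc.inj h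
    simp only [Prod.mk.injEq] at h
    exact atom_ext h.1 h.2.1 h.2.2⟩

/-- The atom with the same predicate and given arguments. -/
def relabel₂ {τ υ : Type} (t u : υ) : Atom τ → Atom υ
  | .concept A _ => .concept A t
  | .role R _ _ => .role R t u
  | .eq _ _ => .eq t u

namespace Poly

variable {α τ υ : Type} [Enc α] [Enc τ] [Enc υ]

@[fun_prop]
theorem exA {f : α → ExAxiom} (hf : Poly aux f) : Poly aux fun a => (f a).A :=
  comp (g := ExAxiom.A) ((show Poly aux fun z : ConceptName × RoleName × ConceptName => z.1 by
    fun_prop).of_enc_eq (fun ρ => (ρ.A, ρ.R, ρ.B)) (fun _ => rfl) fun _ => rfl) hf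

@[fun_prop]
theorem exR {f : α → ExAxiom} (hf : Poly aux f) : Poly aux fun a => (f a).R :=
  comp (g := ExAxiom.R) ((show Poly aux fun z : ConceptName × RoleName × ConceptName => z.2.1 by
    fun_prop).of_enc_eq (fun ρ => (ρ.A, ρ.R, ρ.B)) (fun _ => rfl) fun _ => rfl) hf

@[fun_prop]
theorem exB {f : α → ExAxiom} (hf : Poly aux f) : Poly aux fun a => (f a).B :=
  comp (g := ExAxiom.B) ((show Poly aux fun z : ConceptName × RoleName × ConceptName => z.2.2 by
    fun_prop).of_enc_eq (fun ρ => (ρ.A, ρ.R, ρ.B)) (fun _ => rfl) fun _ => rfl) hf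

@[fun_prop]
theorem exMk {f : α → ConceptName} {g : α → ℕ} {h : α → ConceptName} (hf : Poly aux f)
    (hg : Poly aux g) (hh : Poly aux h) : Poly aux fun a => ExAxiom.mk (f a) (g a) (h a) :=
  (show Poly aux fun a => (f a, g a, h a) by fun_prop).of_enc_eq (fun a => a) (fun _ => rfl)
    fun _ => rfl

@[fun_prop]
theorem code {f : α → ConceptName} (hf : Poly aux f) : Poly aux fun a => (f a).code :=
  hf.of_enc_eq (fun a => a) (fun _ => rfl) fun _ => rfl

/-- The tree of an atom is that of the triple of its predicate and its arguments. -/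
theorem triple : Poly aux fun a : Atom τ => (key a, arg₁ a, arg₂ a) :=
  (id (α := Atom τ)).of_enc_eq (fun a => a) (fun _ => rfl) fun _ => rfl

@[fun_prop]
theorem key {f : α → Atom τ} (hf : Poly aux f) : Poly aux fun a => key (f a) :=
  comp (g := fun z : (ℕ × ℕ) × τ × τ => z.1) (by fun_prop) (triple.comp hf)

@[fun_prop]
theorem arg₁ {f : α → Atom τ} (hf : Poly aux f) : Poly aux fun a => arg₁ (f a) :=
  comp (g := fun z : (ℕ × ℕ) × τ × τ => z.2.1) (by fun_prop) (triple.comp hf)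

@[fun_prop]
theorem arg₂ {f : α → Atom τ} (hf : Poly aux f) : Poly aux fun a => arg₂ (f a) :=
  comp (g := fun z : (ℕ × ℕ) × τ × τ => z.2.2) (by fun_prop) (triple.comp hf)

@[fun_prop]
theorem concept {f : α → ConceptName} {g : α → τ} (hf : Poly aux f) (hg : Poly aux g) :
    Poly aux fun a => Atom.concept (f a) (g a) :=
  (show Poly aux fun a => ((0, (f a).code), g a, g a) by fun_prop).of_enc_eq (fun a => a)
    (fun _ => rfl) fun _ => rfl

@[fun_prop]
theorem role {f : α → ℕ} {g h : α → τ} (hf : Poly aux f) (hg : Poly aux g) (hh : Poly aux h) :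
    Poly aux fun a => Atom.role (f a) (g a) (h a) :=
  (show Poly aux fun a => ((1, f a), g a, h a) by fun_prop).of_enc_eq (fun a => a)
    (fun _ => rfl) fun _ => rfl

@[fun_prop]
theorem atomEq {g h : α → τ} (hg : Poly aux g) (hh : Poly aux h) :
    Poly aux fun a => Atom.eq (g a) (h a) :=
  (show Poly aux fun a => ((2, 0), g a, h a) by fun_prop).of_enc_eq (fun a => a)
    (fun _ => rfl) fun _ => rfl

@[fun_prop]
theorem atomMap {f : α → Atom τ} {σ : α → τ → υ} (hf : Poly aux f)
    (hσ : Poly aux fun z : α × τ => σ z.1 z.2) : Poly aux fun a => (f a).map (σ a) := by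
  have h₁ : Poly aux fun a => σ a (StackMachine.arg₁ (f a)) := hσ.comp₂ id (by fun_prop)
  have h₂ : Poly aux fun a => σ a (StackMachine.arg₂ (f a)) := hσ.comp₂ id (by fun_prop)
  refine (show Poly aux fun a => (StackMachine.key (f a), σ a (StackMachine.arg₁ (f a)),
    σ a (StackMachine.arg₂ (f a))) by fun_prop).of_enc_eq (fun a => a) (fun _ => rfl) fun a => ?_
  cases f a <;> rfl

@[fun_prop]
theorem relabel₂ {f : α → Atom τ} {g h : α → υ} (hf : Poly aux f) (hg : Poly aux g)
    (hh : Poly aux h) : Poly aux fun a => relabel₂ (g a) (h a) (f a) := by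
  refine (show Poly aux fun a => (StackMachine.key (f a), g a,
    bif StackMachine.eqb (StackMachine.key (f a)).1 0 then g a else h a) by fun_prop).of_enc_eq
      (fun a => a) (fun _ => rfl) fun a => ?_
  cases f a
  · rw [show StackMachine.eqb (StackMachine.key (Atom.concept _ _)).1 0 = true from eqb_iff.2 rfl]
    rfl
  · rw [show StackMachine.eqb (StackMachine.key (Atom.role _ _ _)).1 0 = false from
      Bool.eq_false_iff.2 (mt eqb_iff.1 (by simp [StackMachine.key]))]
    rfl
  · rw [show StackMachine.eqb (StackMachine.key (Atom.eq _ _)).1 0 = false from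
      Bool.eq_false_iff.2 (mt eqb_iff.1 (by simp [StackMachine.key]))]
    rfl

end Poly

/-! ### The decision procedure -/

/-- Terms over `⋆`, as the list of their function symbols from the outside in. -/
abbrev Tm := List ExAxiom

/-- The rules of a TBox: the TGDs without existential variables, the axioms `A ⊑ ∃ R . B`, and
the bodies of the EGDs, all of which have the head `y ≈ z`. -/
abbrev RuleData := List (List (Atom Var) × List (Atom Var)) × List ExAxiom × List (List (Atom Var))

/-- What the decision procedure works with: rules, terms, and the pairs of terms that are in the
term order. -/
abbrev Env := RuleData × List Tm × List (Tm × Tm)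

namespace Env

/-- The TGDs without existential variables. -/
def tgds (E : Env) := E.1.1
/-- The existential axioms. -/
def exs (E : Env) := E.1.2.1
/-- The bodies of the EGDs. -/
def egds (E : Env) := E.1.2.2
/-- The terms. -/
def terms (E : Env) := E.2.1
/-- The pairs of terms whose first component is greater. -/
def gts (E : Env) := E.2.2

/-- All pairs of terms. -/
def pairs (E : Env) : List (Tm × Tm) := E.terms.flatMap fun t => E.terms.map fun u => (t, u)

/-- All triples of terms. -/
def trips (E : Env) : List (Tm × Tm × Tm) :=
  E.terms.flatMap fun t => E.pairs.map fun z => (t, z)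

end Env

/-- The atoms of an existential rule. -/
def exAtoms (ρ : ExAxiom) : List (Atom Var) := [.concept ρ.A 0, .role ρ.R 0 1, .concept ρ.B 1]

namespace Env

/-- The atoms that occur in TGDs. -/
def tgdAtoms (E : Env) : List (Atom Var) :=
  (E.tgds.flatMap fun r => r.1 ++ r.2) ++ E.exs.flatMap exAtoms

/-- One atom at least for each predicate. -/
def atoms (E : Env) : List (Atom Var) :=
  E.tgdAtoms ++ ((E.egds.flatMap fun b => b) ++ [.eq 0 1])

/-- All facts over the terms. -/
def univ (E : Env) : List (Atom Tm) :=
  E.atoms.flatMap fun a => E.pairs.map fun z => relabel₂ z.1 z.2 a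

end Env

/-- The substitution given by a triple of terms. -/
def sel (z : Tm × Tm × Tm) (v : Var) : Tm :=
  bif eqb v 0 then z.1 else bif eqb v 1 then z.2.1 else z.2.2

/-- The instances of all atoms of a body are among the given facts. -/
def sats (b : List (Atom Var)) (z : Tm × Tm × Tm) (S : List (Atom Tm)) : Bool :=
  b.all fun a => memb (a.map (sel z)) S

/-- Saturation inside the list `U` under the derivation step `d`. -/
def sat {β : Type} [Enc β] (U : List β) (d : List β → β → Bool) : List β :=
  U.foldl (fun S _ => U.filter fun x => memb x S || d S x) []

/-- The two lists have the same elements. -/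
def same {β : Type} [Enc β] (l l' : List β) : Bool :=
  (l.all fun x => memb x l') && l'.all fun x => memb x l

namespace Env

variable (E : Env)

/-- One step in the derivation of the congruence given by the facts `F`. -/
def congStep (F : List (Atom Tm)) (S : List (Tm × Tm)) (p : Tm × Tm) : Bool :=
  eqb p.1 p.2 || memb (p.2, p.1) S ||
  (E.terms.any fun v => memb (p.1, v) S && memb (v, p.2) S) ||
  (E.exs.any fun ρ => S.any fun q => eqb p.1 (ρ :: q.1) && eqb p.2 (ρ :: q.2)) ||
  E.egds.any fun b => E.trips.any fun z => sats b z F && eqb p z.2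

/-- The congruence given by the facts `F`, on the terms. -/
def cong (F : List (Atom Tm)) : List (Tm × Tm) := sat E.pairs (E.congStep F)

/-- The term `u` is the greatest one that is congruent to `t` according to the list `C`. -/
def isRep (C : List (Tm × Tm)) (t u : Tm) : Bool :=
  memb (t, u) C && E.terms.all fun u' => !memb (t, u') C || eqb u' u || memb (u, u') E.gts

/-- The application of the EGDs. -/
def stepEGD (F : List (Atom Tm)) : List (Atom Tm) :=
  E.univ.filter fun φ => F.any fun ψ => eqb (key ψ) (key φ) &&
    E.isRep (E.cong F) (arg₁ ψ) (arg₁ φ) && E.isRep (E.cong F) (arg₂ ψ) (arg₂ φ)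

/-- The fact `φ` follows by a TGD without existential variables. -/
def follows (F : List (Atom Tm)) (φ : Atom Tm) : Bool :=
  E.tgds.any fun r => E.trips.any fun z => sats r.1 z F && r.2.any fun a => eqb φ (a.map (sel z))

/-- The application of the TGDs without existential variables. -/
def stepUniv (F : List (Atom Tm)) : List (Atom Tm) :=
  E.univ.filter fun φ => memb φ F || E.follows F φ

/-- The states of the simulation of the chase: the current facts, all facts so far, and the
current form of the term (as a list that contains just this term). -/
abbrev State := List (Atom Tm) × List (Atom Tm) × List Tm

/-- One step of the chase without existential rules. -/
def step (F : List (Atom Tm)) : List (Atom Tm) :=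
  bif same (E.stepEGD F) F then E.stepUniv F else E.stepEGD F

theorem step_sublist (F : List (Atom Tm)) : (E.step F).Sublist E.univ := by
  unfold step
  cases same (E.stepEGD F) F <;> exact List.filter_sublist

/-- The current form of the term after one step of the chase. -/
def stepTerm (F : List (Atom Tm)) (W : List Tm) : List Tm :=
  E.terms.filter fun v => bif same (E.stepEGD F) F then memb v W
    else W.any fun w => E.isRep (E.cong F) w v

/-- One step of the simulation. -/
def stepState (x : State) : State :=
  (E.step x.1, E.univ.filter fun φ => memb φ x.2.1 || memb φ (E.step x.1), E.stepTerm x.1 x.2.2)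

end Env

/-- The instance given by a term. -/
def inst : Tm → List (Atom Tm)
  | [] => []
  | ρ :: s => .concept ρ.A s :: .role ρ.R s (ρ :: s) :: .concept ρ.B (ρ :: s) :: inst s

/-- Replace `u` by `t` everywhere. -/
def repl (u t : Tm) : Tm → Tm
  | [] => bif eqb [] u then t else []
  | ρ :: s => bif eqb (ρ :: s) u then t else ρ :: repl u t s

/-- The first list is not longer. -/
def lenLe (t u : Tm) : Bool := !(t.foldl (fun c _ => c.tail) (true :: u.map fun _ => true)).isEmpty

/-- The term is `n`-cyclic. -/
def cyc (n : ℕ) (t : Tm) : Bool := t.any fun ρ => !((t.filter fun ρ' => eqb ρ ρ').drop n).isEmpty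

namespace Env

variable (E : Env)

/-- The initial state for the term `s`. -/
def init (s : Tm) : State :=
  (E.univ.filter fun φ => memb φ (inst s), E.univ.filter fun φ => memb φ (inst s),
    E.terms.filter fun v => eqb v s)

/-- A list that is long enough for the chase to become stationary. -/
def clock : List (Atom Tm) := (E.univ ++ E.univ).flatMap fun _ => E.univ ++ E.univ

/-- The final state for the term `s`. -/
def run (s : Tm) : State := E.clock.foldl (fun x _ => E.stepState x) (E.init s)

/-- The term `ρ(s)` is restricted. -/
def restr (ρ : ExAxiom) (s : Tm) : Bool :=
  (E.run s).2.2.any fun v => E.terms.any fun u =>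
    memb (.role ρ.R v u) (E.run s).2.1 && memb (.concept ρ.B u) (E.run s).2.1

/-- One step in the derivation of the overchase. -/
def overStep (S : List (Atom Tm)) (φ : Atom Tm) : Bool :=
  (E.tgdAtoms.any fun a => eqb φ (a.map fun _ => [])) ||
  E.follows S φ ||
  (E.exs.any fun ρ => E.terms.any fun t => memb (.concept ρ.A t) S && !E.restr ρ t &&
    (eqb φ (.role ρ.R t (ρ :: t)) || eqb φ (.concept ρ.B (ρ :: t)))) ||
  (E.egds.any fun b => E.trips.any fun z => sats b z S &&
    (eqb φ (.eq z.2.1 z.2.2) || eqb φ (.eq z.2.2 z.2.1))) ||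
  S.any fun a => S.any fun e => !eqb (key a).1 2 && eqb (key e).1 2 &&
    lenLe (arg₁ e) (arg₂ e) && (eqb (arg₂ e) (arg₁ a) || eqb (arg₂ e) (arg₂ a)) &&
    eqb φ (a.map (repl (arg₂ e) (arg₁ e)))

/-- The part of the overchase that can be derived inside the terms. -/
def overList : List (Atom Tm) := sat E.univ E.overStep

/-- No `n`-cyclic term occurs. -/
def accept (n : ℕ) : Bool := E.overList.all fun φ => !cyc n (arg₁ φ) && !cyc n (arg₂ φ)

end Env

/-! ### The decision procedure runs in polynomial time -/

namespace Poly

variable {α β : Type} [Enc α] [Enc β] {E : α → Env}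

@[fun_prop]
theorem tgds (hE : Poly aux E) : Poly aux fun a => (E a).tgds := by unfold Env.tgds; fun_prop

@[fun_prop]
theorem exs (hE : Poly aux E) : Poly aux fun a => (E a).exs := by unfold Env.exs; fun_prop

@[fun_prop]
theorem egds (hE : Poly aux E) : Poly aux fun a => (E a).egds := by unfold Env.egds; fun_prop

@[fun_prop]
theorem terms (hE : Poly aux E) : Poly aux fun a => (E a).terms := by unfold Env.terms; fun_prop

@[fun_prop]
theorem gts (hE : Poly aux E) : Poly aux fun a => (E a).gts := by unfold Env.gts; fun_prop

@[fun_prop]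
theorem pairs (hE : Poly aux E) : Poly aux fun a => (E a).pairs := by unfold Env.pairs; fun_prop

@[fun_prop]
theorem trips (hE : Poly aux E) : Poly aux fun a => (E a).trips := by unfold Env.trips; fun_prop

@[fun_prop]
theorem exAtoms {f : α → ExAxiom} (hf : Poly aux f) : Poly aux fun a => exAtoms (f a) := by
  unfold StackMachine.exAtoms; fun_prop

@[fun_prop]
theorem tgdAtoms (hE : Poly aux E) : Poly aux fun a => (E a).tgdAtoms := by
  unfold Env.tgdAtoms; fun_prop

@[fun_prop]
theorem atoms (hE : Poly aux E) : Poly aux fun a => (E a).atoms := by unfold Env.atoms; fun_prop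

@[fun_prop]
theorem univ (hE : Poly aux E) : Poly aux fun a => (E a).univ := by unfold Env.univ; fun_prop

@[fun_prop]
theorem sel {z : α → Tm × Tm × Tm} {v : α → Var} (hz : Poly aux z) (hv : Poly aux v) :
    Poly aux fun a => sel (z a) (v a) := by
  unfold StackMachine.sel; fun_prop

@[fun_prop]
theorem sats {b : α → List (Atom Var)} {z : α → Tm × Tm × Tm} {S : α → List (Atom Tm)}
    (hb : Poly aux b) (hz : Poly aux z) (hS : Poly aux S) :
    Poly aux fun a => sats (b a) (z a) (S a) := by
  unfold StackMachine.sats; fun_prop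

@[fun_prop]
theorem same {l l' : α → List β} (hl : Poly aux l) (hl' : Poly aux l') :
    Poly aux fun a => same (l a) (l' a) := by
  unfold StackMachine.same; fun_prop

@[fun_prop]
theorem sat {U : α → List β} {d : α → List β → β → Bool} (hU : Poly aux U)
    (hd : Poly aux fun z : α × List β × β => d z.1 z.2.1 z.2.2) :
    Poly aux fun a => sat (U a) (d a) := by
  have hd' : Poly aux fun z : (α × List β × β) × β => d z.1.1 z.1.2.1 z.2 :=
    hd.comp (f := fun z : (α × List β × β) × β => (z.1.1, z.1.2.1, z.2)) (by fun_prop)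
  refine foldl (T := fun a => size (U a) + 1) hU (const _)
    (s := fun a S _ => (U a).filter fun x => StackMachine.memb x S || d a S x) (by fun_prop)
    (Bd.add hU.bd_size (Bd.const 1)) fun a l' hl' => ?_
  rcases List.eq_nil_or_concat' l' with rfl | ⟨l, b, rfl⟩
  · simp
  · rw [List.foldl_append]
    exact (size_le_of_sublist List.filter_sublist).trans (Nat.le_add_right _ _)

@[fun_prop]
theorem congStep {F : α → List (Atom Tm)} {S : α → List (Tm × Tm)} {p : α → Tm × Tm}
    (hE : Poly aux E) (hF : Poly aux F) (hS : Poly aux S) (hp : Poly aux p) :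
    Poly aux fun a => (E a).congStep (F a) (S a) (p a) := by
  unfold Env.congStep; fun_prop

@[fun_prop]
theorem cong {F : α → List (Atom Tm)} (hE : Poly aux E) (hF : Poly aux F) :
    Poly aux fun a => (E a).cong (F a) := by
  unfold Env.cong; fun_prop

@[fun_prop]
theorem isRep {C : α → List (Tm × Tm)} {t u : α → Tm} (hE : Poly aux E) (hC : Poly aux C)
    (ht : Poly aux t) (hu : Poly aux u) : Poly aux fun a => (E a).isRep (C a) (t a) (u a) := by
  unfold Env.isRep; fun_prop

@[fun_prop]
theorem stepEGD {F : α → List (Atom Tm)} (hE : Poly aux E) (hF : Poly aux F) :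
    Poly aux fun a => (E a).stepEGD (F a) := by
  unfold Env.stepEGD; fun_prop

@[fun_prop]
theorem follows {F : α → List (Atom Tm)} {φ : α → Atom Tm} (hE : Poly aux E) (hF : Poly aux F)
    (hφ : Poly aux φ) : Poly aux fun a => (E a).follows (F a) (φ a) := by
  unfold Env.follows; fun_prop

@[fun_prop]
theorem stepUniv {F : α → List (Atom Tm)} (hE : Poly aux E) (hF : Poly aux F) :
    Poly aux fun a => (E a).stepUniv (F a) := by
  unfold Env.stepUniv; fun_prop

@[fun_prop]
theorem step {F : α → List (Atom Tm)} (hE : Poly aux E) (hF : Poly aux F) :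
    Poly aux fun a => (E a).step (F a) := by
  unfold Env.step; fun_prop

@[fun_prop]
theorem stepTerm {F : α → List (Atom Tm)} {W : α → List Tm} (hE : Poly aux E) (hF : Poly aux F)
    (hW : Poly aux W) : Poly aux fun a => (E a).stepTerm (F a) (W a) := by
  unfold Env.stepTerm; fun_prop

@[fun_prop]
theorem stepState {x : α → Env.State} (hE : Poly aux E) (hx : Poly aux x) :
    Poly aux fun a => (E a).stepState (x a) := by
  unfold Env.stepState; fun_prop

theorem foldr {γ : Type} [Enc γ] {l : α → List β} {i : α → γ} {s : α → β → γ → γ}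
    (hl : Poly aux l) (hi : Poly aux i) (hs : Poly aux fun z : α × β × γ => s z.1 z.2.1 z.2.2)
    {T : α → ℕ} (hT : Bd .poly T) (h : ∀ a l', l' <:+ l a → size (l'.foldr (s a) (i a)) ≤ T a) :
    Poly aux fun a => (l a).foldr (s a) (i a) := by
  have hs' : Poly aux fun z : α × γ × β => s z.1 z.2.2 z.2.1 :=
    hs.comp (f := fun z : α × γ × β => (z.1, z.2.2, z.2.1)) (by fun_prop)
  have := foldl (l := fun a => (l a).reverse) (s := fun a c b => s a b c) (by fun_prop) hi hs' hT
    fun a l' hl' => by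
      have := h a l'.reverse (List.reverse_prefix.1 (by simpa using hl'))
      rwa [← List.foldl_reverse, List.reverse_reverse] at this
  simpa only [List.foldl_reverse] using this

@[fun_prop]
theorem tails {f : α → List β} (hf : Poly aux f) : Poly aux fun a => (f a).tails := by
  refine comp (g := fun l : List β => l.tails) ?_ hf
  have e : ∀ l : List β, l.foldr (fun b L => (b :: L.headD []) :: L) [[]] = l.tails := by
    intro l
    induction l with
    | nil => rfl
    | cons b l ih => rw [List.foldr_cons, ih]; cases l <;> rfl
  have h : Poly aux fun l : List β => l.foldr (fun b L => (b :: L.headD []) :: L) [[]] := by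
    refine foldr (s := fun _ b L => (b :: L.headD []) :: L) id (const _) (by fun_prop)
      (T := fun l => size l * (size l + 1) + 1)
      ((Bd.size.mul (Bd.size.add (Bd.const 1))).add (Bd.const 1)) fun l l' hl' => ?_
    rw [e]
    have h₁ := size_le_of_sublist hl'.sublist
    refine (size_le_of_forall (k := size l) fun t ht => ?_).trans ?_
    · exact (size_le_of_sublist (((List.mem_tails _ _).1 ht).sublist)).trans h₁
    · have h₂ := length_le_size l'
      rw [List.length_tails]
      exact Nat.add_le_add_right (Nat.mul_le_mul_right _ (by omega)) 1
  simpa only [e] using h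

@[fun_prop]
theorem inst {f : α → Tm} (hf : Poly aux f) : Poly aux fun a => inst (f a) := by
  let ρ₀ : ExAxiom := ⟨.top, 0, .top⟩
  have h : Poly aux fun a => (f a).tails.flatMap fun t => bif t.isEmpty then [] else
      [Atom.concept (t.headD ρ₀).A t.tail, Atom.role (t.headD ρ₀).R t.tail t,
        Atom.concept (t.headD ρ₀).B t] := by
    fun_prop
  convert h using 2 with a
  generalize f a = s
  induction s with
  | nil => rfl
  | cons ρ s ih => simp [StackMachine.inst, ih]

@[fun_prop]
theorem repl {u t s : α → Tm} (hu : Poly aux u) (ht : Poly aux t) (hs : Poly aux s) :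
    Poly aux fun a => repl (u a) (t a) (s a) := by
  have e : ∀ u t s : Tm, s.foldr (fun ρ c => (ρ :: c.1, bif StackMachine.eqb (ρ :: c.1) u then t
      else ρ :: c.2)) ([], bif StackMachine.eqb [] u then t else []) =
        (s, StackMachine.repl u t s) := by
    intro u t s
    induction s with
    | nil => rfl
    | cons ρ s ih => rw [List.foldr_cons, ih]; rfl
  have h : Poly aux fun a => (s a).foldr (fun ρ c => (ρ :: c.1,
      bif StackMachine.eqb (ρ :: c.1) (u a) then t a else ρ :: c.2))
        (([] : Tm), bif StackMachine.eqb [] (u a) then t a else []) := by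
    refine foldr (s := fun a ρ c => (ρ :: c.1, bif StackMachine.eqb (ρ :: c.1) (u a) then t a
      else ρ :: c.2)) hs (by fun_prop) (by fun_prop)
      (T := fun a => 2 * size (s a) + size (t a) + 1)
      ((((Bd.const 2).mul hs.bd_size).add ht.bd_size).add (Bd.const 1)) fun a l' hl' => ?_
    rw [e, size_pair]
    have h₁ := size_le_of_sublist hl'.sublist
    have h₂ : size (StackMachine.repl (u a) (t a) l') ≤ size l' + size (t a) := by
      generalize l' = s
      induction s with
      | nil => unfold StackMachine.repl; cases StackMachine.eqb [] (u a) <;> simp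
      | cons ρ s ih =>
        unfold StackMachine.repl
        cases StackMachine.eqb (ρ :: s) (u a) <;> simp; omega
    omega
  simp only [e] at h
  exact snd.comp h

@[fun_prop]
theorem lenLe {t u : α → Tm} (ht : Poly aux t) (hu : Poly aux u) :
    Poly aux fun a => lenLe (t a) (u a) := by
  have hi : Poly aux fun a => true :: (u a).map fun _ => true := by fun_prop
  have h : Poly aux fun a => (t a).foldl (fun c _ => c.tail) (true :: (u a).map fun _ => true) := by
    refine foldl (s := fun _ c _ => c.tail) ht hi (by fun_prop) hi.bd_size fun a l' _ => ?_
    clear * -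
    generalize (true :: (u a).map fun _ => true) = c
    induction l' generalizing c with
    | nil => exact le_rfl
    | cons b l' ih => exact (ih c.tail).trans (size_le_of_sublist (List.tail_sublist c))
  unfold StackMachine.lenLe
  fun_prop

@[fun_prop]
theorem drop (n : ℕ) {f : α → List β} (hf : Poly aux f) : Poly aux fun a => (f a).drop n := by
  induction n generalizing f with
  | zero => simpa using hf
  | succ n ih =>
    have := ih (f := fun a => (f a).tail) (by fun_prop)
    simpa only [List.drop_tail] using this

@[fun_prop]
theorem cyc (n : ℕ) {t : α → Tm} (ht : Poly aux t) : Poly aux fun a => cyc n (t a) := by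
  unfold StackMachine.cyc; fun_prop

@[fun_prop]
theorem init {s : α → Tm} (hE : Poly aux E) (hs : Poly aux s) :
    Poly aux fun a => (E a).init (s a) := by
  unfold Env.init; fun_prop

@[fun_prop]
theorem clock (hE : Poly aux E) : Poly aux fun a => (E a).clock := by
  unfold Env.clock; fun_prop

@[fun_prop]
theorem run {s : α → Tm} (hE : Poly aux E) (hs : Poly aux s) :
    Poly aux fun a => (E a).run (s a) := by
  have h₁ : Bd .poly fun a => size (E a).univ := (univ hE).bd_size
  have h₂ : Bd .poly fun a => size (E a).terms := (terms hE).bd_size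
  refine foldl (s := fun a x _ => (E a).stepState x)
    (T := fun a => 2 * size (E a).univ + size (E a).terms + 2) (by fun_prop) (by fun_prop)
    (by fun_prop) ((((Bd.const 2).mul h₁).add h₂).add (Bd.const 2)) fun a l' _ => ?_
  have key : ∀ x : Env.State, size x.1 ≤ size (E a).univ → size x.2.1 ≤ size (E a).univ →
      size x.2.2 ≤ size (E a).terms → size x ≤ 2 * size (E a).univ + size (E a).terms + 2 := by
    rintro ⟨F, C, W⟩ h₁ h₂ h₃
    simp only [size_pair] at *
    omega
  rcases List.eq_nil_or_concat' l' with rfl | ⟨l, b, rfl⟩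
  · exact key _ (size_le_of_sublist List.filter_sublist) (size_le_of_sublist List.filter_sublist)
      (size_le_of_sublist List.filter_sublist)
  · rw [List.foldl_append]
    refine key _ ?_ (size_le_of_sublist List.filter_sublist)
      (size_le_of_sublist List.filter_sublist)
    exact size_le_of_sublist (Env.step_sublist _ _)

@[fun_prop]
theorem restr {ρ : α → ExAxiom} {s : α → Tm} (hE : Poly aux E) (hρ : Poly aux ρ)
    (hs : Poly aux s) : Poly aux fun a => (E a).restr (ρ a) (s a) := by
  unfold Env.restr; fun_prop

@[fun_prop]
theorem overStep {S : α → List (Atom Tm)} {φ : α → Atom Tm} (hE : Poly aux E) (hS : Poly aux S)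
    (hφ : Poly aux φ) : Poly aux fun a => (E a).overStep (S a) (φ a) := by
  unfold Env.overStep; fun_prop

@[fun_prop]
theorem overList (hE : Poly aux E) : Poly aux fun a => (E a).overList := by
  unfold Env.overList; fun_prop

@[fun_prop]
theorem accept (n : ℕ) (hE : Poly aux E) : Poly aux fun a => (E a).accept n := by
  unfold Env.accept; fun_prop

end Poly

/-! ### Saturation -/

section Sat

variable {β : Type} [Enc β] {U : List β} {d : List β → β → Bool}

theorem sat_eq_iterate :
    sat U d = (fun S => U.filter fun x => memb x S || d S x)^[U.length] [] :=
  List.foldl_const _ _ _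

theorem sat_sound {P : β → Prop} (h : ∀ S x, (∀ y ∈ S, P y) → x ∈ U → d S x = true → P x) :
    ∀ x ∈ sat U d, P x := by
  rw [sat_eq_iterate]
  generalize U.length = k
  induction k with
  | zero => simp
  | succ k ih =>
    intro x hx
    rw [Function.iterate_succ_apply', List.mem_filter, Bool.or_eq_true, memb_iff] at hx
    exact hx.2.elim (ih x) (h _ x ih hx.1)

theorem sat_subset : ∀ x ∈ sat U d, x ∈ U := by
  rw [sat_eq_iterate]
  cases U.length with
  | zero => simp
  | succ k =>
    intro x hx
    rw [Function.iterate_succ_apply'] at hx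
    exact List.mem_of_mem_filter hx

/-- After as many rounds as `U` has elements nothing is added any more. -/
theorem sat_closed {x : β} (hx : x ∈ U) (hd : d (sat U d) x = true) : x ∈ sat U d := by
  set f : List β → List β := fun S => U.filter fun x => memb x S || d S x with hf
  have mono : ∀ k, (f^[k] []).Sublist (f^[k + 1] []) := by
    intro k
    cases k with
    | zero => exact List.nil_sublist _
    | succ k =>
      have h : f^[k + 1] [] = f (f^[k] []) := Function.iterate_succ_apply' f k []
      have h' : f^[k + 1 + 1] [] = f (f^[k + 1] []) := Function.iterate_succ_apply' f (k + 1) []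
      have e : f (f^[k] []) = (f (f^[k + 1] [])).filter fun x =>
          memb x (f^[k] []) || d (f^[k] []) x := by
        rw [hf, List.filter_filter]
        refine List.filter_congr fun y hy => ?_
        cases hq : (memb y (f^[k] []) || d (f^[k] []) y) with
        | false => rfl
        | true =>
          have hm : y ∈ f^[k + 1] [] := h ▸ List.mem_filter.2 ⟨hy, hq⟩
          rw [Bool.true_and, memb_iff.2 hm, Bool.true_or]
      calc f^[k + 1] [] = _ := h.trans e
        List.Sublist _ (f (f^[k + 1] [])) := List.filter_sublist
        _ = _ := h'.symm
  have stable : ∃ k ≤ U.length, f^[k + 1] [] = f^[k] [] := by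
    by_contra! hne
    have hlen : ∀ k ≤ U.length + 1, k ≤ (f^[k] []).length := by
      intro k
      induction k with
      | zero => simp
      | succ k ih =>
        intro hk
        have h₁ := ih (by omega)
        have h₂ := (mono k).length_le
        have h₃ : (f^[k] []).length ≠ (f^[k + 1] []).length := fun h =>
          hne k (by omega) ((mono k).eq_of_length h).symm
        omega
    have h₁ := hlen _ le_rfl
    rw [Function.iterate_succ_apply'] at h₁
    have h₂ : (f (f^[U.length] [])).length ≤ U.length := List.length_filter_le ..
    omega
  obtain ⟨k, hk, h⟩ := stable
  have h₁ : sat U d = f^[k] [] := by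
    rw [sat_eq_iterate, ← hf]
    obtain ⟨j, hj⟩ := Nat.exists_eq_add_of_le hk
    rw [hj, Nat.add_comm, Function.iterate_add_apply]
    exact Function.iterate_fixed ((Function.iterate_succ_apply' f k []).symm.trans h) j
  rw [h₁] at hd ⊢
  rw [← h, Function.iterate_succ_apply']
  exact List.mem_filter.2 ⟨hx, by simp [hd]⟩

end Sat

/-! ### Terms and facts -/

/-- The term with the given function symbols. -/
def toTerm : Tm → Term
  | [] => Term.star
  | ρ :: s => .app ρ (toTerm s)

theorem toTerm_injective : Function.Injective toTerm := fun t => by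
  induction t with
  | nil => intro u h; cases u <;> simp_all [toTerm, Term.star]
  | cons ρ t ih =>
    intro u h
    cases u with
    | nil => simp [toTerm, Term.star] at h
    | cons ρ' u =>
      simp only [toTerm, Term.app.injEq] at h
      rw [h.1, ih h.2]

@[simp] theorem toTerm_inj {t u : Tm} : toTerm t = toTerm u ↔ t = u := toTerm_injective.eq_iff

@[simp] theorem depth_toTerm (t : Tm) : (toTerm t).depth = t.length := by
  induction t with
  | nil => rfl
  | cons ρ t ih => simp [toTerm, Term.depth, ih]

/-- The fact with the given terms. -/
abbrev toFact (φ : Atom Tm) : Fact := φ.map toTerm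

section Atom

variable {τ υ ω : Type}

@[simp] theorem key_map (f : τ → υ) (a : Atom τ) : key (a.map f) = key a := by cases a <;> rfl

@[simp] theorem arg₁_map (f : τ → υ) (a : Atom τ) : arg₁ (a.map f) = f (arg₁ a) := by
  cases a <;> rfl

@[simp] theorem arg₂_map (f : τ → υ) (a : Atom τ) : arg₂ (a.map f) = f (arg₂ a) := by
  cases a <;> rfl

theorem mem_args {t : τ} {a : Atom τ} : t ∈ a.args ↔ t = arg₁ a ∨ t = arg₂ a := by
  cases a <;> simp [Atom.args, arg₁, arg₂]

theorem map_map (f : τ → υ) (g : υ → ω) (a : Atom τ) :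
    (a.map f).map g = a.map fun x => g (f x) := by
  cases a <;> rfl

theorem map_congr {f g : τ → υ} {a : Atom τ} (h : ∀ t ∈ a.args, f t = g t) :
    a.map f = a.map g :=
  atom_ext (by simp) (by simpa using h _ (mem_args.2 (.inl rfl)))
    (by simpa using h _ (mem_args.2 (.inr rfl)))

theorem map_injective {f : τ → υ} (hf : Function.Injective f) :
    Function.Injective (Atom.map f) := fun a b h =>
  atom_ext (by simpa using congrArg key h) (hf (by simpa using congrArg arg₁ h))
    (hf (by simpa using congrArg arg₂ h))

end Atom

/-- The facts of a list. -/
def facts (F : List (Atom Tm)) : Set Fact := toFact '' {φ | φ ∈ F}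

@[simp] theorem toFact_mem_facts {φ : Atom Tm} {F : List (Atom Tm)} :
    toFact φ ∈ facts F ↔ φ ∈ F :=
  (map_injective toTerm_injective).mem_set_image

/-! ### The congruence on a finite set of terms -/

/-- A relation on a set of terms that is closed under subterms contains the restriction of the
generated congruence if it contains the generating pairs and satisfies the rules of a congruence
inside the set. -/
theorem Cong.of_closed {𝓡 : Set Rule} {F : Set Fact} {D : Set Term} {S : Term → Term → Prop}
    (hD : ∀ ρ t, Term.app ρ t ∈ D → t ∈ D) (hS : ∀ x y, S x y → x ∈ D)
    (hrefl : ∀ x ∈ D, S x x) (hsymm : ∀ x y, S x y → S y x)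
    (htrans : ∀ x y z, S x y → S y z → S x z)
    (happ : ∀ ρ x y, S x y → Term.app ρ x ∈ D → Term.app ρ y ∈ D → S (.app ρ x) (.app ρ y))
    (hgen : ∀ body v w σ, Rule.egd body v w ∈ 𝓡 → (∀ a ∈ body, a.map σ ∈ F) → S (σ v) (σ w))
    {x y : Term} (h : Cong 𝓡 F x y) (hx : x ∈ D) (hy : y ∈ D) : S x y := by
  classical
  have : Nonempty Term := ⟨Term.star⟩
  -- a choice of representatives, and the normal form it induces on all terms
  let r : Term → Term := fun x => Classical.epsilon (S x)
  have hr : ∀ x ∈ D, S x (r x) := fun x hx => Classical.epsilon_spec (p := S x) ⟨x, hrefl x hx⟩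
  have hr' : ∀ x y, S x y → r x = r y := fun x y h =>
    congrArg Classical.epsilon (funext fun z => propext
      ⟨fun h' => htrans _ _ _ (hsymm _ _ h) h', fun h' => htrans _ _ _ h h'⟩)
  let nf : Term → Term := Term.rec (fun c => if Term.const c ∈ D then r (.const c) else .const c)
    fun ρ _ t' => if h : ∃ v, S t' v ∧ Term.app ρ v ∈ D then r (.app ρ h.choose) else .app ρ t'
  have nf_eq : ∀ x ∈ D, nf x = r x := by
    intro x hx
    induction x with
    | const c => exact if_pos hx
    | app ρ t ih =>
      have h₁ := ih (hD _ _ hx)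
      have h₂ : ∃ v, S (nf t) v ∧ Term.app ρ v ∈ D :=
        ⟨t, h₁ ▸ hsymm _ _ (hr t (hD _ _ hx)), hx⟩
      refine (dif_pos h₂).trans (hr' _ _ (happ _ _ _ ?_ h₂.choose_spec.2 hx))
      exact hsymm _ _ (htrans _ _ _ (hr t (hD _ _ hx)) (h₁ ▸ h₂.choose_spec.1))
  have key : ∀ x y, Cong 𝓡 F x y → nf x = nf y := by
    intro x y h
    induction h with
    | egd body v w σ h₁ h₂ =>
      have h := hgen body v w σ h₁ h₂
      rw [nf_eq _ (hS _ _ h), nf_eq _ (hS _ _ (hsymm _ _ h)), hr' _ _ h]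
    | refl => rfl
    | symm _ ih => exact ih.symm
    | trans _ _ ih₁ ih₂ => exact ih₁.trans ih₂
    | @app ρ t u _ ih =>
      change (if h : ∃ v, S (nf t) v ∧ Term.app ρ v ∈ D then r (.app ρ h.choose)
          else .app ρ (nf t)) = (if h : ∃ v, S (nf u) v ∧ Term.app ρ v ∈ D then
          r (.app ρ h.choose) else .app ρ (nf u))
      rw [ih]
  have h₁ := key x y h
  rw [nf_eq x hx, nf_eq y hy] at h₁
  exact htrans _ _ _ (hr x hx) (h₁ ▸ hsymm _ _ (hr y hy))

/-! ### Environments that describe a TBox -/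

/-- The environment consists of the rules of the TBox `T`, all terms up to depth `D` over its
function symbols, and the restriction of the order `gt` to these terms. -/
structure Good (gt : Term → Term → Prop) (T : Set TBoxAxiom) (D : ℕ) (E : Env) : Prop where
  tgd : ∀ b h, Rule.tgd b h ∈ rulesOf T ↔ (b, h) ∈ E.tgds
  ex : ∀ ρ, Rule.ex ρ ∈ rulesOf T ↔ ρ ∈ E.exs
  egd : ∀ b v w, Rule.egd b v w ∈ rulesOf T ↔ b ∈ E.egds ∧ v = 1 ∧ w = 2
  terms : ∀ t, t ∈ E.terms ↔ t.length ≤ D ∧ ∀ ρ ∈ t, ρ ∈ E.exs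
  gts : ∀ t u, (t, u) ∈ E.gts ↔ t ∈ E.terms ∧ u ∈ E.terms ∧ gt (toTerm t) (toTerm u)
  head_vars : ∀ r ∈ E.tgds, ∀ a ∈ r.2, ∀ v ∈ a.args, ∃ b ∈ r.1, v ∈ b.args
  egd_vars : ∀ b ∈ E.egds, (∃ a ∈ b, (1 : Var) ∈ a.args) ∧ ∃ a ∈ b, (2 : Var) ∈ a.args

section Basic

variable {E : Env}

theorem mem_pairs {z : Tm × Tm} : z ∈ E.pairs ↔ z.1 ∈ E.terms ∧ z.2 ∈ E.terms := by
  obtain ⟨t, u⟩ := z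
  simp [Env.pairs]

theorem mem_trips {z : Tm × Tm × Tm} :
    z ∈ E.trips ↔ z.1 ∈ E.terms ∧ z.2.1 ∈ E.terms ∧ z.2.2 ∈ E.terms := by
  obtain ⟨t, u, v⟩ := z
  simp [Env.trips, mem_pairs]

theorem mem_univ {φ : Atom Tm} : φ ∈ E.univ ↔
    (∃ a ∈ E.atoms, key a = key φ) ∧ arg₁ φ ∈ E.terms ∧ arg₂ φ ∈ E.terms := by
  simp only [Env.univ, List.mem_flatMap, List.mem_map]
  constructor
  · rintro ⟨a, ha, z, hz, rfl⟩
    rw [mem_pairs] at hz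
    exact ⟨⟨a, ha, by cases a <;> rfl⟩, by cases a <;> exact hz.1,
      by cases a <;> first | exact hz.1 | exact hz.2⟩
  · rintro ⟨⟨a, ha, hk⟩, h₁, h₂⟩
    refine ⟨a, ha, (arg₁ φ, arg₂ φ), mem_pairs.2 ⟨h₁, h₂⟩, ?_⟩
    cases a <;> cases φ <;> simp_all [relabel₂, key, arg₁, arg₂, code_injective.eq_iff]

theorem sats_iff {b : List (Atom Var)} {z : Tm × Tm × Tm} {S : List (Atom Tm)} :
    sats b z S = true ↔ ∀ a ∈ b, a.map (sel z) ∈ S := by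
  simp [sats]

theorem sel_eq (σ : Var → Tm) : sel (σ 0, σ 1, σ 2) = σ := by
  funext v
  fin_cases v <;> simp [sel, eqb_eq_decide]

theorem sel_mem {z : Tm × Tm × Tm} (hz : z ∈ E.trips) (v : Var) : sel z v ∈ E.terms := by
  rw [mem_trips] at hz
  unfold sel
  cases eqb v 0 <;> cases eqb v 1 <;> simp [hz]

@[simp] theorem sel_one (z : Tm × Tm × Tm) : sel z 1 = z.2.1 :=
  congrFun (sel_eq ![z.1, z.2.1, z.2.2]) 1

@[simp] theorem sel_two (z : Tm × Tm × Tm) : sel z 2 = z.2.2 :=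
  congrFun (sel_eq ![z.1, z.2.1, z.2.2]) 2

end Basic

/-! ### The congruence and the rules on lists of facts -/

theorem mem_facts {x : Fact} {F : List (Atom Tm)} : x ∈ facts F ↔ ∃ φ ∈ F, toFact φ = x :=
  Iff.rfl

theorem facts_inj {F F' : List (Atom Tm)} : facts F = facts F' ↔ ∀ φ, φ ∈ F ↔ φ ∈ F' := by
  refine ⟨fun h φ => by rw [← toFact_mem_facts, h, toFact_mem_facts], fun h => ?_⟩
  ext x
  simp only [mem_facts, h]

theorem same_iff {F F' : List (Atom Tm)} : same F F' = true ↔ facts F = facts F' := by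
  simp only [same, Bool.and_eq_true, List.all_eq_true, memb_iff, facts_inj]
  exact ⟨fun h φ => ⟨h.1 φ, h.2 φ⟩, fun h => ⟨fun φ => (h φ).1, fun φ => (h φ).2⟩⟩

theorem Good.nil_mem {gt : Term → Term → Prop} {T : Set TBoxAxiom} {D : ℕ} {E : Env}
    (hG : Good gt T D E) : [] ∈ E.terms :=
  (hG.terms _).2 (by simp)

theorem egd_mem {gt : Term → Term → Prop} {T : Set TBoxAxiom} {D : ℕ} {E : Env}
    (hG : Good gt T D E) {b : List (Atom Var)} {v w : Var} :
    Rule.egd b v w ∈ nonExistentialRules T ↔ b ∈ E.egds ∧ v = 1 ∧ w = 2 := by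
  simp [nonExistentialRules, Rule.IsExistential, hG.egd]

theorem tgd_mem {gt : Term → Term → Prop} {T : Set TBoxAxiom} {D : ℕ} {E : Env}
    (hG : Good gt T D E) {b h : List (Atom Var)} :
    Rule.tgd b h ∈ nonExistentialRules T ↔ (b, h) ∈ E.tgds := by
  simp [nonExistentialRules, Rule.IsExistential, hG.tgd]

theorem toFact_map_sel (a : Atom Var) (z : Tm × Tm × Tm) :
    toFact (a.map (sel z)) = a.map fun v => toTerm (sel z v) :=
  map_map _ _ _

section Chase

variable {gt : Term → Term → Prop} {T : Set TBoxAxiom} {D : ℕ} {E : Env} (hG : Good gt T D E)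
  (hgt : IsTermOrder gt) {F : List (Atom Tm)} (hF : ∀ φ ∈ F, φ ∈ E.univ)

include hG hF in
/-- A match of a body in the facts is given by a triple of terms. -/
theorem exists_trip {b : List (Atom Var)} {σ : Var → Term} (h : ∀ a ∈ b, a.map σ ∈ facts F) :
    ∃ z ∈ E.trips, sats b z F = true ∧ ∀ a ∈ b, ∀ v ∈ a.args, σ v = toTerm (sel z v) := by
  classical
  have h₁ : ∀ v, ∃ t ∈ E.terms, (∃ u ∈ E.terms, σ v = toTerm u) → σ v = toTerm t := fun v => by
    by_cases hv : ∃ u ∈ E.terms, σ v = toTerm u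
    · exact hv.imp fun u hu => ⟨hu.1, fun _ => hu.2⟩
    · exact ⟨[], hG.nil_mem, fun h => absurd h hv⟩
  choose τ hτ hτ' using h₁
  have h₂ : ∀ a ∈ b, ∀ v ∈ a.args, σ v = toTerm (τ v) := fun a ha v hv => by
    obtain ⟨φ, hφ, e⟩ := h a ha
    have hu := mem_univ.1 (hF φ hφ)
    refine hτ' v ?_
    rcases mem_args.1 hv with rfl | rfl
    · exact ⟨arg₁ φ, hu.2.1, by simpa using (congrArg arg₁ e).symm⟩
    · exact ⟨arg₂ φ, hu.2.2, by simpa using (congrArg arg₂ e).symm⟩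
  refine ⟨(τ 0, τ 1, τ 2), mem_trips.2 ⟨hτ 0, hτ 1, hτ 2⟩, sats_iff.2 fun a ha => ?_, ?_⟩
  · rw [← toFact_mem_facts, toFact_map_sel, sel_eq, ← map_congr (h₂ a ha)]
    exact h a ha
  · rwa [sel_eq]

theorem sats_facts {b : List (Atom Var)} {z : Tm × Tm × Tm} (h : sats b z F = true) :
    ∀ a ∈ b, (a.map fun v => toTerm (sel z v)) ∈ facts F := fun a ha => by
  rw [← toFact_map_sel, toFact_mem_facts]
  exact sats_iff.1 h a ha

theorem congStep_iff {S : List (Tm × Tm)} {t u : Tm} : E.congStep F S (t, u) = true ↔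
    t = u ∨ (u, t) ∈ S ∨ (∃ v ∈ E.terms, (t, v) ∈ S ∧ (v, u) ∈ S) ∨
      (∃ ρ ∈ E.exs, ∃ q ∈ S, t = ρ :: q.1 ∧ u = ρ :: q.2) ∨
      ∃ b ∈ E.egds, ∃ z ∈ E.trips, sats b z F = true ∧ (t, u) = z.2 := by
  simp only [Env.congStep, Bool.or_eq_true, List.any_eq_true, Bool.and_eq_true, eqb_iff, memb_iff,
    or_assoc]

include hG in
theorem Good.tail_mem {ρ : ExAxiom} {t : Tm} (h : ρ :: t ∈ E.terms) : t ∈ E.terms := by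
  rw [hG.terms] at h ⊢
  simp only [List.length_cons, List.mem_cons, forall_eq_or_imp] at h
  exact ⟨by omega, h.2.2⟩

include hG hF in
/-- The saturation computes the restriction of the congruence to the terms. -/
theorem mem_cong {t u : Tm} : (t, u) ∈ E.cong F ↔ t ∈ E.terms ∧ u ∈ E.terms ∧
    Cong (nonExistentialRules T) (facts F) (toTerm t) (toTerm u) := by
  have hsub : ∀ {t u}, (t, u) ∈ E.cong F → t ∈ E.terms ∧ u ∈ E.terms := fun h =>
    mem_pairs.1 (sat_subset _ h)
  constructor
  · intro h
    refine ⟨(hsub h).1, (hsub h).2, ?_⟩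
    refine sat_sound (P := fun p => Cong (nonExistentialRules T) (facts F) (toTerm p.1)
      (toTerm p.2)) (fun S p hS _ hp => ?_) _ h
    obtain ⟨t, u⟩ := p
    rcases congStep_iff.1 hp with rfl | h | ⟨v, -, h₁, h₂⟩ | ⟨ρ, -, q, hq, rfl, rfl⟩ |
      ⟨b, hb, z, -, hz, e⟩
    · exact .refl _
    · exact .symm (hS _ h)
    · exact .trans (hS (t, v) h₁) (hS (v, u) h₂)
    · exact .app ρ (hS _ hq)
    · have := Cong.egd b 1 2 _ ((egd_mem hG).2 ⟨hb, rfl, rfl⟩) (sats_facts hz)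
      rw [sel_one, sel_two, ← e] at this
      exact this
  · rintro ⟨ht, hu, h⟩
    have hcl : ∀ {t u}, t ∈ E.terms → u ∈ E.terms → (E.congStep F (E.cong F) (t, u) = true) →
        (t, u) ∈ E.cong F := fun ht hu h => sat_closed (mem_pairs.2 ⟨ht, hu⟩) h
    have key := Cong.of_closed (𝓡 := nonExistentialRules T) (F := facts F)
      (D := toTerm '' {t | t ∈ E.terms})
      (S := fun x y => ∃ t u, (t, u) ∈ E.cong F ∧ toTerm t = x ∧ toTerm u = y) ?_ ?_ ?_ ?_ ?_ ?_ ?_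
      h ⟨t, ht, rfl⟩ ⟨u, hu, rfl⟩
    · obtain ⟨t', u', h', e₁, e₂⟩ := key
      rwa [toTerm_injective e₁, toTerm_injective e₂] at h'
    · rintro ρ x ⟨t, ht, e⟩
      cases t with
      | nil => simp [toTerm, Term.star] at e
      | cons ρ' t =>
        simp only [toTerm, Term.app.injEq] at e
        exact ⟨t, hG.tail_mem ht, e.2⟩
    · rintro x y ⟨t, u, h, rfl, rfl⟩
      exact ⟨t, (hsub h).1, rfl⟩
    · rintro x ⟨t, ht, rfl⟩
      exact ⟨t, t, hcl ht ht (congStep_iff.2 (.inl rfl)), rfl, rfl⟩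
    · rintro x y ⟨t, u, h, rfl, rfl⟩
      exact ⟨u, t, hcl (hsub h).2 (hsub h).1 (congStep_iff.2 (.inr (.inl h))), rfl, rfl⟩
    · rintro x y z ⟨t, u, h, rfl, rfl⟩ ⟨u', v, h', e, rfl⟩
      rw [toTerm_injective e] at h'
      exact ⟨t, v, hcl (hsub h).1 (hsub h').2
        (congStep_iff.2 (.inr (.inr (.inl ⟨u, (hsub h).2, h, h'⟩)))), rfl, rfl⟩
    · rintro ρ x y ⟨t, u, h, rfl, rfl⟩ ⟨t', ht', e₁⟩ ⟨u', hu', e₂⟩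
      obtain rfl : t' = ρ :: t := toTerm_injective e₁
      obtain rfl : u' = ρ :: u := toTerm_injective e₂
      exact ⟨_, _, hcl ht' hu' (congStep_iff.2 (.inr (.inr (.inr (.inl
        ⟨ρ, ((hG.terms _).1 ht').2 ρ (by simp), _, h, rfl, rfl⟩))))), rfl, rfl⟩
    · intro b v w σ hr hb
      obtain ⟨hb', rfl, rfl⟩ := (egd_mem hG).1 hr
      obtain ⟨z, hz, hs, e⟩ := exists_trip hG hF hb
      obtain ⟨⟨a, ha, hv⟩, a', ha', hw⟩ := hG.egd_vars b hb'
      have hz' := mem_trips.1 hz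
      refine ⟨z.2.1, z.2.2, hcl hz'.2.1 hz'.2.2 (congStep_iff.2 (.inr (.inr (.inr (.inr
        ⟨b, hb', z, hz, hs, rfl⟩))))), ?_, ?_⟩
      · rw [e a ha _ hv, sel_one]
      · rw [e a' ha' _ hw, sel_two]

include hG hF in
/-- The congruence does not leave the terms over `⋆` and the function symbols of the TBox. -/
theorem Cong.exists_toTerm {x y : Term} (h : Cong (nonExistentialRules T) (facts F) x y) :
    (∃ t : Tm, (∀ ρ ∈ t, ρ ∈ E.exs) ∧ toTerm t = x) ↔
      ∃ t : Tm, (∀ ρ ∈ t, ρ ∈ E.exs) ∧ toTerm t = y := by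
  induction h with
  | egd b v w σ hr hb =>
    obtain ⟨hb', rfl, rfl⟩ := (egd_mem hG).1 hr
    obtain ⟨z, hz, hs, e⟩ := exists_trip hG hF hb
    obtain ⟨⟨a, ha, hv⟩, a', ha', hw⟩ := hG.egd_vars b hb'
    exact iff_of_true ⟨_, ((hG.terms _).1 (sel_mem hz 1)).2, (e a ha _ hv).symm⟩
      ⟨_, ((hG.terms _).1 (sel_mem hz 2)).2, (e a' ha' _ hw).symm⟩
  | refl => rfl
  | symm _ ih => exact ih.symm
  | trans _ _ ih₁ ih₂ => exact ih₁.trans ih₂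
  | @app ρ x y _ ih =>
    have key : ∀ x, (∃ t : Tm, (∀ ρ ∈ t, ρ ∈ E.exs) ∧ toTerm t = .app ρ x) ↔
        ρ ∈ E.exs ∧ ∃ t : Tm, (∀ ρ ∈ t, ρ ∈ E.exs) ∧ toTerm t = x := fun x => by
      constructor
      · rintro ⟨t, ht, e⟩
        cases t with
        | nil => simp [toTerm, Term.star] at e
        | cons ρ' t =>
          simp only [toTerm, Term.app.injEq] at e
          obtain ⟨rfl, rfl⟩ := e
          simp only [List.mem_cons, forall_eq_or_imp] at ht
          exact ⟨ht.1, t, ht.2, rfl⟩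
      · rintro ⟨hρ, t, ht, rfl⟩
        exact ⟨ρ :: t, by simpa [hρ] using ht, rfl⟩
    rw [key, key, ih]

theorem isRep_spec {C : List (Tm × Tm)} {t u : Tm} : E.isRep C t u = true ↔
    (t, u) ∈ C ∧ ∀ u' ∈ E.terms, (t, u') ∈ C → u' ≠ u → (u, u') ∈ E.gts := by
  simp only [Env.isRep, Bool.and_eq_true, memb_iff, List.all_eq_true, Bool.or_eq_true,
    Bool.not_eq_true', ← Bool.not_eq_true, eqb_iff]
  refine and_congr_right fun _ => forall₂_congr fun u' _ => ?_
  tauto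

include hG hgt hF in
/-- The greatest congruent term has the least depth, hence it is one of the terms. -/
theorem isRep_iff {t : Tm} (ht : t ∈ E.terms) {x : Term} :
    IsRep gt (nonExistentialRules T) (facts F) (toTerm t) x ↔
      ∃ u ∈ E.terms, toTerm u = x ∧ E.isRep (E.cong F) t u = true := by
  constructor
  · rintro ⟨h₁, h₂⟩
    obtain ⟨u, hu, rfl⟩ := (Cong.exists_toTerm hG hF h₁).1 ⟨t, ((hG.terms t).1 ht).2, rfl⟩
    have hu' : u ∈ E.terms := by
      refine (hG.terms u).2 ⟨?_, hu⟩
      by_cases e : t = u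
      · exact e ▸ ((hG.terms t).1 ht).1
      · have := hgt.depth_le _ _ (h₂ (toTerm t) (.refl _) (by simpa using e))
        simp only [depth_toTerm] at this
        exact this.trans ((hG.terms t).1 ht).1
    refine ⟨u, hu', rfl, isRep_spec.2 ⟨(mem_cong hG hF).2 ⟨ht, hu', h₁⟩, fun v hv h₃ h₄ => ?_⟩⟩
    exact (hG.gts _ _).2 ⟨hu', hv, h₂ _ ((mem_cong hG hF).1 h₃).2.2 (by simpa using h₄)⟩
  · rintro ⟨u, hu, rfl, h⟩
    obtain ⟨h₁, h₂⟩ := isRep_spec.1 h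
    refine ⟨((mem_cong hG hF).1 h₁).2.2, fun y hy hne => ?_⟩
    obtain ⟨v, hv, rfl⟩ := (Cong.exists_toTerm hG hF hy).1 ⟨t, ((hG.terms t).1 ht).2, rfl⟩
    by_cases hl : v.length ≤ D
    · have hv' := (hG.terms v).2 ⟨hl, hv⟩
      exact ((hG.gts _ _).1 (h₂ v hv' ((mem_cong hG hF).2 ⟨ht, hv', hy⟩) (by simpa using hne))).2.2
    · refine (hgt.total _ _ hne.symm).resolve_right fun h₃ => ?_
      have := hgt.depth_le _ _ h₃
      simp only [depth_toTerm] at this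
      exact hl (this.trans ((hG.terms u).1 hu).1)

include hgt in
theorem exists_greatest (l : List Tm) (hl : l ≠ []) :
    ∃ u ∈ l, ∀ u' ∈ l, u' ≠ u → gt (toTerm u) (toTerm u') := by
  induction l with
  | nil => exact absurd rfl hl
  | cons t l ih =>
    rcases eq_or_ne l [] with rfl | hl'
    · exact ⟨t, by simp, by simp⟩
    · obtain ⟨u, hu, h⟩ := ih hl'
      by_cases htu : t = u
      · subst htu
        exact ⟨t, by simp, by simpa using h⟩
      · rcases hgt.total (toTerm t) (toTerm u) (by simpa using htu) with h₁ | h₁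
        · refine ⟨t, by simp, fun u' hu' hne => ?_⟩
          rcases List.mem_cons.1 hu' with rfl | hu'
          · exact absurd rfl hne
          · rcases eq_or_ne u' u with rfl | hne'
            · exact h₁
            · exact hgt.trans _ _ _ h₁ (h _ hu' hne')
        · refine ⟨u, by simp [hu], fun u' hu' hne => ?_⟩
          rcases List.mem_cons.1 hu' with rfl | hu'
          · exact h₁
          · exact h _ hu' hne

include hG hgt hF in
theorem exists_isRep {t : Tm} (ht : t ∈ E.terms) :
    ∃ u ∈ E.terms, E.isRep (E.cong F) t u = true := by
  have hrefl : (t, t) ∈ E.cong F := (mem_cong hG hF).2 ⟨ht, ht, .refl _⟩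
  obtain ⟨u, hu, h⟩ := exists_greatest hgt (E.terms.filter fun u => memb (t, u) (E.cong F))
    (List.ne_nil_of_mem (List.mem_filter.2 ⟨ht, memb_iff.2 hrefl⟩))
  simp only [List.mem_filter, memb_iff] at hu h
  exact ⟨u, hu.1, isRep_spec.2 ⟨hu.2, fun u' hu' hc hne =>
    (hG.gts _ _).2 ⟨hu.1, hu', h u' ⟨hu', hc⟩ hne⟩⟩⟩

include hG hgt in
theorem isRep_unique {C : List (Tm × Tm)} {t u v : Tm} (hu : u ∈ E.terms) (hv : v ∈ E.terms)
    (h₁ : E.isRep C t u = true) (h₂ : E.isRep C t v = true) : u = v := by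
  rw [isRep_spec] at h₁ h₂
  by_contra hne
  exact hgt.irrefl _ (hgt.trans _ _ _
    ((hG.gts _ _).1 (h₁.2 v hv h₂.1 (Ne.symm hne))).2.2 ((hG.gts _ _).1 (h₂.2 u hu h₁.1 hne)).2.2)

theorem mem_applyEGD {𝓡 : Set Rule} {X : Set Fact} {φ : Fact} : φ ∈ applyEGD gt 𝓡 X ↔
    ∃ ψ ∈ X, key ψ = key φ ∧ IsRep gt 𝓡 X (arg₁ ψ) (arg₁ φ) ∧ IsRep gt 𝓡 X (arg₂ ψ) (arg₂ φ) := by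
  constructor
  · rintro (⟨A, t, t', h, h₁, rfl⟩ | ⟨R, t, t', u, u', h, h₁, h₂, rfl⟩ |
      ⟨t, t', u, u', h, h₁, h₂, rfl⟩)
    · exact ⟨_, h, rfl, h₁, h₁⟩
    · exact ⟨_, h, rfl, h₁, h₂⟩
    · exact ⟨_, h, rfl, h₁, h₂⟩
  · rintro ⟨ψ, hψ, hk, h₁, h₂⟩
    cases ψ <;> cases φ <;> simp [key, code_injective.eq_iff] at hk
    · subst hk; exact .inl ⟨_, _, _, hψ, h₁, rfl⟩
    · subst hk; exact .inr (.inl ⟨_, _, _, _, _, hψ, h₁, h₂, rfl⟩)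
    · exact .inr (.inr ⟨_, _, _, _, hψ, h₁, h₂, rfl⟩)

theorem mem_stepEGD {φ : Atom Tm} : φ ∈ E.stepEGD F ↔ φ ∈ E.univ ∧ ∃ ψ ∈ F, key ψ = key φ ∧
    E.isRep (E.cong F) (arg₁ ψ) (arg₁ φ) = true ∧ E.isRep (E.cong F) (arg₂ ψ) (arg₂ φ) = true := by
  simp only [Env.stepEGD, List.mem_filter, List.any_eq_true, Bool.and_eq_true, eqb_iff, and_assoc]

include hG hgt hF in
theorem applyEGD_facts :
    applyEGD gt (nonExistentialRules T) (facts F) = facts (E.stepEGD F) := by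
  ext x
  rw [mem_applyEGD, mem_facts]
  constructor
  · rintro ⟨_, ⟨ψ, hψ, rfl⟩, hk, h₁, h₂⟩
    have hu := mem_univ.1 (hF ψ hψ)
    simp only [arg₁_map, arg₂_map, key_map] at h₁ h₂ hk
    obtain ⟨u₁, hu₁, e₁, h₁'⟩ := (isRep_iff hG hgt hF hu.2.1).1 h₁
    obtain ⟨u₂, hu₂, e₂, h₂'⟩ := (isRep_iff hG hgt hF hu.2.2).1 h₂
    have hc : toFact (relabel₂ u₁ u₂ ψ) = x := by
      refine atom_ext ?_ ?_ ?_
      · rw [key_map, ← hk]; cases ψ <;> rfl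
      · rw [arg₁_map, ← e₁]; cases ψ <;> rfl
      · rw [arg₂_map, ← e₂]
        cases ψ
        · refine congrArg toTerm (isRep_unique hG hgt hu₁ hu₂ h₁' h₂')
        · rfl
        · rfl
    refine ⟨relabel₂ u₁ u₂ ψ, ?_, hc⟩
    subst hc
    simp only [arg₁_map, arg₂_map, key_map, toTerm_inj] at e₁ e₂ hk
    rw [mem_stepEGD, mem_univ, ← e₁, ← e₂, ← hk]
    exact ⟨⟨hu.1, hu₁, hu₂⟩, ψ, hψ, rfl, h₁', h₂'⟩
  · rintro ⟨φ, hφ, rfl⟩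
    obtain ⟨hu, ψ, hψ, hk, h₁, h₂⟩ := mem_stepEGD.1 hφ
    have hu' := mem_univ.1 (hF ψ hψ)
    have hu := mem_univ.1 hu
    refine ⟨toFact ψ, toFact_mem_facts.2 hψ, by simpa using hk, ?_, ?_⟩
    · simp only [arg₁_map]
      exact (isRep_iff hG hgt hF hu'.2.1).2 ⟨_, hu.2.1, rfl, h₁⟩
    · simp only [arg₂_map]
      exact (isRep_iff hG hgt hF hu'.2.2).2 ⟨_, hu.2.2, rfl, h₂⟩

theorem follows_iff {φ : Atom Tm} : E.follows F φ = true ↔ ∃ r ∈ E.tgds, ∃ z ∈ E.trips,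
    sats r.1 z F = true ∧ ∃ a ∈ r.2, φ = a.map (sel z) := by
  simp only [Env.follows, List.any_eq_true, Bool.and_eq_true, eqb_iff]

theorem mem_stepUniv {φ : Atom Tm} :
    φ ∈ E.stepUniv F ↔ φ ∈ E.univ ∧ (φ ∈ F ∨ E.follows F φ = true) := by
  simp only [Env.stepUniv, List.mem_filter, Bool.or_eq_true, memb_iff]

theorem map_sel_mem_univ {a : Atom Var} {z : Tm × Tm × Tm} (ha : a ∈ E.atoms) (hz : z ∈ E.trips) :
    a.map (sel z) ∈ E.univ :=
  mem_univ.2 ⟨⟨a, ha, by simp⟩, by simpa using sel_mem hz _, by simpa using sel_mem hz _⟩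

theorem tgd_atom_mem {r : List (Atom Var) × List (Atom Var)} (hr : r ∈ E.tgds) {a : Atom Var}
    (ha : a ∈ r.1 ∨ a ∈ r.2) : a ∈ E.tgdAtoms :=
  List.mem_append_left _ (List.mem_flatMap.2 ⟨r, hr, List.mem_append.2 ha⟩)

include hG hF in
/-- The consequences of the TGDs without existential variables. -/
theorem tgd_iff {x : Fact} : (∃ b h σ a, (b, h) ∈ E.tgds ∧ (∀ c ∈ b, c.map σ ∈ facts F) ∧ a ∈ h ∧
    x = a.map σ) ↔ ∃ φ ∈ E.univ, E.follows F φ = true ∧ toFact φ = x := by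
  constructor
  · rintro ⟨b, h, σ, a, hr, hb, ha, rfl⟩
    obtain ⟨z, hz, hs, e⟩ := exists_trip hG hF hb
    refine ⟨a.map (sel z), map_sel_mem_univ (List.mem_append_left _ (tgd_atom_mem hr (.inr ha))) hz,
      follows_iff.2 ⟨_, hr, z, hz, hs, a, ha, rfl⟩, ?_⟩
    rw [toFact_map_sel]
    refine (map_congr fun v hv => ?_).symm
    obtain ⟨c, hc, hv⟩ := hG.head_vars _ hr a ha v hv
    exact e c hc v hv
  · rintro ⟨φ, -, h, rfl⟩
    obtain ⟨r, hr, z, -, hs, a, ha, rfl⟩ := follows_iff.1 h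
    exact ⟨r.1, r.2, _, a, hr, sats_facts hs, ha, toFact_map_sel _ _⟩

include hG hF in
theorem applyUniv_facts : applyUniv (nonExistentialRules T) (facts F) = facts (E.stepUniv F) := by
  ext x
  constructor
  · rintro (⟨r, hr, -, hx⟩ | hx)
    · cases r with
      | tgd b h =>
        obtain ⟨σ, hb, ⟨a, ha, rfl⟩, -⟩ := hx
        obtain ⟨φ, h₁, h₂, h₃⟩ := (tgd_iff hG hF).1
          ⟨b, h, σ, a, (tgd_mem hG).1 hr, hb, ha, rfl⟩
        exact ⟨φ, mem_stepUniv.2 ⟨h₁, .inr h₂⟩, h₃⟩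
      | ex ρ => exact absurd trivial hr.2
      | egd => exact hx.elim
    · obtain ⟨φ, hφ, rfl⟩ := hx
      exact ⟨φ, mem_stepUniv.2 ⟨hF φ hφ, .inl hφ⟩, rfl⟩
  · rintro ⟨φ, hφ, rfl⟩
    by_cases h : toFact φ ∈ facts F
    · exact .inr h
    · obtain ⟨hu, hφ⟩ := mem_stepUniv.1 hφ
      have hφ := hφ.resolve_left (mt toFact_mem_facts.2 h)
      obtain ⟨b, hd, σ, a, hr, hb, ha, e⟩ := (tgd_iff hG hF).2 ⟨φ, hu, hφ, rfl⟩
      exact .inl ⟨_, (tgd_mem hG).2 hr, id, σ, hb, ⟨a, ha, e⟩, fun h' => h (e ▸ h' a ha)⟩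

theorem applyEx_eq (X : Set Fact) : applyEx (nonExistentialRules T) X = X := by
  refine Set.union_eq_right.2 ?_
  rintro x ⟨r, hr, h, -⟩
  exact absurd h hr.2

include hG hgt hF in
/-- One step of the chase, on lists of facts over the terms. -/
theorem chaseStep_facts :
    chaseStep gt (nonExistentialRules T) (facts F) = facts (E.step F) := by
  unfold chaseStep Env.step
  rw [applyEGD_facts hG hgt hF, applyUniv_facts hG hF, applyEx_eq]
  cases h : same (E.stepEGD F) F with
  | false =>
    rw [if_pos (mt same_iff.2 (by simp [h]))]
    rfl
  | true =>
    rw [if_neg (not_not.2 (same_iff.1 h))]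
    split_ifs with h'
    · rfl
    · exact (not_not.1 h').symm

end Chase

/-! ### The chase becomes stationary in time -/

section Stationary

variable {gt : Term → Term → Prop} {T : Set TBoxAxiom} {D : ℕ} {E : Env} (hG : Good gt T D E)
  (hgt : IsTermOrder gt) {F : List (Atom Tm)} (hF : ∀ φ ∈ F, φ ∈ E.univ)

/-- The terms that occur in the facts. -/
def occ (F : List (Atom Tm)) : Finset Tm := (F.map arg₁ ++ F.map arg₂).toFinset

theorem mem_occ {t : Tm} : t ∈ occ F ↔ ∃ φ ∈ F, t = arg₁ φ ∨ t = arg₂ φ := by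
  simp only [occ, List.mem_toFinset, List.mem_append, List.mem_map]
  constructor
  · rintro (⟨φ, h, rfl⟩ | ⟨φ, h, rfl⟩)
    · exact ⟨φ, h, .inl rfl⟩
    · exact ⟨φ, h, .inr rfl⟩
  · rintro ⟨φ, h, rfl | rfl⟩
    · exact .inl ⟨φ, h, rfl⟩
    · exact .inr ⟨φ, h, rfl⟩

theorem step_subset : ∀ φ ∈ E.step F, φ ∈ E.univ := fun _ h => (E.step_sublist F).subset h

include hF in
theorem occ_subset : ∀ t ∈ occ F, t ∈ E.terms := fun t ht => by
  obtain ⟨φ, hφ, rfl | rfl⟩ := mem_occ.1 ht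
  · exact (mem_univ.1 (hF φ hφ)).2.1
  · exact (mem_univ.1 (hF φ hφ)).2.2

include hG hgt hF in
/-- An application of the EGDs that changes the facts reduces the number of terms: if the map
from terms to representatives were injective, then all generating pairs of the congruence would
be trivial. -/
theorem card_occ_stepEGD (h : facts (E.stepEGD F) ≠ facts F) :
    (occ (E.stepEGD F)).card < (occ F).card := by
  have hr : ∀ t : Tm, ∃ u, t ∈ E.terms → u ∈ E.terms ∧ E.isRep (E.cong F) t u = true := fun t => by
    by_cases ht : t ∈ E.terms
    · exact (exists_isRep hG hgt hF ht).imp fun u hu _ => hu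
    · exact ⟨[], fun h => absurd h ht⟩
  choose r hr using hr
  have huniq : ∀ t ∈ E.terms, ∀ u ∈ E.terms, E.isRep (E.cong F) t u = true → u = r t :=
    fun t ht u hu h => isRep_unique hG hgt hu (hr t ht).1 h (hr t ht).2
  have hsub : occ (E.stepEGD F) ⊆ (occ F).image r := fun t ht => by
    obtain ⟨φ, hφ, e⟩ := mem_occ.1 ht
    obtain ⟨hu, ψ, hψ, -, h₁, h₂⟩ := mem_stepEGD.1 hφ
    have hu := mem_univ.1 hu
    have hu' := mem_univ.1 (hF ψ hψ)
    rw [Finset.mem_image]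
    rcases e with rfl | rfl
    · exact ⟨_, mem_occ.2 ⟨ψ, hψ, .inl rfl⟩, (huniq _ hu'.2.1 _ hu.2.1 h₁).symm⟩
    · exact ⟨_, mem_occ.2 ⟨ψ, hψ, .inr rfl⟩, (huniq _ hu'.2.2 _ hu.2.2 h₂).symm⟩
  refine lt_of_le_of_ne ((Finset.card_le_card hsub).trans Finset.card_image_le) fun hcard => h ?_
  have hinj : Set.InjOn r (occ F) := Finset.card_image_iff.1
    (le_antisymm Finset.card_image_le (hcard ▸ Finset.card_le_card hsub))
  have htriv : ∀ x y, Cong (nonExistentialRules T) (facts F) x y → x = y := by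
    intro x y hc
    induction hc with
    | egd b v w σ hrule hb =>
      have hc := Cong.egd b v w σ hrule hb
      obtain ⟨hb', rfl, rfl⟩ := (egd_mem hG).1 hrule
      obtain ⟨z, hz, hs, e⟩ := exists_trip hG hF hb
      have hocc : ∀ v : Var, (∃ a ∈ b, v ∈ a.args) →
          σ v = toTerm (sel z v) ∧ sel z v ∈ occ F := by
        rintro v ⟨a, ha, hv⟩
        refine ⟨e a ha v hv, mem_occ.2 ⟨_, sats_iff.1 hs a ha, ?_⟩⟩
        exact (mem_args.1 hv).imp (fun h => by rw [arg₁_map, h]) fun h => by rw [arg₂_map, h]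
      obtain ⟨e₁, h₁⟩ := hocc 1 (hG.egd_vars b hb').1
      obtain ⟨e₂, h₂⟩ := hocc 2 (hG.egd_vars b hb').2
      rw [e₁, e₂] at hc ⊢
      have ht₁ := sel_mem hz 1
      have ht₂ := sel_mem hz 2
      refine congrArg toTerm (hinj h₁ h₂ ?_)
      refine huniq _ ht₂ _ (hr _ ht₁).1 ?_
      obtain ⟨u, hu, e, h⟩ := (isRep_iff hG hgt hF ht₂ (x := toTerm (r (sel z 1)))).1 (by
        have h := (isRep_iff hG hgt hF ht₁).2 ⟨_, (hr _ ht₁).1, rfl, (hr _ ht₁).2⟩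
        exact ⟨hc.symm.trans h.1, fun u' hu' => h.2 u' (hc.trans hu')⟩)
      rwa [← toTerm_injective e]
    | refl => rfl
    | symm _ ih => exact ih.symm
    | trans _ _ ih₁ ih₂ => exact ih₁.trans ih₂
    | app ρ _ ih => rw [ih]
  have hrep : ∀ t u, E.isRep (E.cong F) t u = true → t = u := fun t u h =>
    toTerm_injective (htriv _ _ ((mem_cong hG hF).1 (isRep_spec.1 h).1).2.2)
  have hid : ∀ t ∈ E.terms, E.isRep (E.cong F) t t = true := fun t ht => by
    have h := (hr t ht).2
    rwa [← hrep _ _ h] at h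
  rw [facts_inj]
  refine fun φ => ⟨fun hφ => ?_, fun hφ => ?_⟩
  · obtain ⟨-, ψ, hψ, hk, h₁, h₂⟩ := mem_stepEGD.1 hφ
    rwa [← atom_ext hk (hrep _ _ h₁) (hrep _ _ h₂)]
  · have hu := mem_univ.1 (hF φ hφ)
    exact mem_stepEGD.2 ⟨hF φ hφ, φ, hφ, rfl, hid _ hu.2.1, hid _ hu.2.2⟩

include hG in
/-- All variables in the head of a TGD occur in its body, so no new terms arise. -/
theorem occ_stepUniv : occ (E.stepUniv F) ⊆ occ F := fun t ht => by
  obtain ⟨φ, hφ, e⟩ := mem_occ.1 ht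
  rcases (mem_stepUniv.1 hφ).2 with h | h
  · exact mem_occ.2 ⟨φ, h, e⟩
  · obtain ⟨r, hr, z, -, hs, a, ha, rfl⟩ := follows_iff.1 h
    have key : ∀ v ∈ a.args, sel z v ∈ occ F := fun v hv => by
      obtain ⟨b, hb, hv⟩ := hG.head_vars r hr a ha v hv
      refine mem_occ.2 ⟨_, sats_iff.1 hs b hb, ?_⟩
      exact (mem_args.1 hv).imp (fun h => by rw [arg₁_map, h]) fun h => by rw [arg₂_map, h]
    rw [arg₁_map, arg₂_map] at e
    rcases e with rfl | rfl
    · exact key _ (mem_args.2 (.inl rfl))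
    · exact key _ (mem_args.2 (.inr rfl))

/-- Terms weigh more than facts, which are to be added. -/
def weight (E : Env) (F : List (Atom Tm)) : ℕ :=
  (occ F).card * (E.univ.length + 1) + (E.univ.length - F.toFinset.card)

theorem card_le_univ (hF : ∀ φ ∈ F, φ ∈ E.univ) : F.toFinset.card ≤ E.univ.length :=
  (Finset.card_le_card fun φ hφ => List.mem_toFinset.2 (hF φ (List.mem_toFinset.1 hφ))).trans
    (List.toFinset_card_le _)

include hG hgt hF in
theorem weight_step (h : facts (E.step F) ≠ facts F) : weight E (E.step F) < weight E F := by
  unfold Env.step at h ⊢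
  cases hs : same (E.stepEGD F) F with
  | false =>
    have h₁ := card_occ_stepEGD hG hgt hF (mt same_iff.2 (by simp [hs]))
    have h₂ : ((occ (E.stepEGD F)).card + 1) * (E.univ.length + 1) ≤
        (occ F).card * (E.univ.length + 1) := Nat.mul_le_mul_right _ h₁
    rw [Nat.add_mul] at h₂
    simp only [cond_false, weight]
    omega
  | true =>
    rw [hs, cond_true] at h
    have h₁ := Nat.mul_le_mul_right (E.univ.length + 1)
      (Finset.card_le_card (occ_stepUniv hG (F := F)))
    have h₂ : F.toFinset.card < (E.stepUniv F).toFinset.card := by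
      refine Finset.card_lt_card (Finset.ssubset_iff_subset_ne.2 ⟨fun φ hφ => ?_, fun e => h ?_⟩)
      · rw [List.mem_toFinset] at hφ ⊢
        exact mem_stepUniv.2 ⟨hF φ hφ, .inl hφ⟩
      · rw [facts_inj]
        intro φ
        rw [← List.mem_toFinset, ← e, List.mem_toFinset]
    have h₃ := card_le_univ (F := E.stepUniv F) fun φ hφ => (mem_stepUniv.1 hφ).1
    simp only [cond_true, weight]
    omega

include hG hgt in
theorem exists_stationary (F : List (Atom Tm)) (hF : ∀ φ ∈ F, φ ∈ E.univ) :
    ∃ i ≤ weight E F, facts (E.step (E.step^[i] F)) = facts (E.step^[i] F) := by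
  generalize hw : weight E F = w
  induction w using Nat.strong_induction_on generalizing F with
  | _ w ih =>
    by_cases h : facts (E.step F) = facts F
    · exact ⟨0, Nat.zero_le _, h⟩
    · have hlt := weight_step hG hgt hF h
      obtain ⟨i, hi, h⟩ := ih _ (hw ▸ hlt) (E.step F) step_subset rfl
      exact ⟨i + 1, by omega, h⟩

include hG in
/-- The simulation runs long enough: `weight E F ≤ L * (L + 1) + L` if `L` is the number of all
facts, which is at least the number of terms, and the clock has length `(2 * L) ^ 2`. -/
theorem weight_le_clock (hF : ∀ φ ∈ F, φ ∈ E.univ) : weight E F ≤ E.clock.length := by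
  have hpos : 0 < E.terms.length := List.length_pos_of_mem hG.nil_mem
  have h₁ : (occ F).card ≤ E.terms.length :=
    (Finset.card_le_card fun t ht => List.mem_toFinset.2 (occ_subset hF t ht)).trans
      (List.toFinset_card_le _)
  have h₂ : E.pairs.length = E.terms.length * E.terms.length := by
    simp [Env.pairs, List.length_flatMap]
  have h₃ : E.univ.length = E.atoms.length * (E.terms.length * E.terms.length) := by
    simp [Env.univ, List.length_flatMap, h₂]
  have h₄ : 0 < E.atoms.length := by simp [Env.atoms]
  have h₅ : E.clock.length =
      (E.univ.length + E.univ.length) * (E.univ.length + E.univ.length) := by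
    simp [Env.clock, List.length_flatMap]; ring
  have h₆ : E.terms.length ≤ E.univ.length := by
    rw [h₃]
    exact (Nat.le_mul_of_pos_left _ hpos).trans (Nat.le_mul_of_pos_left _ h₄)
  rw [h₅, weight]
  generalize E.univ.length = L at *
  have h₇ : (occ F).card * (L + 1) ≤ L * (L + 1) := Nat.mul_le_mul_right _ (h₁.trans h₆)
  have h₈ : L * 1 ≤ L * L := Nat.mul_le_mul_left _ (hpos.trans_le h₆)
  have h₉ : (L + L) * (L + L) = 4 * (L * L) := by ring
  rw [Nat.mul_add L] at h₇
  omega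

end Stationary

/-! ### The simulation of the chase -/

section Simulation

variable {gt : Term → Term → Prop} {T : Set TBoxAxiom} {D : ℕ} {E : Env} (hG : Good gt T D E)
  (hgt : IsTermOrder gt)

theorem termInstance_toTerm (s : Tm) : termInstance (toTerm s) = facts (inst s) := by
  induction s with
  | nil => simp [termInstance, toTerm, Term.star, facts, inst]
  | cons ρ s ih =>
    ext x
    simp only [toTerm, termInstance, ih, inst, mem_facts, Set.mem_union, Set.mem_insert_iff,
      Set.mem_singleton_iff, List.mem_cons, exists_eq_or_imp, or_assoc]
    simp only [toFact, Atom.map, toTerm, eq_comm (b := x)]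

include hG in
theorem inst_subset {s : Tm} (hs : s ∈ E.terms) : ∀ φ ∈ inst s, φ ∈ E.univ := by
  induction s with
  | nil => simp [inst]
  | cons ρ s ih =>
    have hs' := hG.tail_mem hs
    have hρ : ρ ∈ E.exs := ((hG.terms _).1 hs).2 ρ (by simp)
    have key : ∀ a ∈ exAtoms ρ, a ∈ E.atoms := fun a ha => List.mem_append_left _
      (List.mem_append_right _ (List.mem_flatMap.2 ⟨ρ, hρ, ha⟩))
    simp only [inst, List.mem_cons, forall_eq_or_imp]
    exact ⟨mem_univ.2 ⟨⟨_, key (.concept ρ.A 0) (by simp [exAtoms]), rfl⟩, hs', hs'⟩,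
      mem_univ.2 ⟨⟨_, key (.role ρ.R 0 1) (by simp [exAtoms]), rfl⟩, hs', hs⟩,
      mem_univ.2 ⟨⟨_, key (.concept ρ.B 1) (by simp [exAtoms]), rfl⟩, hs, hs⟩, ih hs'⟩

/-- The state after `i` steps of the chase with the instance given by `s`. -/
structure Simulates (gt : Term → Term → Prop) (T : Set TBoxAxiom) (E : Env) (s : Tm) (i : ℕ)
    (x : Env.State) : Prop where
  current : chaseSeq gt (nonExistentialRules T) (termInstance (toTerm s)) i = facts x.1
  current_subset : ∀ φ ∈ x.1, φ ∈ E.univ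
  all : facts x.2.1 =
    ⋃ j ∈ Set.Iic i, chaseSeq gt (nonExistentialRules T) (termInstance (toTerm s)) j
  all_subset : ∀ φ ∈ x.2.1, φ ∈ E.univ
  term_mem : ∀ w ∈ x.2.2, w ∈ E.terms
  term : ∀ v, ReplacedAt gt (nonExistentialRules T) (termInstance (toTerm s)) (toTerm s) i v ↔
    ∃ w ∈ x.2.2, toTerm w = v

include hG in
theorem simulates_init {s : Tm} (hs : s ∈ E.terms) : Simulates gt T E s 0 (E.init s) := by
  have h : facts (E.univ.filter fun φ => memb φ (inst s)) = termInstance (toTerm s) := by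
    rw [termInstance_toTerm, facts_inj]
    intro φ
    rw [List.mem_filter, memb_iff]
    exact ⟨fun h => h.2, fun h => ⟨inst_subset hG hs φ h, h⟩⟩
  refine ⟨h.symm, fun φ h => List.mem_of_mem_filter h, ?_, fun φ h => List.mem_of_mem_filter h,
    fun φ h => List.mem_of_mem_filter h, fun v => ?_⟩
  · simp [Env.init, h, chaseSeq]
  · simp only [ReplacedAt, Env.init, List.mem_filter, eqb_iff]
    exact ⟨fun h => ⟨s, ⟨hs, rfl⟩, h.symm⟩, fun ⟨w, hw, h⟩ => by rw [← h, hw.2]⟩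

include hG hgt in
theorem simulates_step {s : Tm} {i : ℕ} {x : Env.State} (h : Simulates gt T E s i x) :
    Simulates gt T E s (i + 1) (E.stepState x) := by
  have hc := applyEGD_facts hG hgt h.current_subset
  have hstep : chaseSeq gt (nonExistentialRules T) (termInstance (toTerm s)) (i + 1) =
      facts (E.step x.1) := by
    rw [chaseSeq, h.current, chaseStep_facts hG hgt h.current_subset]
  refine ⟨hstep, step_subset, ?_, fun φ h => List.mem_of_mem_filter h,
    fun φ h => List.mem_of_mem_filter h, fun v => ?_⟩
  · have hU : (⋃ j ∈ Set.Iic (i + 1),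
        chaseSeq gt (nonExistentialRules T) (termInstance (toTerm s)) j) =
        facts x.2.1 ∪ facts (E.step x.1) := by
      rw [h.all, ← hstep]
      ext y
      simp only [Set.mem_iUnion, Set.mem_Iic, Set.mem_union, exists_prop, Nat.le_succ_iff,
        Nat.succ_eq_add_one, or_and_right, exists_or, exists_eq_left]
    rw [hU]
    ext y
    simp only [Env.stepState, mem_facts, Set.mem_union, List.mem_filter, Bool.or_eq_true, memb_iff]
    constructor
    · rintro ⟨φ, ⟨-, h | h⟩, e⟩
      · exact .inl ⟨φ, h, e⟩
      · exact .inr ⟨φ, h, e⟩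
    · rintro (⟨φ, hφ, e⟩ | ⟨φ, hφ, e⟩)
      · exact ⟨φ, ⟨h.all_subset φ hφ, .inl hφ⟩, e⟩
      · exact ⟨φ, ⟨step_subset φ hφ, .inr hφ⟩, e⟩
  · simp only [ReplacedAt, h.current, h.term, hc, Env.stepState, Env.stepTerm, List.mem_filter]
    cases hs : same (E.stepEGD x.1) x.1 with
    | true =>
      have he := same_iff.1 hs
      simp only [he, ne_eq, not_true, false_and, false_or, true_and, cond_true, memb_iff]
      constructor
      · rintro ⟨_, ⟨w, hw, rfl⟩, rfl⟩
        exact ⟨w, ⟨h.term_mem w hw, hw⟩, rfl⟩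
      · rintro ⟨w, ⟨-, hw⟩, rfl⟩
        exact ⟨_, ⟨w, hw, rfl⟩, rfl⟩
    | false =>
      have he : facts (E.stepEGD x.1) ≠ facts x.1 := mt same_iff.2 (by simp [hs])
      simp only [he, ne_eq, not_false_eq_true, false_and, or_false, true_and, cond_false,
        List.any_eq_true]
      constructor
      · rintro ⟨_, ⟨w, hw, rfl⟩, hr⟩
        obtain ⟨u, hu, e, hr⟩ := (isRep_iff hG hgt h.current_subset (h.term_mem w hw)).1 hr
        exact ⟨u, ⟨hu, w, hw, hr⟩, e⟩
      · rintro ⟨u, ⟨hu, w, hw, hr⟩, rfl⟩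
        exact ⟨_, ⟨w, hw, rfl⟩,
          (isRep_iff hG hgt h.current_subset (h.term_mem w hw)).2 ⟨u, hu, rfl, hr⟩⟩

include hG hgt in
theorem simulates_iterate {s : Tm} (hs : s ∈ E.terms) (i : ℕ) :
    Simulates gt T E s i (E.stepState^[i] (E.init s)) := by
  induction i with
  | zero => exact simulates_init hG hs
  | succ i ih =>
    rw [Function.iterate_succ_apply']
    exact simulates_step hG hgt ih

theorem iterate_fst (x : Env.State) (i : ℕ) : (E.stepState^[i] x).1 = E.step^[i] x.1 := by
  induction i generalizing x with
  | zero => rfl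
  | succ i ih => rw [Function.iterate_succ_apply, Function.iterate_succ_apply, ih]; rfl

theorem run_eq (s : Tm) : E.run s = E.stepState^[E.clock.length] (E.init s) :=
  List.foldl_const _ _ _

include hG hgt in
/-- From some step of the simulation on, neither the facts nor the term change any more. -/
theorem stationary {s : Tm} (hs : s ∈ E.terms) : ∃ N ≤ E.clock.length, ∀ j, N ≤ j →
    chaseSeq gt (nonExistentialRules T) (termInstance (toTerm s)) j =
        chaseSeq gt (nonExistentialRules T) (termInstance (toTerm s)) N ∧
      ∀ v, ReplacedAt gt (nonExistentialRules T) (termInstance (toTerm s)) (toTerm s) j v ↔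
        ReplacedAt gt (nonExistentialRules T) (termInstance (toTerm s)) (toTerm s) N v := by
  have h0 := (simulates_init (gt := gt) hG hs).current_subset
  obtain ⟨N, hN, h⟩ := exists_stationary hG hgt _ h0
  refine ⟨N, hN.trans (weight_le_clock hG h0), ?_⟩
  set I := termInstance (toTerm s)
  set 𝓡 := nonExistentialRules T
  have hsim := simulates_iterate hG hgt hs N
  have hcur : chaseSeq gt 𝓡 I N = facts (E.step^[N] (E.init s).1) := by
    rw [hsim.current, iterate_fst]
  have hfix : chaseStep gt 𝓡 (chaseSeq gt 𝓡 I N) = chaseSeq gt 𝓡 I N := by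
    rw [hcur, chaseStep_facts hG hgt, h]
    rw [← iterate_fst]
    exact hsim.current_subset
  have hegd : applyEGD gt 𝓡 (chaseSeq gt 𝓡 I N) = chaseSeq gt 𝓡 I N := by
    by_contra hne
    rw [chaseStep, if_pos hne] at hfix
    exact hne hfix
  intro j hj
  obtain ⟨k, rfl⟩ := Nat.exists_eq_add_of_le hj
  clear hj
  induction k with
  | zero => exact ⟨rfl, fun _ => Iff.rfl⟩
  | succ k ih =>
    obtain ⟨ih₁, ih₂⟩ := ih
    refine ⟨?_, fun v => ?_⟩
    · rw [← Nat.add_assoc, chaseSeq, ih₁, hfix]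
    · rw [← Nat.add_assoc, ReplacedAt, ih₁, hegd]
      simp [ih₂]

include hG hgt in
/-- The final state of the simulation tells whether a term is restricted. -/
theorem restr_iff {ρ : ExAxiom} {s : Tm} (hs : s ∈ E.terms) :
    E.restr ρ s = true ↔ Restricted gt T ρ (toTerm s) := by
  obtain ⟨N, hN, hst⟩ := stationary hG hgt hs
  set I := termInstance (toTerm s) with hI
  set 𝓡 := nonExistentialRules T with hR
  have hsim := simulates_iterate hG hgt hs E.clock.length
  rw [← run_eq] at hsim
  have hfinal : ∀ v, FinalTerm gt 𝓡 I (toTerm s) v ↔ ∃ w ∈ (E.run s).2.2, toTerm w = v := by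
    intro v
    rw [← hsim.term, (hst _ hN).2]
    constructor
    · rintro ⟨i, hi⟩
      exact ((hst _ (Nat.le_add_left N i)).2 v).1 (hi _ (Nat.le_add_right _ _))
    · exact fun h => ⟨N, fun j hj => ((hst j hj).2 v).2 h⟩
  have hchase : chase gt 𝓡 I = facts (E.run s).2.1 := by
    rw [hsim.all, chase]
    refine Set.Subset.antisymm (Set.iUnion_subset fun j => ?_)
      (Set.iUnion₂_subset fun j _ => Set.subset_iUnion _ j)
    rcases le_total j E.clock.length with h | h
    · exact Set.subset_biUnion_of_mem (u := fun j => chaseSeq gt 𝓡 I j) h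
    · rw [(hst j (hN.trans h)).1]
      exact Set.subset_biUnion_of_mem (u := fun j => chaseSeq gt 𝓡 I j) hN
  simp only [Env.restr, List.any_eq_true, Bool.and_eq_true, memb_iff]
  unfold Restricted
  rw [← hI, ← hR]
  simp only [hfinal, hchase]
  constructor
  · rintro ⟨v, hv, u, -, h₁, h₂⟩
    exact ⟨_, toTerm u, ⟨v, hv, rfl⟩, ⟨_, h₁, rfl⟩, ⟨_, h₂, rfl⟩⟩
  · rintro ⟨_, _, ⟨v, hv, rfl⟩, ⟨φ, h₁, e₁⟩, ⟨ψ, h₂, e₂⟩⟩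
    cases φ <;> simp only [toFact, Atom.map, Atom.role.injEq, reduceCtorEq] at e₁
    cases ψ <;> simp only [toFact, Atom.map, Atom.concept.injEq, reduceCtorEq] at e₂
    obtain ⟨rfl, hv', rfl⟩ := e₁
    obtain ⟨rfl, hu'⟩ := e₂
    obtain rfl := toTerm_injective hv'
    obtain rfl := toTerm_injective hu'
    exact ⟨_, hv, _, (mem_univ.1 (hsim.all_subset _ h₁)).2.2, h₁, h₂⟩

end Simulation

/-! ### Replacement, length and cyclic terms -/

theorem toTerm_repl (u t s : Tm) :
    toTerm (repl u t s) = Term.replace (toTerm u) (toTerm t) (toTerm s) := by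
  induction s with
  | nil =>
    by_cases e : [] = u
    · subst e; simp [repl, eqb_eq_decide, Term.replace, toTerm, Term.star]
    · have e' : toTerm [] ≠ toTerm u := mt toTerm_inj.1 e
      simp only [toTerm, Term.star] at e'
      simp [repl, eqb_eq_decide, Term.replace, toTerm, Term.star, e, e']
  | cons ρ s ih =>
    by_cases e : ρ :: s = u
    · subst e; simp [repl, eqb_eq_decide, Term.replace, toTerm]
    · have e' : toTerm (ρ :: s) ≠ toTerm u := mt toTerm_inj.1 e
      simp only [toTerm] at e'
      simp [repl, eqb_eq_decide, Term.replace, toTerm, e, e', ih]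

theorem length_repl_le {u t : Tm} (h : t.length ≤ u.length) (s : Tm) :
    (repl u t s).length ≤ s.length := by
  induction s with
  | nil =>
    unfold repl
    cases e : eqb [] u with
    | false => simp
    | true => rw [← eqb_iff.1 e] at h; simpa using h
  | cons ρ s ih =>
    unfold repl
    cases e : eqb (ρ :: s) u with
    | false => simpa using ih
    | true => rw [← eqb_iff.1 e] at h; simpa using h

theorem mem_repl {u t s : Tm} {ρ : ExAxiom} (h : ρ ∈ repl u t s) : ρ ∈ t ∨ ρ ∈ s := by
  induction s with
  | nil =>
    unfold repl at h
    cases e : eqb [] u <;> simp_all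
  | cons ρ' s ih =>
    unfold repl at h
    cases e : eqb (ρ' :: s) u with
    | false =>
      simp only [e, cond_false, List.mem_cons] at h
      rcases h with rfl | h
      · simp
      · exact (ih h).imp_right fun h => by simp [h]
    | true => exact .inl (by simpa [e] using h)

theorem lenLe_iff {t u : Tm} : lenLe t u = true ↔ t.length ≤ u.length := by
  have h : ∀ (t : Tm) (c : List Bool), t.foldl (fun c _ => c.tail) c = c.drop t.length := by
    intro t
    induction t with
    | nil => simp
    | cons ρ t ih => intro c; rw [List.foldl_cons, ih, List.drop_tail]; rfl
  rw [lenLe, h, Bool.not_eq_true', ← Bool.not_eq_true, List.isEmpty_iff, List.drop_eq_nil_iff]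
  simp

theorem subterm_toTerm {x : Term} {t : Tm} (h : Term.Subterm x (toTerm t)) :
    ∃ s, s <:+ t ∧ toTerm s = x := by
  induction t with
  | nil => cases h; exact ⟨[], List.suffix_rfl, rfl⟩
  | cons ρ t ih =>
    cases h with
    | refl => exact ⟨_, List.suffix_rfl, rfl⟩
    | app _ _ h =>
      obtain ⟨s, hs, e⟩ := ih h
      exact ⟨s, hs.trans (List.suffix_cons _ _), e⟩

theorem subterm_depth_le {x y : Term} (h : Term.Subterm x y) : x.depth ≤ y.depth := by
  induction h with
  | refl => exact le_rfl
  | app ρ t _ ih => exact ih.trans (Nat.le_succ _)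

/-- The subterms of a term that start with `ρ` form a chain, so that being cyclic is a matter of
the number of occurrences of `ρ`. -/
theorem cyclic_toTerm {n : ℕ} {t : Tm} : (toTerm t).Cyclic n ↔ ∃ ρ, n < t.count ρ := by
  constructor
  · rintro ⟨ρ, s, h, hs⟩
    refine ⟨ρ, ?_⟩
    induction n generalizing t with
    | zero =>
      obtain ⟨v, hv, e⟩ := subterm_toTerm h
      cases v with
      | nil => simp [toTerm, Term.star] at e
      | cons ρ' v =>
        simp only [toTerm, Term.app.injEq] at e
        exact List.count_pos_iff.2 (hv.subset (by simp [e.1]))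
    | succ n ih =>
      obtain ⟨v, hv, e⟩ := subterm_toTerm h
      cases v with
      | nil => simp [toTerm, Term.star] at e
      | cons ρ' v =>
        simp only [toTerm, Term.app.injEq] at e
        obtain ⟨rfl, e⟩ := e
        obtain ⟨h₁, h₂⟩ := hs n (Nat.lt_succ_self n)
        have h₃ : Term.Subterm (.app ρ' (s n)) (toTerm v) := by
          rw [e]
          generalize hy : Term.app ρ' (s (n + 1)) = y at h₁ h₂
          cases h₁ with
          | refl => exact absurd rfl h₂
          | app _ _ h => exact (Term.app.inj hy).2 ▸ h
        have h₄ := ih h₃ fun i hi => hs i (by omega)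
        have h₅ := hv.sublist.count_le ρ'
        rw [List.count_cons_self] at h₅
        omega
  · rintro ⟨ρ, h⟩
    refine ⟨ρ, ?_⟩
    induction t generalizing n with
    | nil => simp at h
    | cons ρ' t ih =>
      by_cases e : ρ' = ρ
      · subst e
        rw [List.count_cons_self] at h
        cases n with
        | zero => exact ⟨fun _ => toTerm t, .refl, by simp⟩
        | succ n =>
          obtain ⟨s, h₁, h₂⟩ := ih (n := n) (by omega)
          refine ⟨Function.update s (n + 1) (toTerm t), ?_, fun i hi => ?_⟩
          · rw [Function.update_self]; exact .refl
          · rw [Function.update_of_ne (by omega)]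
            rcases Nat.lt_succ_iff_lt_or_eq.1 hi with hi | rfl
            · rw [Function.update_of_ne (by omega)]
              exact h₂ i hi
            · rw [Function.update_self]
              refine ⟨.app _ _ h₁, fun e => ?_⟩
              have := subterm_depth_le h₁
              rw [e] at this
              simp [Term.depth] at this
      · rw [List.count_cons_of_ne e] at h
        obtain ⟨s, h₁, h₂⟩ := ih h
        exact ⟨s, .app _ _ h₁, h₂⟩

theorem cyc_iff {n : ℕ} {t : Tm} : cyc n t = true ↔ (toTerm t).Cyclic n := by
  have h : ∀ ρ, t.filter (fun ρ' => eqb ρ ρ') = t.filter (· == ρ) := fun ρ =>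
    List.filter_congr fun ρ' _ => by
      rw [Bool.eq_iff_iff, eqb_iff, beq_iff_eq]; exact eq_comm
  rw [cyclic_toTerm]
  simp only [cyc, List.any_eq_true, h, Bool.not_eq_true', ← Bool.not_eq_true, List.isEmpty_iff,
    List.drop_eq_nil_iff, ← List.count_eq_length_filter, not_le]
  exact ⟨fun ⟨ρ, _, h⟩ => ⟨ρ, h⟩, fun ⟨ρ, h⟩ => ⟨ρ, List.count_pos_iff.1 (by omega), h⟩⟩

theorem length_le_of_not_cyclic {n : ℕ} {t : Tm} {l : List ExAxiom} (hl : ∀ ρ ∈ t, ρ ∈ l)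
    (h : ¬ (toTerm t).Cyclic n) : t.length ≤ n * l.length := by
  rw [cyclic_toTerm] at h
  push Not at h
  calc t.length = ∑ ρ ∈ t.toFinset, t.count ρ := (List.sum_toFinset_count_eq_length t).symm
    _ ≤ t.toFinset.card * n := Finset.sum_le_card_nsmul _ _ _ fun ρ _ => h ρ
    _ ≤ l.length * n := Nat.mul_le_mul_right _ ((Finset.card_le_card fun ρ hρ =>
        List.mem_toFinset.2 (hl ρ (List.mem_toFinset.1 hρ))).trans (List.toFinset_card_le _))
    _ = n * l.length := Nat.mul_comm _ _

/-! ### The overchase -/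

section Over

variable {gt : Term → Term → Prop} {T : Set TBoxAxiom} {D : ℕ} {E : Env} (hG : Good gt T D E)
  (hgt : IsTermOrder gt)

theorem overStep_iff {S : List (Atom Tm)} {φ : Atom Tm} : E.overStep S φ = true ↔
    (∃ a ∈ E.tgdAtoms, φ = a.map fun _ => []) ∨ E.follows S φ = true ∨
    (∃ ρ ∈ E.exs, ∃ t ∈ E.terms, .concept ρ.A t ∈ S ∧ E.restr ρ t = false ∧
      (φ = .role ρ.R t (ρ :: t) ∨ φ = .concept ρ.B (ρ :: t))) ∨
    (∃ b ∈ E.egds, ∃ z ∈ E.trips, sats b z S = true ∧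
      (φ = .eq z.2.1 z.2.2 ∨ φ = .eq z.2.2 z.2.1)) ∨
    ∃ a ∈ S, ∃ e ∈ S, (key a).1 ≠ 2 ∧ (key e).1 = 2 ∧ (arg₁ e).length ≤ (arg₂ e).length ∧
      (arg₂ e = arg₁ a ∨ arg₂ e = arg₂ a) ∧ φ = a.map (repl (arg₂ e) (arg₁ e)) := by
  simp only [Env.overStep, Bool.or_eq_true, List.any_eq_true, Bool.and_eq_true, eqb_iff, memb_iff,
    Bool.not_eq_true', ← Bool.not_eq_true, lenLe_iff, or_assoc, and_assoc, ne_eq]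

include hG in
theorem mem_tgdAtoms {a : Atom Var} :
    a ∈ E.tgdAtoms ↔ ∃ r ∈ rulesOf T, r.IsTGD ∧ a ∈ r.atoms := by
  simp only [Env.tgdAtoms, List.mem_append, List.mem_flatMap]
  constructor
  · rintro (⟨r, hr, ha⟩ | ⟨ρ, hρ, ha⟩)
    · exact ⟨.tgd r.1 r.2, (hG.tgd _ _).2 hr, trivial, List.mem_append.2 ha⟩
    · exact ⟨.ex ρ, (hG.ex _).2 hρ, trivial, ha⟩
  · rintro ⟨r, hr, ht, ha⟩
    cases r with
    | tgd b h => exact .inl ⟨_, (hG.tgd _ _).1 hr, List.mem_append.1 ha⟩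
    | ex ρ => exact .inr ⟨_, (hG.ex _).1 hr, ha⟩
    | egd => exact ht.elim

theorem eq_of_key {τ : Type} {a : Atom τ} (h : (key a).1 = 2) : a = .eq (arg₁ a) (arg₂ a) := by
  cases a <;> simp_all [key, arg₁, arg₂]

theorem eqFree_iff {τ : Type} {a : Atom τ} : a.EqFree ↔ (key a).1 ≠ 2 := by
  cases a <;> simp [key, Atom.EqFree]

include hG hgt in
theorem overchase_of_mem {φ : Atom Tm} (h : φ ∈ E.overList) : Overchase gt T (toFact φ) := by
  refine sat_sound (P := fun φ => Overchase gt T (toFact φ)) (fun S φ hS _ h => ?_) φ h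
  have hF : ∀ x ∈ facts S, Overchase gt T x := by
    rintro _ ⟨ψ, hψ, rfl⟩
    exact hS ψ hψ
  rcases overStep_iff.1 h with ⟨a, ha, rfl⟩ | h | ⟨ρ, hρ, t, ht, hA, hr, h⟩ |
    ⟨b, hb, z, -, hs, h⟩ | ⟨a, ha, e, he, hk, hk', hl, hm, rfl⟩
  · obtain ⟨r, hr, ht, ha⟩ := (mem_tgdAtoms hG).1 ha
    rw [toFact, map_map]
    exact .critical r a hr ht ha
  · obtain ⟨r, hr, z, -, hs, a, ha, rfl⟩ := follows_iff.1 h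
    rw [toFact_map_sel]
    exact .univ r.1 r.2 _ a ((hG.tgd _ _).2 hr) (fun b hb => hF _ (sats_facts hs b hb)) ha
  · have hr' : ¬ Restricted gt T ρ (toTerm t) := by
      rw [← restr_iff hG hgt ht, hr]
      simp
    rcases h with rfl | rfl
    · exact .exRole ρ (toTerm t) ((hG.ex ρ).2 hρ) (hS _ hA) hr'
    · exact .exConcept ρ (toTerm t) ((hG.ex ρ).2 hρ) (hS _ hA) hr'
  · have hr := (hG.egd b 1 2).2 ⟨hb, rfl, rfl⟩
    have hb' := fun b hb => hF _ (sats_facts hs b hb)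
    rcases h with rfl | rfl
    · have := Overchase.egd _ _ _ _ hr hb'
      rwa [sel_one, sel_two] at this
    · have := Overchase.egdSymm _ _ _ _ hr hb'
      rwa [sel_one, sel_two] at this
  · have h₁ := hS _ he
    rw [eq_of_key hk'] at h₁
    have := Overchase.eqRule _ _ _ (eqFree_iff.2 (by rwa [key_map])) h₁ (hS _ ha)
      (by simpa using hl) (mem_args.2 (by simpa using hm))
    rw [map_map] at this
    rw [toFact, map_map]
    simpa only [toTerm_repl] using this

include hG hgt in
/-- If no `n`-cyclic term has been derived, then all derived terms have depth at most
`n * E.exs.length`, so that another application of a rule still finds its terms among those of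
the environment. -/
theorem overchase_complete {n : ℕ} (hD : n * E.exs.length + 1 ≤ D) (hacc : E.accept n = true)
    {x : Fact} (h : Overchase gt T x) : x ∈ facts E.overList := by
  have hsub : ∀ φ ∈ E.overList, φ ∈ E.univ := sat_subset
  have hlen : ∀ φ ∈ E.overList, ∀ t, t = arg₁ φ ∨ t = arg₂ φ → t.length + 1 ≤ D := by
    intro φ hφ t ht
    have h₁ := List.all_eq_true.1 hacc φ hφ
    simp only [Bool.and_eq_true, Bool.not_eq_true', ← Bool.not_eq_true, cyc_iff] at h₁
    have hu := mem_univ.1 (hsub φ hφ)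
    have hmem : ∀ ρ ∈ t, ρ ∈ E.exs := by
      rcases ht with rfl | rfl
      · exact ((hG.terms _).1 hu.2.1).2
      · exact ((hG.terms _).1 hu.2.2).2
    have hc : ¬ (toTerm t).Cyclic n := by
      rcases ht with rfl | rfl
      · exact h₁.1
      · exact h₁.2
    have := length_le_of_not_cyclic hmem hc
    omega
  have hcl : ∀ φ ∈ E.univ, E.overStep E.overList φ = true → toFact φ ∈ facts E.overList :=
    fun φ hφ h => toFact_mem_facts.2 (sat_closed hφ h)
  have hex : ∀ ρ t, Rule.ex ρ ∈ rulesOf T → .concept ρ.A t ∈ facts E.overList →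
      ¬ Restricted gt T ρ t → .role ρ.R t (.app ρ t) ∈ facts E.overList ∧
        .concept ρ.B (.app ρ t) ∈ facts E.overList := by
    rintro ρ _ hr ⟨φ, hφ, e⟩ hR
    cases φ with
    | role => simp [toFact, Atom.map] at e
    | eq => simp [toFact, Atom.map] at e
    | concept A t =>
      simp only [toFact, Atom.map, Atom.concept.injEq] at e
      obtain ⟨rfl, rfl⟩ := e
      have ht : t ∈ E.terms := (mem_univ.1 (hsub _ hφ)).2.1
      have hl := hlen _ hφ t (.inl rfl)
      have hρ := (hG.ex ρ).1 hr
      have ht' : ρ :: t ∈ E.terms := (hG.terms _).2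
        ⟨hl, by simpa [hρ] using ((hG.terms _).1 ht).2⟩
      have hR' : E.restr ρ t = false := by
        rw [← Bool.not_eq_true, restr_iff hG hgt ht]
        exact hR
      have key : ∀ a ∈ exAtoms ρ, a ∈ E.atoms := fun a ha => List.mem_append_left _
        (List.mem_append_right _ (List.mem_flatMap.2 ⟨ρ, hρ, ha⟩))
      constructor
      · exact hcl (.role ρ.R t (ρ :: t))
          (mem_univ.2 ⟨⟨_, key (.role ρ.R 0 1) (by simp [exAtoms]), rfl⟩, ht, ht'⟩)
          (overStep_iff.2 (.inr (.inr (.inl ⟨ρ, hρ, t, ht, hφ, hR', .inl rfl⟩))))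
      · exact hcl (.concept ρ.B (ρ :: t))
          (mem_univ.2 ⟨⟨_, key (.concept ρ.B 1) (by simp [exAtoms]), rfl⟩, ht', ht'⟩)
          (overStep_iff.2 (.inr (.inr (.inl ⟨ρ, hρ, t, ht, hφ, hR', .inr rfl⟩))))
  have hegd : ∀ b v w σ, Rule.egd b v w ∈ rulesOf T → (∀ a ∈ b, a.map σ ∈ facts E.overList) →
      .eq (σ v) (σ w) ∈ facts E.overList ∧ .eq (σ w) (σ v) ∈ facts E.overList := by
    intro b v w σ hr hb
    obtain ⟨hb', rfl, rfl⟩ := (hG.egd _ _ _).1 hr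
    obtain ⟨z, hz, hs, e⟩ := exists_trip hG hsub hb
    obtain ⟨⟨a, ha, hv⟩, a', ha', hw⟩ := hG.egd_vars b hb'
    have hz' := mem_trips.1 hz
    have hk : Atom.eq 0 1 ∈ E.atoms := List.mem_append_right _
      (List.mem_append_right _ (List.mem_singleton.2 rfl))
    rw [e a ha _ hv, e a' ha' _ hw, sel_one, sel_two]
    constructor
    · exact hcl (.eq z.2.1 z.2.2) (mem_univ.2 ⟨⟨_, hk, rfl⟩, hz'.2⟩)
        (overStep_iff.2 (.inr (.inr (.inr (.inl ⟨b, hb', z, hz, hs, .inl rfl⟩)))))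
    · exact hcl (.eq z.2.2 z.2.1) (mem_univ.2 ⟨⟨_, hk, rfl⟩, hz'.2.symm⟩)
        (overStep_iff.2 (.inr (.inr (.inr (.inl ⟨b, hb', z, hz, hs, .inr rfl⟩)))))
  induction h with
  | critical r a hr ht ha =>
    have ha' := (mem_tgdAtoms hG).2 ⟨r, hr, ht, ha⟩
    have := hcl (a.map fun _ => []) (mem_univ.2 ⟨⟨a, List.mem_append_left _ ha', by simp⟩,
      by simpa using hG.nil_mem, by simpa using hG.nil_mem⟩) (overStep_iff.2 (.inl ⟨a, ha', rfl⟩))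
    rwa [toFact, map_map] at this
  | univ b h σ a hr _ ha ih =>
    obtain ⟨φ, hu, hf, e⟩ := (tgd_iff hG hsub).1 ⟨b, h, σ, a, (hG.tgd _ _).1 hr, ih, ha, rfl⟩
    exact e ▸ hcl φ hu (overStep_iff.2 (.inr (.inl hf)))
  | exRole ρ t hr _ hR ih => exact (hex ρ t hr ih hR).1
  | exConcept ρ t hr _ hR ih => exact (hex ρ t hr ih hR).2
  | egd b v w σ hr _ ih => exact (hegd b v w σ hr ih).1
  | egdSymm b v w σ hr _ ih => exact (hegd b v w σ hr ih).2
  | eqRule t u a hf _ _ hd hm ih₁ ih₂ =>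
    obtain ⟨e, he, h₁⟩ := ih₁
    obtain ⟨φ, hφ, rfl⟩ := ih₂
    have hk : (key e).1 = 2 := by rw [← key_map toTerm, show e.map toTerm = _ from h₁]; rfl
    rw [eq_of_key hk] at he h₁
    simp only [toFact, Atom.map, Atom.eq.injEq] at h₁
    obtain ⟨rfl, rfl⟩ := h₁
    simp only [depth_toTerm] at hd
    simp only [mem_args, arg₁_map, arg₂_map, toTerm_inj] at hm
    rw [eqFree_iff, key_map] at hf
    have hue := mem_univ.1 (hsub _ he)
    have huφ := mem_univ.1 (hsub _ hφ)
    have hr : ∀ s ∈ E.terms, repl (arg₂ e) (arg₁ e) s ∈ E.terms := fun s hs => by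
      rw [hG.terms] at hs ⊢
      exact ⟨(length_repl_le hd s).trans hs.1,
        fun ρ hρ => (mem_repl hρ).elim (((hG.terms _).1 hue.2.1).2 ρ) (hs.2 ρ)⟩
    have := hcl (φ.map (repl (arg₂ e) (arg₁ e)))
      (mem_univ.2 ⟨by simpa using huφ.1, by simpa using hr _ huφ.2.1, by simpa using hr _ huφ.2.2⟩)
      (overStep_iff.2 (.inr (.inr (.inr (.inr ⟨φ, hφ, _, he, hf, rfl, hd, hm, rfl⟩)))))
    rw [toFact, map_map] at this ⊢
    simpa only [toTerm_repl] using this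

include hG hgt in
/-- Unless an `n`-cyclic term is derived inside the given terms, no derivation leaves them. -/
theorem accept_iff {n : ℕ} (hD : n * E.exs.length + 1 ≤ D) :
    E.accept n = true ↔ RCA gt n T := by
  constructor
  · intro hacc x hx t ht
    obtain ⟨φ, hφ, rfl⟩ := overchase_complete hG hgt hD hacc hx
    have h₁ := List.all_eq_true.1 hacc φ hφ
    simp only [Bool.and_eq_true, Bool.not_eq_true', ← Bool.not_eq_true, cyc_iff] at h₁
    simp only [mem_args, arg₁_map, arg₂_map] at ht
    rcases ht with rfl | rfl
    · exact h₁.1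
    · exact h₁.2
  · intro h
    refine List.all_eq_true.2 fun φ hφ => ?_
    simp only [Bool.and_eq_true, Bool.not_eq_true', ← Bool.not_eq_true, cyc_iff]
    have := h _ (overchase_of_mem hG hgt hφ)
    simp only [mem_args, arg₁_map, arg₂_map] at this
    exact ⟨this _ (.inl rfl), this _ (.inr rfl)⟩

end Over

/-! ### Reading a TBox -/

theorem codes_injective : Function.Injective TBoxAxiom.codes := fun α β h => by
  have hl : ∀ l l' : List ConceptName, l.map ConceptName.code = l'.map ConceptName.code ↔ l = l' :=
    fun _ _ => (List.map_injective_iff.2 code_injective).eq_iff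
  cases α <;> cases β <;> simp [TBoxAxiom.codes, code_injective.eq_iff, hl] at h
  case ex.ex ρ ρ' => cases ρ; cases ρ'; simp_all
  all_goals simp [h]

/-- Axioms are written as lists of numbers. -/
instance : Enc TBoxAxiom := ⟨fun α => enc α.codes, fun _ _ h => codes_injective (Enc.inj h)⟩

theorem enc_map {α β : Type} [Enc α] [Enc β] {f : α → β} (hf : ∀ a, enc (f a) = enc a)
    (l : List α) : enc (l.map f) = enc l := by
  induction l with
  | nil => rfl
  | cons a l ih =>
    change Tree.node (enc (f a)) (enc (l.map f)) = Tree.node (enc a) (enc l)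
    rw [hf, ih]

/-- One step in reading a word from right to left; the numbers are kept as lists of bits. -/
def readSym (s : Sym) (L : List (List (List Bool))) : List (List (List Bool)) :=
  bif eqb s .semi then [] :: L
  else bif eqb s .comma then ([] :: L.headD []) :: L.tail
  else ((eqb s (.bit true) :: (L.headD []).headD []) :: (L.headD []).tail) :: L.tail

/-- The lists of numbers in a word. -/
def readWord (w : List Sym) : List (List (List Bool)) := w.foldr readSym []

theorem size_headD_le {α : Type} [Enc α] (l : List (List α)) : size (l.headD []) + size l.tail ≤
    size l + 1 := by
  cases l <;> simp; omega

theorem size_readSym (s : Sym) (L : List (List (List Bool))) :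
    size (readSym s L) ≤ size L + 9 := by
  have h₁ := size_headD_le L
  have h₂ := size_headD_le (L.headD [])
  unfold readSym
  cases eqb s .semi <;> cases eqb s .comma <;>
    simp only [cond_true, cond_false, size_cons, size_nil, size_bool] <;> omega

theorem Poly.readWord {α : Type} [Enc α] {f : α → List Sym} (hf : Poly aux f) :
    Poly aux fun a => readWord (f a) := by
  refine foldr (s := fun _ s L => readSym s L) (T := fun a => 9 * size (f a) + 1) hf (const _) ?_
    (((Bd.const 9).mul hf.bd_size).add (Bd.const 1)) fun a l' hl' => ?_
  · unfold readSym; fun_prop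
  · have h₁ := hl'.length_le
    have h₂ := length_le_size (f a)
    have h₃ : size (l'.foldr readSym []) ≤ 9 * l'.length + 1 := by
      clear * -
      induction l' with
      | nil => simp
      | cons s l ih =>
        have := size_readSym s (l.foldr readSym [])
        rw [List.foldr_cons, List.length_cons]
        omega
    exact h₃.trans (by omega)

theorem readWord_encodeTBox (T : List TBoxAxiom) :
    readWord (encodeTBox T) = T.map fun α => α.codes.map Nat.bits := by
  have h₁ : ∀ (l m : List Bool) (x : List (List Bool)) (L : List (List (List Bool))),
      (l.map Sym.bit).foldr readSym ((m :: x) :: L) = ((l ++ m) :: x) :: L := by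
    intro l m x L
    induction l with
    | nil => rfl
    | cons b l ih =>
      rw [List.map_cons, List.foldr_cons, ih]
      cases b <;> simp [readSym, eqb_eq_decide]
  have h₂ : ∀ (l : List ℕ) (x : List (List Bool)) (L : List (List (List Bool))),
      (l.flatMap encodeNat).foldr readSym (x :: L) = (l.map Nat.bits ++ x) :: L := by
    intro l x L
    induction l with
    | nil => rfl
    | cons k l ih =>
      rw [List.flatMap_cons, List.foldr_append, ih, encodeNat, List.foldr_append]
      simp [readSym, eqb_eq_decide, h₁]
  induction T with
  | nil => rfl
  | cons α T ih =>
    rw [readWord, encodeTBox] at *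
    rw [List.flatMap_cons, List.foldr_append, ih, encodeNats, List.foldr_append]
    simp [readSym, eqb_eq_decide, h₂]

theorem enc_readWord (T : List TBoxAxiom) : enc (readWord (encodeTBox T)) = enc T := by
  rw [readWord_encodeTBox]
  exact enc_map (fun α => enc_map (f := Nat.bits) (fun _ => rfl) α.codes) T

/-- A TBox that is given as a word: unlike for a list of axioms, its tree is that of the word. -/
structure TBoxWord where
  /-- the axioms -/
  axs : List TBoxAxiom

instance : Enc TBoxWord := ⟨fun T => enc (encodeTBox T.axs), fun T T' h => by
  have h₁ := congrArg (fun w => enc (readWord w)) (Enc.inj h)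
  simp only [enc_readWord] at h₁
  exact congrArg TBoxWord.mk (Enc.inj h₁)⟩

theorem Poly.axs : Poly aux TBoxWord.axs :=
  (readWord id).of_enc_eq (fun T : TBoxWord => encodeTBox T.axs) (fun _ => rfl) fun T =>
    (enc_readWord T.axs).symm

/-! ### The rules of a TBox -/

/-- The concept name with the given number. -/
def ofCode : ℕ → ConceptName
  | 0 => .top
  | 1 => .bot
  | k + 2 => .name k

@[simp] theorem code_ofCode (k : ℕ) : (ofCode k).code = k := by
  rcases k with _ | _ | k <;> rfl

@[simp] theorem ofCode_code (A : ConceptName) : ofCode A.code = A := code_injective (by simp)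

/-- The number at position `i`. -/
def nth (i : ℕ) (c : List ℕ) : ℕ := (c.drop i).headD 0

/-- The concept name at position `i`. -/
def cn (i : ℕ) (c : List ℕ) : ConceptName := ofCode (nth i c)

/-- The TGDs without existential variables for an axiom, given by its numbers. -/
def tgdsOf (c : List ℕ) : List (List (Atom Var) × List (Atom Var)) :=
  bif eqb (nth 0 c) 0 then
    [((c.drop 2).map fun k => .concept (ofCode k) 0, [.concept (cn 1 c) 0])]
  else bif eqb (nth 0 c) 1 then
    [([.concept (cn 1 c) 0, .role (nth 2 c) 0 1], [.concept (cn 3 c) 1])]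
  else bif eqb (nth 0 c) 4 then [([.role (nth 1 c) 0 1], [.role (nth 2 c) 0 1])]
  else bif eqb (nth 0 c) 5 then [([.role (nth 1 c) 1 0], [.role (nth 2 c) 0 1])]
  else bif eqb (nth 0 c) 6 then
    [([.role (nth 1 c) 0 1, .role (nth 2 c) 1 2], [.role (nth 3 c) 0 2])]
  else []

/-- The existential rules for an axiom. -/
def exsOf (c : List ℕ) : List ExAxiom :=
  bif eqb (nth 0 c) 3 then [⟨cn 1 c, nth 2 c, cn 3 c⟩] else []

/-- The bodies of the EGDs for an axiom. -/
def egdsOf (c : List ℕ) : List (List (Atom Var)) :=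
  bif eqb (nth 0 c) 2 then [[.concept (cn 1 c) 0, .role (nth 2 c) 0 1, .concept (cn 3 c) 1,
    .role (nth 2 c) 0 2, .concept (cn 3 c) 2]] else []

/-- Body and head of the rule `topRule a`. -/
def topPair (a : Atom Var) : List (Atom Var) × List (Atom Var) :=
  ([relabel₂ 0 1 a], bif eqb (key a).1 0 then [.concept .top 0]
    else [.concept .top 0, .concept .top 1])

/-- The rules of a TBox. -/
def ruleData (T : List TBoxAxiom) : RuleData :=
  ((T.flatMap fun α => tgdsOf α.codes) ++ (T.flatMap fun α =>
      (tgdsOf α.codes).flatMap (fun r => r.1 ++ r.2) ++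
        ((exsOf α.codes).flatMap exAtoms ++ (egdsOf α.codes).flatMap fun b => b)).map topPair,
    T.flatMap fun α => exsOf α.codes, T.flatMap fun α => egdsOf α.codes)

namespace Poly

variable {α : Type} [Enc α]

@[fun_prop]
theorem ofCode {f : α → ℕ} (hf : Poly aux f) : Poly aux fun a => ofCode (f a) :=
  hf.of_enc_eq (fun a => a) (fun _ => rfl) fun a => congrArg enc (code_ofCode (f a))

@[fun_prop]
theorem codes {f : α → TBoxAxiom} (hf : Poly aux f) : Poly aux fun a => (f a).codes :=
  hf.of_enc_eq (fun a => a) (fun _ => rfl) fun _ => rfl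

@[fun_prop]
theorem nth (i : ℕ) {f : α → List ℕ} (hf : Poly aux f) : Poly aux fun a => nth i (f a) := by
  unfold StackMachine.nth; fun_prop

@[fun_prop]
theorem cn (i : ℕ) {f : α → List ℕ} (hf : Poly aux f) : Poly aux fun a => cn i (f a) := by
  unfold StackMachine.cn; fun_prop

@[fun_prop]
theorem tgdsOf {f : α → List ℕ} (hf : Poly aux f) : Poly aux fun a => tgdsOf (f a) := by
  unfold StackMachine.tgdsOf; fun_prop

@[fun_prop]
theorem exsOf {f : α → List ℕ} (hf : Poly aux f) : Poly aux fun a => exsOf (f a) := by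
  unfold StackMachine.exsOf; fun_prop

@[fun_prop]
theorem egdsOf {f : α → List ℕ} (hf : Poly aux f) : Poly aux fun a => egdsOf (f a) := by
  unfold StackMachine.egdsOf; fun_prop

@[fun_prop]
theorem topPair {f : α → Atom Var} (hf : Poly aux f) : Poly aux fun a => topPair (f a) := by
  unfold StackMachine.topPair; fun_prop

@[fun_prop]
theorem ruleData {f : α → List TBoxAxiom} (hf : Poly aux f) :
    Poly aux fun a => ruleData (f a) := by
  unfold StackMachine.ruleData; fun_prop

end Poly

theorem tgd_eq_toRule {b h : List (Atom Var)} {α : TBoxAxiom} :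
    Rule.tgd b h = α.toRule ↔ (b, h) ∈ tgdsOf α.codes := by
  cases α <;> simp [TBoxAxiom.toRule, tgdsOf, TBoxAxiom.codes, nth, cn, eqb_eq_decide,
    Function.comp_def]

theorem ex_eq_toRule {ρ : ExAxiom} {α : TBoxAxiom} :
    Rule.ex ρ = α.toRule ↔ ρ ∈ exsOf α.codes := by
  cases α <;> simp [TBoxAxiom.toRule, exsOf, TBoxAxiom.codes, nth, cn, eqb_eq_decide]

theorem egd_eq_toRule {b : List (Atom Var)} {v w : Var} {α : TBoxAxiom} :
    Rule.egd b v w = α.toRule ↔ b ∈ egdsOf α.codes ∧ v = 1 ∧ w = 2 := by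
  cases α <;> simp [TBoxAxiom.toRule, egdsOf, TBoxAxiom.codes, nth, cn, eqb_eq_decide]

theorem mem_atoms_toRule {a : Atom Var} {α : TBoxAxiom} : a ∈ α.toRule.atoms ↔
    a ∈ (tgdsOf α.codes).flatMap (fun r => r.1 ++ r.2) ++
      ((exsOf α.codes).flatMap exAtoms ++ (egdsOf α.codes).flatMap fun b => b) := by
  cases α <;> simp [TBoxAxiom.toRule, Rule.atoms, tgdsOf, exsOf, egdsOf, exAtoms,
    TBoxAxiom.codes, nth, cn, eqb_eq_decide, Function.comp_def]

theorem topRule_eq (a : Atom Var) : topRule a = .tgd (topPair a).1 (topPair a).2 := by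
  cases a <;> simp [topRule, topPair, relabel₂, key, eqb_eq_decide]

section Good

variable {T : List TBoxAxiom}

theorem mem_tgds {b h : List (Atom Var)} :
    Rule.tgd b h ∈ rulesOf {α | α ∈ T} ↔ (b, h) ∈ (ruleData T).1 := by
  simp only [rulesOf, Set.mem_union, Set.mem_ofPred_eq, tgd_eq_toRule, ruleData, List.mem_append,
    List.mem_flatMap, List.mem_map, mem_atoms_toRule, topRule_eq, Rule.tgd.injEq]
  refine or_congr Iff.rfl ?_
  constructor
  · rintro ⟨α, hα, a, ha, h₁, h₂⟩
    exact ⟨a, ⟨α, hα, ha⟩, Prod.ext h₁.symm h₂.symm⟩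
  · rintro ⟨a, ⟨α, hα, ha⟩, h⟩
    exact ⟨α, hα, a, ha, (congrArg Prod.fst h).symm, (congrArg Prod.snd h).symm⟩

theorem mem_exs {ρ : ExAxiom} : Rule.ex ρ ∈ rulesOf {α | α ∈ T} ↔ ρ ∈ (ruleData T).2.1 := by
  simp [rulesOf, ex_eq_toRule, ruleData, topRule_eq]

theorem mem_egds {b : List (Atom Var)} {v w : Var} : Rule.egd b v w ∈ rulesOf {α | α ∈ T} ↔
    b ∈ (ruleData T).2.2 ∧ v = 1 ∧ w = 2 := by
  simp only [rulesOf, Set.mem_union, Set.mem_ofPred_eq, egd_eq_toRule, ruleData, topRule_eq,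
    reduceCtorEq, and_false, exists_false, or_false, List.mem_flatMap]
  exact ⟨fun ⟨α, h, h'⟩ => ⟨⟨α, h, h'.1⟩, h'.2⟩, fun ⟨⟨α, h, h'⟩, h''⟩ => ⟨α, h, h', h''⟩⟩

theorem head_vars : ∀ r ∈ (ruleData T).1, ∀ a ∈ r.2, ∀ v ∈ a.args, ∃ b ∈ r.1, v ∈ b.args := by
  rintro ⟨b, h⟩ hr
  rcases mem_tgds.2 hr with ⟨α, -, e⟩ | ⟨α, -, a, -, e⟩
  · cases α <;> simp only [TBoxAxiom.toRule, Rule.tgd.injEq, reduceCtorEq] at e <;>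
      obtain ⟨rfl, rfl⟩ := e <;> simp [Atom.args]
  · cases a <;> simp only [topRule, Rule.tgd.injEq] at e <;>
      obtain ⟨rfl, rfl⟩ := e <;> simp [Atom.args]

theorem egd_vars : ∀ b ∈ (ruleData T).2.2,
    (∃ a ∈ b, (1 : Var) ∈ a.args) ∧ ∃ a ∈ b, (2 : Var) ∈ a.args := by
  intro b hb
  rcases mem_egds.2 ⟨hb, rfl, rfl⟩ with ⟨α, -, e⟩ | ⟨α, -, a, -, e⟩
  · cases α <;> simp only [TBoxAxiom.toRule, Rule.egd.injEq, reduceCtorEq] at e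
    obtain ⟨rfl, -⟩ := e
    simp [Atom.args]
  · simp [topRule_eq] at e

end Good

/-! ### The terms up to a given depth -/

theorem Bd.two_pow {α : Type} [Enc α] {t : α → ℕ} (ht : Bd .poly t) :
    Bd .exp fun a => 2 ^ t a :=
  ht.imp fun _ h a => Nat.pow_le_pow_right two_pos (h a)

/-- One round in the construction of the terms. -/
def extend (l : List ExAxiom) (L : List Tm) : List Tm :=
  [] :: l.flatMap fun ρ => L.map fun t => ρ :: t

/-- A list whose length is sufficient as depth. -/
def depthClock (n : ℕ) (l : List ExAxiom) : List Unit :=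
  () :: (List.replicate n ()).flatMap fun _ => l.map fun _ => ()

/-- The terms over the function symbols in `l`. -/
def termsOver (n : ℕ) (l : List ExAxiom) : List Tm :=
  (depthClock n l).foldl (fun L _ => extend l L) [[]]

theorem length_depthClock (n : ℕ) (l : List ExAxiom) :
    (depthClock n l).length = n * l.length + 1 := by
  simp [depthClock, List.length_flatMap]

theorem mem_extend_iterate {l : List ExAxiom} {k : ℕ} {t : Tm} :
    t ∈ (extend l)^[k] [[]] ↔ t.length ≤ k ∧ ∀ ρ ∈ t, ρ ∈ l := by
  induction k generalizing t with
  | zero => simp +contextual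
  | succ k ih =>
    rw [Function.iterate_succ_apply', extend]
    cases t with
    | nil => simp
    | cons ρ t =>
      simp only [List.mem_cons, reduceCtorEq, false_or, List.mem_flatMap, List.mem_map,
        List.cons.injEq, List.length_cons, Nat.add_le_add_iff_right, forall_eq_or_imp]
      constructor
      · rintro ⟨ρ', hρ, u, hu, rfl, rfl⟩
        exact ⟨(ih.1 hu).1, hρ, (ih.1 hu).2⟩
      · rintro ⟨h₁, h₂, h₃⟩
        exact ⟨ρ, h₂, t, ih.2 ⟨h₁, h₃⟩, rfl, rfl⟩

theorem mem_termsOver {n : ℕ} {l : List ExAxiom} {t : Tm} :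
    t ∈ termsOver n l ↔ t.length ≤ n * l.length + 1 ∧ ∀ ρ ∈ t, ρ ∈ l := by
  rw [termsOver, List.foldl_const, length_depthClock, mem_extend_iterate]

theorem length_extend_iterate_le (l : List ExAxiom) (k : ℕ) :
    ((extend l)^[k] [[]]).length ≤ (l.length + 1) ^ k := by
  induction k with
  | zero => simp
  | succ k ih =>
    have h : ∀ L : List Tm, (extend l L).length = l.length * L.length + 1 := fun L => by
      simp [extend, List.length_flatMap]
    rw [Function.iterate_succ_apply', h, pow_succ']
    have h₁ := Nat.mul_le_mul_left l.length ih
    have h₂ := Nat.one_le_pow k (l.length + 1) (by omega)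
    rw [add_mul, one_mul]
    omega

theorem size_term_le {l : List ExAxiom} {k : ℕ} {t : Tm} (h₁ : t.length ≤ k)
    (h₂ : ∀ ρ ∈ t, ρ ∈ l) : size t ≤ k * (size l + 1) + 1 :=
  (size_le_of_forall fun ρ hρ => size_le_of_mem (h₂ ρ hρ)).trans
    (Nat.add_le_add_right (Nat.mul_le_mul_right _ h₁) 1)

section TermsOver

variable {α : Type} [Enc α] {f : α → List ExAxiom}

theorem Comp.termsOver (n : ℕ) (hf : Poly aux f) : Comp aux .exp fun a => termsOver n (f a) := by
  have hclock : Poly aux fun a => depthClock n (f a) := by unfold depthClock; fun_prop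
  have hstep : Poly aux fun z : α × List Tm × Unit => extend (f z.1) z.2.1 := by
    unfold extend; fun_prop
  have hs := hf.bd_size
  have hk : Bd .poly fun a => n * size (f a) + 1 := ((Bd.const n).mul hs).add (Bd.const 1)
  refine Comp.foldl_poly (i := fun _ => [[]]) hclock.exp_of_poly
    (Poly.const (aux := aux) [[]]).exp_of_poly hstep
    (T := fun a => 2 ^ (size (f a) * (n * size (f a) + 1)) *
      ((n * size (f a) + 1) * (size (f a) + 1) + 1 + 1) + 1) ?_ fun a l' hl' => ?_
  · exact ((hs.mul hk).two_pow.mul ((((hk.mul (hs.add (Bd.const 1))).add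
      (Bd.const 1)).add (Bd.const 1)).exp_of_poly)).add (Bd.const 1)
  · have h₁ := length_le_size (f a)
    have h₂ : l'.length ≤ n * size (f a) + 1 := by
      refine hl'.length_le.trans ?_
      rw [length_depthClock]
      exact Nat.add_le_add_right (Nat.mul_le_mul_left n h₁.le) 1
    rw [List.foldl_const]
    refine (size_le_of_forall (k := (n * size (f a) + 1) * (size (f a) + 1) + 1)
      fun t ht => ?_).trans (Nat.add_le_add_right (Nat.mul_le_mul_right _ ?_) 1)
    · obtain ⟨h₃, h₄⟩ := mem_extend_iterate.1 ht
      exact size_term_le (h₃.trans h₂) h₄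
    · calc _ ≤ ((f a).length + 1) ^ l'.length := length_extend_iterate_le _ _
        _ ≤ (2 ^ size (f a)) ^ l'.length :=
          Nat.pow_le_pow_left (h₁.trans Nat.lt_two_pow_self) _
        _ = 2 ^ (size (f a) * l'.length) := (pow_mul ..).symm
        _ ≤ _ := Nat.pow_le_pow_right two_pos (Nat.mul_le_mul_left _ h₂)

theorem bd_size_termsOver (n : ℕ) (hf : Poly aux f) :
    ∃ u, Bd .poly u ∧ ∀ a, ∀ t ∈ StackMachine.termsOver n (f a), size t ≤ u a := by
  have hs := hf.bd_size
  refine ⟨fun a => (n * size (f a) + 1) * (size (f a) + 1) + 1,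
    ((((Bd.const n).mul hs).add (Bd.const 1)).mul (hs.add (Bd.const 1))).add (Bd.const 1),
    fun a t ht => ?_⟩
  obtain ⟨h₁, h₂⟩ := mem_termsOver.1 ht
  have h₃ := Nat.mul_le_mul_left n (length_le_size (f a)).le
  exact size_term_le (h₁.trans (by omega)) h₂

end TermsOver

/-! ### The table of the term order -/

/-- The elements that satisfy `p`, in reverse order. -/
def collect {β : Type} (p : β → Bool) (l : List β) : List β :=
  l.foldl (fun L b => bif p b then b :: L else L) []

theorem mem_collect {β : Type} {p : β → Bool} {l : List β} {b : β} :
    b ∈ collect p l ↔ b ∈ l ∧ p b = true := by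
  have h : ∀ L, b ∈ l.foldl (fun L b => bif p b then b :: L else L) L ↔
      b ∈ L ∨ b ∈ l ∧ p b = true := by
    induction l with
    | nil => simp
    | cons c l ih =>
      intro L
      rw [List.foldl_cons, ih]
      cases hc : p c
      · simp only [cond_false, List.mem_cons]
        constructor
        · rintro (h | h)
          · exact .inl h
          · exact .inr ⟨.inr h.1, h.2⟩
        · rintro (h | ⟨rfl | h, h'⟩)
          · exact .inl h
          · simp [hc] at h'
          · exact .inr ⟨h, h'⟩
      · simp only [cond_true, List.mem_cons]
        constructor
        · rintro ((rfl | h) | h)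
          · exact .inr ⟨.inl rfl, hc⟩
          · exact .inl h
          · exact .inr ⟨.inr h.1, h.2⟩
        · rintro (h | ⟨rfl | h, h'⟩)
          · exact .inl (.inr h)
          · exact .inl (.inl rfl)
          · exact .inr ⟨h, h'⟩
  simpa [collect] using h []

/-- An exponential test may be applied to exponentially many elements if these are of polynomial
size. -/
theorem Comp.collect {α β : Type} [Enc α] [Enc β] {l : α → List β} {p : β → Bool}
    (hl : Comp aux .exp l) (hp : Comp aux .exp p) {u : α → ℕ} (hu : Bd .poly u)
    (hlu : ∀ a, ∀ b ∈ l a, size b ≤ u a) :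
    Comp aux .exp fun a => StackMachine.collect p (l a) := by
  obtain ⟨t, ⟨c, ht⟩, hp⟩ := hp
  have hb : Poly aux fun z : α × List β × β => z.2.2 := by fun_prop
  obtain ⟨t₁, ⟨c₁, ht₁⟩, h₁⟩ := hb
  obtain ⟨t₂, ⟨c₂, ht₂⟩, h₂⟩ := Poly.id (aux := aux) (α := α × List β × β)
  have h₃ : Poly aux fun z : Bool × α × List β × β =>
      bif z.1 then z.2.2.2 :: z.2.2.1 else z.2.2.1 := by fun_prop
  obtain ⟨t₃, ⟨c₃, ht₃⟩, h₃⟩ := h₃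
  obtain ⟨s, hs, hls⟩ := hl.exists_size_le
  -- a bound for the size of the argument in each step
  have hz : Bd .exp fun a : α => size a + (s a + 1) + s a + 5 :=
    ((Bd.size.add (hs.add (Bd.const 1))).add hs).add (Bd.const 5)
  have hsize : ∀ a l', l' <+: l a → size (StackMachine.collect p l') ≤ s a := by
    intro a l' hl'
    have key : ∀ l' : List β, size (StackMachine.collect p l') ≤ size l' := by
      intro l'
      have h : ∀ L, size (l'.foldl (fun L b => bif p b then b :: L else L) L) + 1 ≤
          size L + size l' := by
        induction l' with
        | nil => simp
        | cons b l' ih =>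
          intro L
          have h₁ := ih (b :: L)
          have h₂ := ih L
          rw [List.foldl_cons]
          cases p b <;> simp only [cond_true, cond_false, size_cons] at * <;> omega
      have := h []
      rw [size_nil] at this
      exact Nat.le_of_add_le_add_right (by rw [StackMachine.collect]; omega : _ + 1 ≤ _ + 1)
    exact (key l').trans ((size_le_of_prefix hl').trans (hls a))
  refine Comp.foldl (i := fun _ => []) hl (Poly.const (aux := aux) []).exp_of_poly
    (h₃.comp (Within.pair (hp.comp h₁) h₂))
    (T := fun a => s a + (((((size a + (s a + 1) + s a + 5) ^ c₁ + 2 ^ (u a + 2) ^ c) +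
      (size a + (s a + 1) + s a + 5) ^ c₂) + 10 * ((size a + (s a + 1) + s a + 5) +
      (size a + (s a + 1) + s a + 5) ^ c₂) + 12) + (size a + (s a + 1) + s a + 5) ^ c₃)) ?_ ?_ ?_
  · have e : Bd .exp fun a => 2 ^ (u a + 2) ^ c := ((hu.add (Bd.const 2)).pow c).two_pow
    exact hs.add ((((((hz.pow c₁).add e).add (hz.pow c₂)).add ((Bd.const 10).mul
      (hz.add (hz.pow c₂)))).add (Bd.const 12)).add (hz.pow c₃))
  · exact fun a l' hl' => (hsize a l' hl').trans (Nat.le_add_right _ _)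
  · intro a l' b hb
    have e₁ := hsize a l' ((List.prefix_append _ _).trans hb)
    have hmem : b ∈ l a := hb.subset (by simp)
    have e₂ := (size_le_of_mem hmem).trans (hls a)
    have e₃ : size (a, StackMachine.collect p l', b) + 4 ≤ size a + (s a + 1) + s a + 5 := by
      simp only [size_pair]; omega
    have f₁ := (ht₁ (a, StackMachine.collect p l', b)).trans
      (Nat.pow_le_pow_left (by omega : _ ≤ size a + (s a + 1) + s a + 5) c₁)
    have f₂ := (ht₂ (a, StackMachine.collect p l', b)).trans
      (Nat.pow_le_pow_left (by omega : _ ≤ size a + (s a + 1) + s a + 5) c₂)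
    have f₃ := (ht₃ (p b, a, StackMachine.collect p l', b)).trans
      (Nat.pow_le_pow_left (by rw [size_pair, size_bool]; omega :
        _ ≤ size a + (s a + 1) + s a + 5) c₃)
    have f₄ := (ht b).trans (Nat.pow_le_pow_right two_pos
      (Nat.pow_le_pow_left (Nat.add_le_add_right (hlu a b hmem) 2) c))
    simp only [StackMachine.collect] at *
    omega

/-- The word for a pair of terms. -/
def pairWord (z : Tm × Tm) : List Sym := encodeTermPair (toTerm z.1, toTerm z.2)

theorem Poly.pairWord : Poly aux pairWord := by
  have hbits : Poly aux fun k : ℕ => k.bits := id.of_enc_eq (fun k => k) (fun _ => rfl) fun _ => rfl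
  have hbit : Poly aux Sym.bit := id.of_enc_eq (fun b => b) (fun _ => rfl) fun _ => rfl
  have hnat : Poly aux encodeNat := by unfold encodeNat; fun_prop
  have hnats : Poly aux encodeNats := by unfold encodeNats; fun_prop
  have hcodes : ∀ t : Tm,
      (toTerm t).codes = (t.flatMap fun ρ => [ρ.A.code, ρ.R, ρ.B.code]) ++ [0] := by
    intro t
    induction t with
    | nil => rfl
    | cons ρ t ih => simp [toTerm, Term.codes, ih]
  unfold StackMachine.pairWord encodeTermPair
  simp only [hcodes]
  fun_prop

/-! ### The environment of a TBox -/

theorem enc_word (w : List Sym) : enc w = wordTree w := by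
  induction w with
  | nil => rfl
  | cons s w ih =>
    change Tree.node (enc s) (enc w) = _
    rw [ih]
    rfl

/-- Polynomials are bounded by the powers used for `Bd`. -/
theorem exists_eval_le (p : Polynomial ℕ) : ∃ c, ∀ k x, k ≤ x → p.eval k ≤ (x + 2) ^ c := by
  induction p using Polynomial.induction_on' with
  | add p q hp hq =>
    obtain ⟨c, hc⟩ := hp
    obtain ⟨d, hd⟩ := hq
    refine ⟨c + d + 1, fun k x h => ?_⟩
    rw [Polynomial.eval_add]
    exact (Nat.add_le_add (hc k x h) (hd k x h)).trans (Bd.pow_add_pow_le (by omega) c d)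
  | monomial i a =>
    refine ⟨a + i, fun k x h => ?_⟩
    rw [Polynomial.eval_monomial, pow_add]
    exact Nat.mul_le_mul (Nat.lt_two_pow_self.le.trans (Nat.pow_le_pow_left (by omega) a))
      (Nat.pow_le_pow_left (by omega) i)

/-- A machine for the term order may be used as an oracle. -/
theorem comp_oracle {f : Term × Term → Bool}
    (M : TM2ComputableInTime encodeTermPair Computability.encodeBool f) {p : Polynomial ℕ}
    (hM : ∀ k, M.time k ≤ 2 ^ p.eval k) :
    Comp M.toTM2ComputableAux .exp fun z : Tm × Tm => f (toTerm z.1, toTerm z.2) := by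
  obtain ⟨t, ht, N, hN⟩ := Poly.pairWord (aux := M.toTM2ComputableAux)
  obtain ⟨c, hc⟩ := exists_eval_le p
  refine Comp.of_computes (Mach.seq N oracle) (u := fun _ => 1)
    (t := fun z => t z + (4 * t z + 2 ^ (t z + 2) ^ c + 6)) ?_ (Bd.const 1) (fun z => ?_)
    fun _ => le_rfl
  · exact ht.exp_of_poly.add ((((Bd.const 4).mul ht.exp_of_poly).add
      ((ht.add (Bd.const 2)).pow c).two_pow).add (Bd.const 6))
  · obtain ⟨h₁, h₂⟩ := hN z
    have h₃ : (pairWord z).length ≤ t z := (length_le_size _).le.trans h₁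
    rw [enc_word] at h₂
    refine (h₂.seq (oracle_on (M.outputsFun (toTerm z.1, toTerm z.2)))).mono ?_
    have h₄ : M.time (pairWord z).length ≤ 2 ^ (t z + 2) ^ c :=
      (hM _).trans (Nat.pow_le_pow_right two_pos (hc _ _ h₃))
    change t z + (4 * (pairWord z).length + M.time (pairWord z).length + 6) ≤ _
    omega

/-- The environment of a TBox for deciding `RCA_n`, when the order is given by `g`. -/
def envOf (g : Tm × Tm → Bool) (n : ℕ) (T : List TBoxAxiom) : Env :=
  (ruleData T, termsOver n (ruleData T).2.1,
    collect g (Env.pairs (ruleData T, termsOver n (ruleData T).2.1, [])))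

theorem good_envOf {gt : Term → Term → Prop} {g : Tm × Tm → Bool}
    (hg : ∀ z, g z = true ↔ gt (toTerm z.1) (toTerm z.2)) (n : ℕ) (T : List TBoxAxiom) :
    Good gt {α | α ∈ T} (n * (ruleData T).2.1.length + 1) (envOf g n T) where
  tgd _ _ := mem_tgds
  ex _ := mem_exs
  egd _ _ _ := mem_egds
  terms _ := mem_termsOver
  gts t u := by
    refine mem_collect.trans ?_
    rw [mem_pairs, hg, and_assoc]
    rfl
  head_vars := head_vars
  egd_vars := egd_vars

theorem comp_envOf {g : Tm × Tm → Bool} (hg : Comp aux .exp g) (n : ℕ) :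
    Comp aux .exp fun T : TBoxWord => envOf g n T.axs := by
  have hT : Poly aux fun T : TBoxWord => T.axs := Poly.axs
  have h₁ : Poly aux fun T : TBoxWord => ruleData T.axs := by fun_prop
  have h₂ : Poly aux fun T : TBoxWord => (ruleData T.axs).2.1 := by fun_prop
  have h₃ := Comp.termsOver n h₂
  have h₄ : Poly aux fun z : RuleData × List Tm => Env.pairs (z.1, z.2, []) := by fun_prop
  have h₅ := Comp.comp h₄ (Comp.pair (Comp.exp_of_poly (m := .exp) h₁) h₃)
  obtain ⟨u, hu, h⟩ := bd_size_termsOver n h₂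
  refine Comp.pair h₁.exp_of_poly (Comp.pair h₃ (Comp.collect h₅ hg
    (u := fun T => u T + u T + 1) ((hu.add hu).add (Bd.const 1)) fun T z hz => ?_))
  obtain ⟨h₆, h₇⟩ := mem_pairs.1 hz
  have h₆ := h T _ h₆
  have h₇ := h T _ h₇
  rw [size_pair z.1 z.2]
  omega

/-! ### The Turing machine -/

theorem Runs.iterate {K : Type} [DecidableEq K] {Γ : K → Type} {σ Λ : Type}
    {m : Λ → TM2.Stmt Γ Λ σ} {q v S v' S' k} (h : Runs m q v S v' S' k) :
    ∃ j < k, (flip bind (TM2.step m))^[j] (some (TM2.stepAux q v S)) = some ⟨none, v', S'⟩ := by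
  induction h with
  | halt k h => exact ⟨0, Nat.succ_pos k, congrArg some h⟩
  | step h _ ih =>
    obtain ⟨j, hj, e⟩ := ih
    refine ⟨j + 1, Nat.succ_lt_succ hj, ?_⟩
    rw [Function.iterate_succ_apply, h]
    exact e

/-- The Turing machine that runs a program on its own stacks and those of the oracle. -/
abbrev machine (M : Machine aux) : FinTM2 :=
  have := aux.tm.kFin
  have := aux.tm.σFin
  have := M.fin
  { K := Stack aux
    k₀ := .inl .inp
    k₁ := .inl .out
    Γ := Gam aux
    Λ := M.Λ
    main := M.main
    σ := Sta aux
    initialState := v0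
    Γk₀Fin := inferInstanceAs (Fintype Sym)
    m := M.code }

theorem exists_outputs {M : Machine aux} {w : List Sym} {x : Bool} {k : ℕ}
    (h : M.Runs v0 (store w [] [] [] [] [] fun _ => []) v0 (store [] [x] [] [] [] [] fun _ => [])
      k) : Nonempty (TM2OutputsInTime (machine M) w (some [x]) k) := by
  obtain ⟨j, hj, e⟩ := Runs.iterate h
  have h₀ : (fun _ => [] : ∀ k, List (Gam aux k)) = store [] [] [] [] [] [] fun _ => [] := by
    funext k
    rcases k with (_ | _ | _ | _ | _ | _) | k <;> rfl
  have h₁ : (initList (machine M) w).stk = store w [] [] [] [] [] fun _ => [] := by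
    refine (initList_stk (machine M) w).trans ?_
    refine (congrArg (fun S => Function.update S (Sum.inl Wk.inp) w) h₀).trans ?_
    exact update_store_inp ..
  have h₂ : (haltList (machine M) [x]).stk = store [] [x] [] [] [] [] fun _ => [] := by
    refine (haltList_stk (machine M) [x]).trans ?_
    refine (congrArg (fun S => Function.update S (Sum.inl Wk.out) [x]) h₀).trans ?_
    exact update_store_out ..
  refine ⟨⟨⟨j + 1, ?_⟩, hj⟩⟩
  rw [Function.iterate_succ_apply]
  have e₁ : (initList (machine M) w : TM2.Cfg (Gam aux) M.Λ (Sta aux)) =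
      ⟨some M.main, v0, store w [] [] [] [] [] fun _ => []⟩ := by rw [← h₁]; rfl
  have e₂ : (haltList (machine M) [x] : TM2.Cfg (Gam aux) M.Λ (Sta aux)) =
      ⟨none, v0, store [] [x] [] [] [] [] fun _ => []⟩ := by rw [← h₂]; rfl
  change (flip bind (TM2.step M.code))^[j] (TM2.step M.code (initList (machine M) w)) =
    some (haltList (machine M) [x])
  rw [e₁, e₂]
  exact e

/-- A function on TBoxes that is computable in exponential time is decidable in exponential
time by a Turing machine. -/
theorem inExpTime_of_comp {f : List TBoxAxiom → Bool} {L : List TBoxAxiom → Prop}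
    (h : Comp aux .exp fun T : TBoxWord => f T.axs) (hf : ∀ T, f T = true ↔ L T) :
    InExpTime encodeTBox L := by
  obtain ⟨t, ⟨c, ht⟩, M, hM⟩ := h
  let N : Machine aux := Mach.seq readInput (Mach.seq M writeOutput)
  let p : Polynomial ℕ := (2 * .X + 3) ^ c + (4 * .X + 5)
  have hp : ∀ k, p.eval k = (2 * k + 3) ^ c + (4 * k + 5) := fun k => by simp [p]
  have hrun : ∀ T, N.Runs v0 (store (encodeTBox T) [] [] [] [] [] fun _ => []) v0
      (store [] [f T] [] [] [] [] fun _ => []) (2 ^ p.eval (encodeTBox T).length) := by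
    intro T
    have h₁ := (hM ⟨T⟩).2 []
    have h₂ := ht ⟨T⟩
    have h₃ : enc (⟨T⟩ : TBoxWord) = wordTree (encodeTBox T) := enc_word _
    rw [size, h₃, size_wordTree] at h₂
    rw [h₃, List.append_nil, List.append_nil] at h₁
    refine (Mach.seq_runs (readInput_runs _) (Mach.seq_runs h₁ (writeOutput_runs (f T)))).mono ?_
    rw [hp, pow_add]
    generalize (encodeTBox T).length = k at *
    have h₄ : 4 * k + 6 ≤ 2 ^ (4 * k + 5) := Nat.lt_two_pow_self
    have h₅ : 1 ≤ 2 ^ (2 * k + 3) ^ c := Nat.one_le_two_pow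
    have h₆ : 2 ^ (2 * k + 3) ^ c * (4 * k + 6) ≤ 2 ^ (2 * k + 3) ^ c * 2 ^ (4 * k + 5) :=
      Nat.mul_le_mul_left _ h₄
    have h₇ : 4 * k + 5 ≤ 2 ^ (2 * k + 3) ^ c * (4 * k + 5) := Nat.le_mul_of_pos_left _ h₅
    have h₈ : 2 ^ (2 * k + 3) ^ c * (4 * k + 6) =
      2 ^ (2 * k + 3) ^ c * (4 * k + 5) + 2 ^ (2 * k + 3) ^ c := by ring
    simp only [show 2 * k + 1 + 2 = 2 * k + 3 by omega] at h₂
    omega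
  refine ⟨f, ⟨⟨machine N, Equiv.refl Sym, Equiv.refl Bool⟩, fun k => 2 ^ p.eval k, fun T => ?_⟩, p,
    hf, fun _ => le_rfl⟩
  have h : Nonempty (TM2OutputsInTime (machine N)
      (List.map (Equiv.refl Sym).invFun (encodeTBox T)) (some [f T]) (2 ^ p.eval
        (encodeTBox T).length)) := by
    rw [show List.map (Equiv.refl Sym).invFun (encodeTBox T) = encodeTBox T from List.map_id _]
    exact exists_outputs (hrun T)
  exact h.some

end StackMachine

theorem mainTheorem4 (gt : HornSRIQ.Term → HornSRIQ.Term → Prop)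
    (hgt : HornSRIQ.IsTermOrder gt)
    (hdec : InExpTime HornSRIQ.encodeTermPair (fun p => gt p.1 p.2)) (n : ℕ) :
    InExpTime HornSRIQ.encodeTBox (fun T => HornSRIQ.RCA gt n {α | α ∈ T}) := by
  obtain ⟨f, M, p, hf, hM⟩ := hdec
  let g := fun z : StackMachine.Tm × StackMachine.Tm =>
    f (StackMachine.toTerm z.1, StackMachine.toTerm z.2)
  have h₁ : StackMachine.Comp M.toTM2ComputableAux .exp fun T : StackMachine.TBoxWord =>
      StackMachine.envOf g n T.axs :=
    StackMachine.comp_envOf (StackMachine.comp_oracle M hM) n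
  have h₂ : StackMachine.Poly M.toTM2ComputableAux fun E : StackMachine.Env => E.accept n :=
    StackMachine.Poly.accept n StackMachine.Poly.id
  refine StackMachine.inExpTime_of_comp (f := fun T => (StackMachine.envOf g n T).accept n)
    (StackMachine.Comp.comp h₂ h₁) fun T => ?_
  exact StackMachine.accept_iff (StackMachine.good_envOf (fun _ => hf _) n T) hgt le_rfl
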